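/- Let $(W,S)$ be an irreducible finite Coxeter system of rank $n\ge 2$ with longest element $w_\circ$, and let ${\bf c}$ be a word in which every element of $S$ occurs exactly once, i.e. a reduced expression of a Coxeter element $c$; let $h$ be the Coxeter number (the order of $c$). Let ${\bf w}_\circ^{\bf c}$ be the ${\bf c}$-sorting word of $w_\circ$, that is, the reduced expression of $w_\circ$ that is the lexicographically first subword (as a sequence of positions) of ${\bf c}^\infty={\bf c}{\bf c}{\bf c}\cdots$, and let $\psi(w)=w_\circ^{-1}ww_\circ$, applied letterwise to words. Two words coincide up to commutations if one is obtained from the other by successively exchanging adjacent commuting letters. An element $w\in W$ is a $c$-singleton if some reduced expression of $w$ is a prefix of a word that coincides with ${\bf w}_\circ^{\bf c}$ up to commutations. The natural partial order on the letters of a word puts a letter $\sigma$ before a letter $\tau$ if there is a subword starting at $\sigma$ and ending at $\tau$ in which consecutive letters do not commute. The $2$-cover $\mathcal C^2_{\bf c}$ is the following directed graph. Its vertices are the letters of the concatenation ${\bf w}_\circ^{\bf c}\,\psi({\bf w}_\circ^{\bf c})$; this word coincides with ${\bf c}^h$ up to commutations, so its letters are identified with those of ${\bf c}^h$ (the $j$-th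 occurrence of $s\in S$ in one word corresponds to the $j$-th occurrence of $s$ in the other). Its directed edges are the images of the edges of the Hasse diagram of the natural partial order on the letters of ${\bf c}^\infty$ (directed from smaller to larger) under the projection that sends a letter of the copy number $hk+i$ of ${\bf c}$, $0\le i<h$, to the same letter of the copy number $i$ (copies are counted from $0$). Let $\mathcal C_{\psi({\bf w}_\circ^{\bf c})}$ be the subgraph of $\mathcal C^2_{\bf c}$ induced by the vertices that are letters of the second factor $\psi({\bf w}_\circ^{\bf c})$. A cut path of $\mathcal C^2_{\bf c}$ is a set $\kappa$ of edges of $\mathcal C^2_{\bf c}$ such that every directed cycle (without repeated vertices) of $\mathcal C^2_{\bf c}$ contains precisely one edge of $\kappa$. Then the set of $c$-singletons is in bijection with the set of cut paths of $\mathcal C^2_{\bf c}$ that contain no edge of $\mathcal C_{\psi({\bf w}_\circ^{\bf c})}$. -/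

import Mathlib

namespace CutPaths

/-! ### Words and the natural partial order -/

/-- The strict natural partial order on the letters of a (finite or infinite) word `g : ι → G`:
`i` precedes `j` if there is a subword that starts with the letter at position `i`, ends with the
letter at position `j`, and whose consecutive letters do not commute. -/
def NatLT {ι G : Type*} [LT ι] [Group G] (g : ι → G) : ι → ι → Prop :=
  Relation.TransGen fun i j => i < j ∧ ¬ Commute (g i) (g j)

/-- The covering relation of the natural partial order, that is, the directed edges `i → j` of its
Hasse diagram. -/
def NatCovBy {ι G : Type*} [LT ι] [Group G] (g : ι → G) (i j : ι) : Prop :=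
  NatLT g i j ∧ ∀ k, NatLT g i k → ¬ NatLT g k j

/-! ### Directed graphs and cut paths -/

/-- The set of directed edges of a directed graph. -/
def edgeSet {V : Type*} (G : Digraph V) : Set (V × V) :=
  {e | G.Adj e.1 e.2}

/-- The directed edges of the subgraph induced by a set `U` of vertices. -/
def inducedEdgeSet {V : Type*} (G : Digraph V) (U : Set V) : Set (V × V) :=
  {e | G.Adj e.1 e.2 ∧ e.1 ∈ U ∧ e.2 ∈ U}

/-- `v 0 → v 1 → ⋯ → v m → v 0` is a directed cycle: the vertices `v i` are pairwise distinct, and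
the addition `i + 1` in `Fin (m + 1)` is cyclic. -/
def IsDirectedCycle {V : Type*} (G : Digraph V) {m : ℕ} (v : Fin (m + 1) → V) : Prop :=
  Function.Injective v ∧ ∀ i, G.Adj (v i) (v (i + 1))

/-- A cut path is a set `κ` of edges such that every directed cycle contains precisely one edge
of `κ`. -/
def IsCutPath {V : Type*} (G : Digraph V) (κ : Set (V × V)) : Prop :=
  κ ⊆ edgeSet G ∧
    ∀ (m : ℕ) (v : Fin (m + 1) → V), IsDirectedCycle G v → ∃! i, (v i, v (i + 1)) ∈ κ

/-! ### Coxeter systems -/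

section Coxeter

variable {B W : Type*} [Group W] {M : CoxeterMatrix B} (cs : CoxeterSystem M W)

/-- The underlying graph of the Coxeter graph: two generators are joined by an edge if they do not
commute. The Coxeter system is irreducible if this graph is connected. -/
def coxeterGraph : SimpleGraph B where
  Adj i j := ¬ Commute (cs.simple i) (cs.simple j)
  symm := ⟨fun _ _ h h' => h h'.symm⟩
  loopless := ⟨fun _ h => h (Commute.refl _)⟩

/-- A word in which every generator appears precisely once, that is, a reduced expression of a
Coxeter element. -/
def IsCoxeterWord (c : List B) : Prop :=
  c.Nodup ∧ ∀ i, i ∈ c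

/-- The Coxeter number, as the order of the Coxeter element represented by `c`. -/
noncomputable def coxeterNumber (c : List B) : ℕ :=
  orderOf (cs.wordProd c)

/-- The positions of the infinite word `c^∞ = c c c ⋯`, from left to right: `(k, p)` is the
position `p` of the copy number `k` of `c` (copies are counted from `0`). -/
abbrev Pos (c : List B) : Type := ℕ ×ₗ Fin c.length

/-- The letter of `c^∞` at a position. -/
def letter (c : List B) (a : Pos c) : B :=
  c.get (ofLex a).2

/-- The subwords of `c^∞` (given by their increasing sequences of positions) that are reduced
expressions of `w`. The type of position sequences carries the lexicographic order. -/
def reducedSubwords (c : List B) (w : W) : Set (Lex (Fin (cs.length w) → Pos c)) :=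
  {p | StrictMono (ofLex p) ∧ cs.wordProd (List.ofFn fun k => letter c (ofLex p k)) = w}

theorem reducedSubwords_nonempty {c : List B} (hc : IsCoxeterWord c) (w : W) :
    (reducedSubwords cs c w).Nonempty := by
  obtain ⟨ω, hω, rfl⟩ := cs.exists_isReduced w
  have hlen : cs.length (cs.wordProd ω) = ω.length := hω
  choose idx hidx using fun i : B => List.get_of_mem (hc.2 i)
  refine ⟨toLex fun k => toLex ((k : ℕ), idx (ω.get (Fin.cast hlen k))), ?_, ?_⟩
  · intro i j hij
    exact Prod.Lex.toLex_lt_toLex.2 (Or.inl hij)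
  · congr 1
    apply List.ext_get
    · simpa using hlen
    · intro n h₁ h₂
      simp only [List.get_ofFn]
      exact hidx _

/-- The positions in `c^∞` of the `c`-sorting word of `w`: the lexicographically first sequence of
positions of a subword that is a reduced expression of `w`. -/
noncomputable def sortingPositions {c : List B} (hc : IsCoxeterWord c) (w : W) :
    Lex (Fin (cs.length w) → Pos c) :=
  (wellFounded_lt (α := Lex (Fin (cs.length w) → Pos c))).min
    (reducedSubwords cs c w) (reducedSubwords_nonempty cs hc w)

/-- The `c`-sorting word of `w`. -/
noncomputable def sortingWord {c : List B} (hc : IsCoxeterWord c) (w : W) :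
    Fin (cs.length w) → B :=
  fun k => letter c (ofLex (sortingPositions cs hc w) k)

/-- One commutation: two adjacent commuting letters are exchanged. -/
inductive CommStep : List B → List B → Prop
  | swap (u v : List B) (i j : B) (h : Commute (cs.simple i) (cs.simple j)) :
      CommStep (u ++ i :: j :: v) (u ++ j :: i :: v)

/-- The two words coincide up to commutations. -/
def CommEquiv : List B → List B → Prop :=
  Relation.EqvGen (CommStep cs)

/-- `u` is a prefix of `v` up to commutations. -/
def IsPrefixUpToComm (u v : List B) : Prop :=
  ∃ v', CommEquiv cs v' v ∧ u <+: v'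

section Finite

variable [Finite W]

theorem exists_longest : ∃ w₀ : W, ∀ w : W, cs.length w ≤ cs.length w₀ :=
  Finite.exists_max cs.length

/-- The longest element of a finite Coxeter group. -/
noncomputable def longest : W :=
  (exists_longest cs).choose

/-- The number of letters of a reduced expression of the longest element. -/
noncomputable def numLetters : ℕ :=
  cs.length (longest cs)

/-- The `c`-sorting word of the longest element. -/
noncomputable def longestWord {c : List B} (hc : IsCoxeterWord c) : Fin (numLetters cs) → B :=
  sortingWord cs hc (longest cs)

/-- `w` is a `c`-singleton: some reduced expression of `w` is, up to commutations, a prefix of the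
`c`-sorting word of the longest element. -/
def IsSingleton {c : List B} (hc : IsCoxeterWord c) (w : W) : Prop :=
  ∃ u : List B, cs.IsReduced u ∧ cs.wordProd u = w ∧
    IsPrefixUpToComm cs u (List.ofFn (longestWord cs hc))

/-- The automorphism `w ↦ w₀⁻¹ w w₀` of `W`. -/
noncomputable def psi (w : W) : W :=
  (longest cs)⁻¹ * w * longest cs

/-- The word `w₀(c) ψ(w₀(c))`, the concatenation of the `c`-sorting word of the longest element and
of its image under `ψ`, as a word in the simple reflections. -/
noncomputable def doubleWord {c : List B} (hc : IsCoxeterWord c) :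
    Fin (numLetters cs + numLetters cs) → W :=
  Fin.append (fun k => cs.simple (longestWord cs hc k))
    (fun k => psi cs (cs.simple (longestWord cs hc k)))

/-- The number of earlier occurrences in `w₀(c) ψ(w₀(c))` of the generator at position `i`. -/
noncomputable def occ {c : List B} (hc : IsCoxeterWord c)
    (i : Fin (numLetters cs + numLetters cs)) : ℕ :=
  {j | j < i ∧ doubleWord cs hc j = doubleWord cs hc i}.ncard

/-- The letter of `c^∞` at position `a` projects to the letter number `i` of `w₀(c) ψ(w₀(c))`.
The projection sends copy `k` of `c` in `c^∞` to copy `k mod h` in `c^h`. The words `c^h` and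
`w₀(c) ψ(w₀(c))` coincide up to commutations, so that their letters are identified by the
generator and the number of its earlier occurrences; for a letter of `c^h` the latter number is the
number of the copy of `c` that it belongs to. -/
def ProjectsTo {c : List B} (hc : IsCoxeterWord c) (a : Pos c)
    (i : Fin (numLetters cs + numLetters cs)) : Prop :=
  cs.simple (letter c a) = doubleWord cs hc i ∧
    (ofLex a).1 % coxeterNumber cs c = occ cs hc i

/-- The 2-cover: its vertices are the letters of `w₀(c) ψ(w₀(c))`, its directed edges are the
projections of the edges of the Hasse diagram of the natural partial order of `c^∞`. -/
def twoCover {c : List B} (hc : IsCoxeterWord c) :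
    Digraph (Fin (numLetters cs + numLetters cs)) where
  Adj i j := ∃ a b : Pos c, NatCovBy (fun x : Pos c => cs.simple (letter c x)) a b ∧
    ProjectsTo cs hc a i ∧ ProjectsTo cs hc b j

/-- The vertices of the 2-cover that correspond to the second half `ψ(w₀(c))` of the word
`w₀(c) ψ(w₀(c))`. -/
def psiVertices : Set (Fin (numLetters cs + numLetters cs)) :=
  {i | numLetters cs ≤ (i : ℕ)}

end Finite

end Coxeter

end CutPaths

set_option linter.unusedSectionVars false

/-! The Coxeter graph of an irreducible finite Coxeter group is a tree, so the orientation of its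
edges by the order of letters in `c` is the gradient of a height `η`. Write the copy number `k` of
`s` in `c^∞` as `(k, s)` and give it the time `η s + 2 * k`. Letters of adjacent generators
alternate in time, and the Hasse edges of the natural order are exactly the pairs of adjacent
generators whose times differ by one. An order ideal is then a function `b` such that the values `η
s + 2 * b s` at adjacent generators differ by one; such a function is called a slice.

The sorting word of the longest element is one of these ideals. For the slice at time zero,
Steinberg's alternating product of the two colour classes gives the longest element after `m` layers
(`exists_layerProd_eq_longest`). Moving a slice past a letter `s` removes `s` on the left and adds
`ψ(s)` on the right, and `s w₀ = w₀ ψ(s)`; hence between any slice and its Nakayama translate lies a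
reduced word of the longest element (`heapProd_nakayama`). Two translates shift `k` by `m`, which
yields `h = m` (`heapProd_period`). For the slice `0`, the translate `a` bounds the sorting word, by
the lexicographic comparison in `not_lt_of_mem_reducedSubwords`. It satisfies `a s + a (ψ s) = h`,
so the 2-cover is the Hasse diagram of all `(k, s)`, `k ∈ ℤ`, modulo translation by `h`: a cylinder,
in which the second half of the word is the strip `a s ≤ k < h` (`exists_isCylinder`).

Both sides of the bijection are matched with the slices `0 ≤ b ≤ a`. The singletons are the products
of the order ideals of the sorting word, and different ideals have different products
(`nonempty_singleton_equiv`). For cut paths, the key fact is that every directed cycle winds around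
the cylinder exactly once (`cycle_length`): positive definiteness excludes a spider with three legs
of length two, hence the Coxeter graph is a caterpillar, the cylinder can be drawn without
crossings, and a closed curve winding more than once would cross itself. So all cycles have length
`2 * h`, and the weight `2h · 1_κ - 1` vanishes on each of them. Its potential turns `κ` into a
level function on the letters that rises by one across `κ` and under translation by `h`
(`exists_level`). Avoiding the strip makes the level constant there, and the place where this level
is first reached is the slice (`exists_slice`). -/

namespace CutPaths

open Real

/-! ### The geometric representation -/

section GeometricRepresentation

variable {B : Type*} [Fintype B] [DecidableEq B] (M : CoxeterMatrix B)

/-- The entries of the bilinear form of the geometric representation. -/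
noncomputable def coxForm (i j : B) : ℝ :=
  -cos (π / M i j)

theorem coxForm_self (i : B) : coxForm M i i = 1 := by
  simp [coxForm]

theorem coxForm_symm (i j : B) : coxForm M i j = coxForm M j i := by
  rw [coxForm, coxForm, M.symmetric]

/-- The simple root `α_i`. -/
def simpleRoot (i : B) : B → ℝ :=
  Pi.single i 1

/-- The simple coroot, as a functional: `x ↦ 2 ⟨x, α_i⟩`. -/
noncomputable def simpleCoroot (i : B) : Module.Dual ℝ (B → ℝ) :=
  ∑ j, (2 * coxForm M i j) • LinearMap.proj j

theorem simpleCoroot_apply (i : B) (x : B → ℝ) :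
    simpleCoroot M i x = ∑ j, 2 * coxForm M i j * x j := by
  simp [simpleCoroot]

theorem simpleCoroot_simpleRoot (i j : B) :
    simpleCoroot M i (simpleRoot j) = 2 * coxForm M i j := by
  simp [simpleCoroot_apply, simpleRoot, Pi.single_apply]

theorem simpleCoroot_self (i : B) : simpleCoroot M i (simpleRoot i) = 2 := by
  simp [simpleCoroot_simpleRoot, coxForm_self]

/-- The simple reflection of the geometric representation. -/
noncomputable def simpleReflection (i : B) : (B → ℝ) ≃ₗ[ℝ] (B → ℝ) :=
  Module.reflection (simpleCoroot_self M i)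

theorem simpleReflection_apply (i : B) (x : B → ℝ) :
    simpleReflection M i x = x - simpleCoroot M i x • simpleRoot i :=
  Module.reflection_apply _ _

theorem chebyshevS_two_mul_cos (θ : ℝ) (k : ℤ) :
    (Polynomial.Chebyshev.S ℝ k).eval (2 * cos θ) * sin θ = sin ((k + 1) * θ) := by
  simp

theorem simpleReflection_liftable : M.IsLiftable (simpleReflection M) := by
  intro i j
  by_cases hij : i = j
  · subst hij
    have h : simpleReflection M i * simpleReflection M i = 1 := by
      ext1 x
      exact Module.involutive_reflection (simpleCoroot_self M i) x
    rw [h, one_pow]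
  by_cases h0 : M i j = 0
  · simp [h0]
  have h1 : M i j ≠ 1 := M.off_diagonal i j hij
  set m := M i j with hm
  have hm2 : 2 ≤ m := by omega
  have hmpos : (0 : ℝ) < m := by positivity
  set θ : ℝ := π / m with hθ
  have hmθ : m * θ = π := by rw [hθ]; field_simp
  have hforms : coxForm M i j = -cos θ := by rw [coxForm, ← hm]
  have hforms' : coxForm M j i = -cos θ := by rw [coxForm_symm, hforms]
  apply LinearEquiv.ext
  intro z
  have key := Module.reflection_mul_reflection_pow_apply (simpleCoroot_self M i)
    (simpleCoroot_self M j) m z (2 * cos (2 * θ)) (by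
      rw [simpleCoroot_simpleRoot, simpleCoroot_simpleRoot, hforms, hforms', cos_two_mul]; ring)
  rw [simpleReflection, simpleReflection, key]
  -- For `m = 2` the quotient formula for the Chebyshev values divides by `sin (2 * θ) = sin π = 0`,
  -- so this case is computed directly.
  rcases hm2.eq_or_lt with h2 | h3
  · have hc : cos θ = 0 := by
      rw [hθ, ← h2]; simp
    have e1 : ((m : ℤ) - 2) / 2 = 0 := by omega
    have e2 : ((m : ℤ) - 1) / 2 = 0 := by omega
    have e3 : ((m : ℤ) - 3) / 2 = -1 := by omega
    have e4 : (m : ℤ) / 2 = 1 := by omega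
    rw [e1, e2, e3, e4, simpleCoroot_simpleRoot, simpleCoroot_simpleRoot, hforms, hforms',
      cos_two_mul, hc]
    simp only [Polynomial.Chebyshev.S_zero, Polynomial.Chebyshev.S_one,
      Polynomial.Chebyshev.S_neg_one, Polynomial.eval_one, Polynomial.eval_X,
      Polynomial.eval_zero, LinearEquiv.coe_one, id_eq]
    module
  have hs : sin (2 * θ) ≠ 0 := by
    have hm3 : (3 : ℝ) ≤ m := by exact_mod_cast h3
    apply ne_of_gt
    apply sin_pos_of_pos_of_lt_pi
    · rw [hθ]; positivity
    · rw [hθ, ← mul_div_assoc, div_lt_iff₀ hmpos]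
      nlinarith [pi_pos]
  have hS (k : ℤ) : (Polynomial.Chebyshev.S ℝ k).eval (2 * cos (2 * θ)) =
      sin ((k + 1) * (2 * θ)) / sin (2 * θ) := by
    rw [← chebyshevS_two_mul_cos, mul_div_assoc, div_self hs, mul_one]
  -- The coefficients in `key` vanish because of `S_{p-1} = 0` for `m = 2p`, and because of `S_p +
  -- S_{p-1} = 0` for `m = 2p + 1`; these are `sin π = 0` and `sin (π + θ) + sin (π - θ) = 0`.
  rcases Nat.even_or_odd' m with ⟨p, hp | hp⟩
  · have e1 : ((m : ℤ) - 2) / 2 = p - 1 := by omega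
    have e2 : ((m : ℤ) - 1) / 2 = p - 1 := by omega
    have hz : (Polynomial.Chebyshev.S ℝ ((p : ℤ) - 1)).eval (2 * cos (2 * θ)) = 0 := by
      rw [hS]
      have : (((p : ℤ) - 1 : ℤ) + 1 : ℝ) * (2 * θ) = π := by
        rw [← hmθ, hp]; push_cast; ring
      rw [this, sin_pi, zero_div]
    rw [e1, e2, hz]
    simp
  · have e1 : ((m : ℤ) - 2) / 2 = p - 1 := by omega
    have e2 : ((m : ℤ) - 1) / 2 = p := by omega
    have e3 : ((m : ℤ) - 3) / 2 = p - 1 := by omega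
    have e4 : ((m : ℤ)) / 2 = p := by omega
    have hz : (Polynomial.Chebyshev.S ℝ (p : ℤ)).eval (2 * cos (2 * θ)) +
        (Polynomial.Chebyshev.S ℝ ((p : ℤ) - 1)).eval (2 * cos (2 * θ)) = 0 := by
      rw [hS, hS, ← add_div]
      have a1 : (((p : ℤ) : ℝ) + 1) * (2 * θ) = π + θ := by
        rw [← hmθ, hp]; push_cast; ring
      have a2 : (((p : ℤ) - 1 : ℤ) + 1 : ℝ) * (2 * θ) = π - θ := by
        rw [← hmθ, hp]; push_cast; ring
      rw [a1, a2, sin_pi_sub, add_comm π θ, sin_add_pi]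
      simp
    rw [e1, e2, e3, e4, hz]
    simp

end GeometricRepresentation

/-! ### Positive roots and descents -/

section Positivity

variable {B W : Type*} [Fintype B] [DecidableEq B] [Group W] {M : CoxeterMatrix B}
  (cs : CoxeterSystem M W)

/-- The geometric representation. -/
noncomputable def geomRep : W →* ((B → ℝ) ≃ₗ[ℝ] (B → ℝ)) :=
  cs.lift ⟨simpleReflection M, simpleReflection_liftable M⟩

theorem geomRep_simple (i : B) : geomRep cs (cs.simple i) = simpleReflection M i :=
  cs.lift_apply_simple _ i

theorem geomRep_simple_apply (i : B) (x : B → ℝ) :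
    geomRep cs (cs.simple i) x = x - simpleCoroot M i x • simpleRoot i := by
  rw [geomRep_simple, simpleReflection_apply]

theorem geomRep_mul_apply (v w : W) (x : B → ℝ) :
    geomRep cs (v * w) x = geomRep cs v (geomRep cs w x) := by
  rw [map_mul]; rfl

theorem geomRep_simple_self (i : B) :
    geomRep cs (cs.simple i) (simpleRoot i) = -simpleRoot i := by
  rw [geomRep_simple_apply, simpleCoroot_self]; module

theorem geomRep_mul_simple_self (w : W) (i : B) :
    geomRep cs (w * cs.simple i) (simpleRoot i) = -geomRep cs w (simpleRoot i) := by
  rw [geomRep_mul_apply, geomRep_simple_self, map_neg]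

/-- The values of the Chebyshev polynomials of the second kind, normalized as
`sin (k θ) / sin θ` at `l = 2 cos θ`. -/
def dihedralCoeff (l : ℝ) : ℕ → ℝ
  | 0 => 0
  | 1 => 1
  | k + 2 => l * dihedralCoeff l (k + 1) - dihedralCoeff l k

theorem dihedralCoeff_mul_sin (θ : ℝ) : ∀ k : ℕ,
    dihedralCoeff (2 * cos θ) k * sin θ = sin (k * θ)
  | 0 => by simp [dihedralCoeff]
  | 1 => by simp [dihedralCoeff]
  | k + 2 => by
    have h1 := dihedralCoeff_mul_sin θ (k + 1)
    have h2 := dihedralCoeff_mul_sin θ k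
    rw [dihedralCoeff, sub_mul, mul_assoc, h1, h2]
    have e1 : ((k + 2 : ℕ) : ℝ) * θ = ((k + 1 : ℕ) : ℝ) * θ + θ := by push_cast; ring
    have e2 : (k : ℝ) * θ = ((k + 1 : ℕ) : ℝ) * θ - θ := by push_cast; ring
    rw [e1, e2, sin_add, sin_sub]
    ring

theorem dihedralCoeff_two : ∀ k : ℕ, dihedralCoeff 2 k = k
  | 0 => by simp [dihedralCoeff]
  | 1 => by simp [dihedralCoeff]
  | k + 2 => by
    rw [dihedralCoeff, dihedralCoeff_two (k + 1), dihedralCoeff_two k]; push_cast; ring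

/-- The coefficient is `sin (k π / m) / sin (π / m)` with `m = M i j`, and `k π / m` does not exceed
`π`. The entry `0` stands for infinite order; there `π / 0 = 0` gives `l = 2` and the coefficient is
`k`. -/
theorem dihedralCoeff_nonneg {i j : B} (hij : i ≠ j) {k : ℕ} (hk : M i j = 0 ∨ k ≤ M i j) :
    0 ≤ dihedralCoeff (-(2 * coxForm M i j)) k := by
  have e : -(2 * coxForm M i j) = 2 * cos (π / M i j) := by rw [coxForm]; ring
  rw [e]
  by_cases h0 : M i j = 0
  · rw [h0]; simp [dihedralCoeff_two]
  have hk' := hk.resolve_left h0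
  have h1 : M i j ≠ 1 := M.off_diagonal i j hij
  have hm2 : (2 : ℝ) ≤ M i j := by exact_mod_cast (by omega : 2 ≤ M i j)
  have hmpos : (0 : ℝ) < M i j := by linarith
  have hsin : 0 < sin (π / M i j) := by
    apply sin_pos_of_pos_of_lt_pi (by positivity)
    rw [div_lt_iff₀ hmpos]; nlinarith [pi_pos]
  refine nonneg_of_mul_nonneg_left ?_ hsin
  rw [dihedralCoeff_mul_sin]
  apply sin_nonneg_of_nonneg_of_le_pi (by positivity)
  rw [← mul_div_assoc, div_le_iff₀ hmpos, mul_comm]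
  have : (k : ℝ) ≤ M i j := by exact_mod_cast hk'
  nlinarith [pi_pos]

theorem geomRep_simple_combination (i j : B) (a b : ℝ) :
    geomRep cs (cs.simple j) (a • simpleRoot i + b • simpleRoot j) =
      a • simpleRoot i + (-(2 * coxForm M i j) * a - b) • simpleRoot j := by
  rw [geomRep_simple_apply, map_add, map_smul, map_smul, simpleCoroot_self,
    simpleCoroot_simpleRoot, coxForm_symm M j i]
  simp only [smul_eq_mul]
  module

/-- The rank two computation behind positivity: one further reflection of the dihedral subgroup is
one step of the recurrence of `dihedralCoeff`. -/
theorem geomRep_alternatingWord (i j : B) (n : ℕ) :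
    geomRep cs (cs.wordProd (CoxeterSystem.alternatingWord i j n)) (simpleRoot i) =
      if Even n then
        dihedralCoeff (-(2 * coxForm M i j)) (n + 1) • simpleRoot i +
          dihedralCoeff (-(2 * coxForm M i j)) n • simpleRoot j
      else
        dihedralCoeff (-(2 * coxForm M i j)) (n + 1) • simpleRoot j +
          dihedralCoeff (-(2 * coxForm M i j)) n • simpleRoot i := by
  induction n with
  | zero => simp [CoxeterSystem.alternatingWord, dihedralCoeff]
  | succ n ih =>
    rw [CoxeterSystem.alternatingWord_succ', cs.wordProd_cons, geomRep_mul_apply, ih]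
    by_cases hn : Even n
    · rw [if_pos hn, if_pos hn, if_neg (by simpa [Nat.even_add_one] using hn),
        geomRep_simple_combination, dihedralCoeff]
      module
    · rw [if_neg hn, if_neg hn, if_pos (by simpa [Nat.even_add_one] using hn),
        geomRep_simple_combination, dihedralCoeff, coxForm_symm M j i]
      module

/-- A substitute for minimal coset representatives of the dihedral subgroup of `i` and `j`: a
longest alternating right factor ending in `j` is split off without loss of length. -/
theorem exists_maximal_alternating_decomposition (w : W) (i j : B) :
    ∃ (v : W) (n : ℕ), w = v * cs.wordProd (CoxeterSystem.alternatingWord i j n) ∧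
      cs.length w = cs.length v + n ∧
      ∀ (v' : W), w = v' * cs.wordProd (CoxeterSystem.alternatingWord i j (n + 1)) →
        cs.length w ≠ cs.length v' + (n + 1) := by
  classical
  let P : ℕ → Prop := fun n => ∃ v : W,
    w = v * cs.wordProd (CoxeterSystem.alternatingWord i j n) ∧ cs.length w = cs.length v + n
  have h0 : P 0 := ⟨w, by simp [CoxeterSystem.alternatingWord], by simp⟩
  have hb : ∀ n, P n → n ≤ cs.length w := by
    rintro n ⟨v, -, h⟩; omega
  obtain ⟨v, hv, hl⟩ := Nat.findGreatest_spec (P := P) (Nat.zero_le (cs.length w)) h0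
  refine ⟨v, _, hv, hl, fun v' h1 h2 => ?_⟩
  have hP : P (Nat.findGreatest P (cs.length w) + 1) := ⟨v', h1, h2⟩
  have := Nat.le_findGreatest (hb _ hP) hP
  omega

/-- An element of a Coxeter group sends the simple root `α_i` to a nonnegative combination of the
simple roots unless `i` is a right descent. -/
theorem geomRep_simpleRoot_nonneg (w : W) (i : B) (h : ¬ cs.IsRightDescent w i) :
    ∀ k, 0 ≤ geomRep cs w (simpleRoot i) k := by
  induction hn : cs.length w using Nat.strong_induction_on generalizing w i with
  | _ N ih =>
  by_cases hw : w = 1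
  · subst hw
    intro k
    simp only [map_one, LinearEquiv.coe_one, id_eq, simpleRoot, Pi.single_apply]
    split_ifs <;> norm_num
  obtain ⟨j, hj⟩ := cs.exists_rightDescent_of_ne_one hw
  have hij : i ≠ j := fun e => h (e ▸ hj)
  obtain ⟨v, n, hv, hl, hmax⟩ := exists_maximal_alternating_decomposition cs w i j
  have hn1 : 1 ≤ n := by
    by_contra hn0
    obtain rfl : n = 0 := by omega
    apply hmax (w * cs.simple j)
    · simp [CoxeterSystem.alternatingWord]
    · have := (cs.isRightDescent_iff).1 hj; omega
  have hvlt : cs.length v < N := by omega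
  -- This generator would prolong the alternating factor on its left, against maximality.
  have hright : ¬ cs.IsRightDescent v (if Even n then j else i) := by
    intro hd
    apply hmax (v * cs.simple (if Even n then j else i))
    · rw [CoxeterSystem.alternatingWord_succ', cs.wordProd_cons, mul_assoc,
        cs.simple_mul_simple_cancel_left, ← hv]
    · have := (cs.isRightDescent_iff).1 hd; omega
  -- This generator is the first letter of the alternating factor; as a descent of `v` it would make
  -- `w` shorter than `cs.length v + n`.
  have hleft : ¬ cs.IsRightDescent v (if Even n then i else j) := by
    intro hd
    obtain ⟨p, rfl⟩ : ∃ p, n = p + 1 := ⟨n - 1, by omega⟩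
    have hd' := (cs.isRightDescent_iff).1 hd
    have e : (if Even (p + 1) then i else j) = if Even p then j else i := by
      by_cases hp : Even p <;> simp [hp, Nat.even_add_one]
    rw [CoxeterSystem.alternatingWord_succ', cs.wordProd_cons, ← mul_assoc, ← e] at hv
    have h1 := cs.length_mul_le (v * cs.simple (if Even (p + 1) then i else j))
      (cs.wordProd (CoxeterSystem.alternatingWord i j p))
    have h2 := cs.length_wordProd_le (CoxeterSystem.alternatingWord i j p)
    rw [← hv] at h1
    rw [CoxeterSystem.length_alternatingWord] at h2
    omega
  have hvi : ∀ k, 0 ≤ geomRep cs v (simpleRoot i) k := by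
    apply ih _ hvlt v i _ rfl
    by_cases hp : Even n
    · simpa [hp] using hleft
    · simpa [hp] using hright
  have hvj : ∀ k, 0 ≤ geomRep cs v (simpleRoot j) k := by
    apply ih _ hvlt v j _ rfl
    by_cases hp : Even n
    · simpa [hp] using hright
    · simpa [hp] using hleft
  -- Since `i` is not a descent of `w`, appending it produces an alternating word of length `n + 1`
  -- that must be reduced, which bounds its length by the order of the dihedral rotation.
  have hbound : M i j = 0 ∨ n + 1 ≤ M i j := by
    by_contra hcon
    push Not at hcon
    have hM : M j i ≠ 0 := by rw [M.symmetric]; exact hcon.1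
    have hnot := cs.not_isReduced_alternatingWord j i (m := n + 1) hM
      (by rw [M.symmetric]; exact hcon.2)
    apply hnot
    have h1 := (cs.not_isRightDescent_iff).1 h
    have e : w * cs.simple i = v * cs.wordProd (CoxeterSystem.alternatingWord j i (n + 1)) := by
      rw [CoxeterSystem.alternatingWord_succ, cs.wordProd_concat, ← mul_assoc, ← hv]
    have h2 := cs.length_mul_le v (cs.wordProd (CoxeterSystem.alternatingWord j i (n + 1)))
    rw [← e] at h2
    have h3 := cs.length_wordProd_le (CoxeterSystem.alternatingWord j i (n + 1))
    rw [CoxeterSystem.IsReduced]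
    rw [CoxeterSystem.length_alternatingWord] at h3 ⊢
    omega
  have c1 := dihedralCoeff_nonneg hij hbound
  have c2 := dihedralCoeff_nonneg (M := M) hij (k := n) (hbound.imp_right (by omega))
  intro k
  rw [hv, geomRep_mul_apply, geomRep_alternatingWord]
  split_ifs
  · simp only [map_add, map_smul, Pi.add_apply, Pi.smul_apply, smul_eq_mul]
    have := mul_nonneg c1 (hvi k)
    have := mul_nonneg c2 (hvj k)
    linarith
  · simp only [map_add, map_smul, Pi.add_apply, Pi.smul_apply, smul_eq_mul]
    have := mul_nonneg c1 (hvj k)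
    have := mul_nonneg c2 (hvi k)
    linarith

theorem geomRep_simpleRoot_nonpos (w : W) (i : B) (h : cs.IsRightDescent w i) :
    ∀ k, geomRep cs w (simpleRoot i) k ≤ 0 := by
  intro k
  have h1 := geomRep_simpleRoot_nonneg cs (w * cs.simple i) i
    ((cs.isRightDescent_iff_not_isRightDescent_mul).1 h) k
  rw [geomRep_mul_simple_self] at h1
  simpa using h1

theorem simpleRoot_ne_zero (i : B) : (simpleRoot i : B → ℝ) ≠ 0 := by
  simp [simpleRoot]

theorem geomRep_simpleRoot_ne_zero (w : W) (i : B) : geomRep cs w (simpleRoot i) ≠ 0 := by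
  simpa using simpleRoot_ne_zero i

theorem isRightDescent_of_nonpos {w : W} {i : B} (h : ∀ k, geomRep cs w (simpleRoot i) k ≤ 0) :
    cs.IsRightDescent w i := by
  by_contra hd
  apply geomRep_simpleRoot_ne_zero cs w i
  funext k
  exact le_antisymm (h k) (geomRep_simpleRoot_nonneg cs w i hd k)

theorem simple_injective : Function.Injective cs.simple := by
  intro i j hij
  have h := geomRep_simple_self cs i
  rw [hij, geomRep_simple_apply] at h
  by_contra hne
  have := congrFun h i
  simp only [simpleRoot, Pi.sub_apply, Pi.smul_apply, Pi.neg_apply, Pi.single_eq_same,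
    Pi.single_eq_of_ne hne, smul_eq_mul, mul_zero] at this
  norm_num at this

/-- If `i ≠ j`, then `s_i` and `s_j` commute precisely if `α_i` and `α_j` are orthogonal. -/
theorem commute_simple_iff {i j : B} (hij : i ≠ j) :
    Commute (cs.simple i) (cs.simple j) ↔ coxForm M i j = 0 := by
  constructor
  · intro h
    have e : geomRep cs (cs.simple i * cs.simple j) (simpleRoot j) =
      geomRep cs (cs.simple j * cs.simple i) (simpleRoot j) := by rw [h.eq]
    rw [geomRep_mul_apply, geomRep_mul_apply, geomRep_simple_self, geomRep_simple_apply,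
      geomRep_simple_apply, geomRep_simple_apply] at e
    have := congrFun e i
    rw [map_neg, simpleCoroot_simpleRoot] at this
    simp only [simpleRoot, Pi.sub_apply, Pi.smul_apply, Pi.neg_apply, Pi.single_eq_same,
      Pi.single_eq_of_ne hij, smul_eq_mul] at this
    linarith
  · intro h
    have hM : M i j = 2 := by
      have hc : cos (π / M i j) = 0 := by
        rw [coxForm] at h; linarith
      have h1 : M i j ≠ 1 := M.off_diagonal i j hij
      have h0 : M i j ≠ 0 := by
        intro h0; rw [h0] at hc; simp at hc
      by_contra h2
      have h3 : (3 : ℝ) ≤ M i j := by exact_mod_cast (by omega : 3 ≤ M i j)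
      have : 0 < cos (π / M i j) := by
        apply cos_pos_of_mem_Ioo
        constructor
        · have : 0 < π / M i j := div_pos pi_pos (by linarith)
          linarith [pi_pos]
        · rw [div_lt_iff₀ (by linarith)]; nlinarith [pi_pos]
      linarith
    have hp := cs.simple_mul_simple_pow i j
    rw [hM, pow_two] at hp
    have := mul_eq_one_iff_eq_inv.1 hp
    rw [mul_inv_rev, cs.inv_simple, cs.inv_simple] at this
    exact this

theorem coxForm_le_neg_half {i j : B} (h : ¬ Commute (cs.simple i) (cs.simple j)) :
    coxForm M i j ≤ -(1 / 2) := by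
  have hij : i ≠ j := by rintro rfl; exact h (Commute.refl _)
  have h1 : M i j ≠ 1 := M.off_diagonal i j hij
  have h2 : M i j ≠ 2 := by
    intro h2; apply h; rw [commute_simple_iff cs hij, coxForm, h2]; simp
  rw [coxForm]
  by_cases h0 : M i j = 0
  · rw [h0]; norm_num
  have h3 : (3 : ℝ) ≤ M i j := by exact_mod_cast (by omega : 3 ≤ M i j)
  rw [← cos_pi_div_three, neg_le_neg_iff]
  apply cos_le_cos_of_nonneg_of_le_pi (by positivity) (by linarith [pi_pos])
  gcongr

theorem coxForm_nonpos {i j : B} (hij : i ≠ j) : coxForm M i j ≤ 0 := by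
  have h1 : M i j ≠ 1 := M.off_diagonal i j hij
  rw [coxForm, neg_nonpos]
  by_cases h0 : M i j = 0
  · rw [h0]; norm_num
  have h2 : (2 : ℝ) ≤ M i j := by exact_mod_cast (by omega : 2 ≤ M i j)
  apply cos_nonneg_of_mem_Icc
  constructor
  · have : 0 < π / M i j := div_pos pi_pos (by linarith)
    linarith [pi_pos]
  · gcongr

end Positivity

end CutPaths

namespace CutPaths

/-! ### A Perron–Frobenius eigenvector -/

section PerronFrobenius

variable {B : Type*} [Fintype B]

/-- The first order condition at an extremum, without derivatives; it is applied to perturbations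
along coordinate vectors. -/
theorem eq_zero_of_quadratic_nonneg {b c : ℝ} (hc : 0 ≤ c)
    (h : ∀ e : ℝ, 0 ≤ 2 * e * b + e ^ 2 * c) : b = 0 := by
  by_contra hb
  have h1 := h (-b / (c + 1))
  have hc1 : 0 < c + 1 := by linarith
  have e : 2 * (-b / (c + 1)) * b + (-b / (c + 1)) ^ 2 * c =
      -(b ^ 2 * (c + 2)) / (c + 1) ^ 2 := by
    field_simp; ring
  rw [e, neg_div] at h1
  have : 0 < b ^ 2 * (c + 2) / (c + 1) ^ 2 := by positivity
  linarith

/-- A symmetric nonnegative matrix whose support is a connected graph has a positive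
eigenvector. -/
theorem exists_pos_eigenvector [Nonempty B] (A : B → B → ℝ) (hsymm : ∀ i j, A i j = A j i)
    (hnonneg : ∀ i j, 0 ≤ A i j) (G : SimpleGraph B) (hG : G.Connected)
    (hpos : ∀ i j, G.Adj i j → 0 < A i j) :
    ∃ (x : B → ℝ) (l : ℝ), (∀ i, 0 < x i) ∧ ∀ i, ∑ j, A i j * x j = l * x i := by
  classical
  let q : (B → ℝ) → ℝ := fun x => ∑ i, ∑ j, A i j * x i * x j
  let n : (B → ℝ) → ℝ := fun x => ∑ i, x i ^ 2
  let S : Set (B → ℝ) := {x | n x = 1}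
  have hncont : Continuous n := by fun_prop
  have hqcont : Continuous q := by fun_prop
  have hS : IsCompact S := by
    apply Metric.isCompact_of_isClosed_isBounded
    · exact isClosed_eq hncont continuous_const
    · rw [Metric.isBounded_iff_subset_closedBall 0]
      refine ⟨1, fun x hx => ?_⟩
      rw [mem_closedBall_zero_iff, pi_norm_le_iff_of_nonneg zero_le_one]
      intro i
      rw [Real.norm_eq_abs, ← sq_le_one_iff_abs_le_one]
      have h1 : x i ^ 2 ≤ n x :=
        Finset.single_le_sum (f := fun i => x i ^ 2) (fun i _ => sq_nonneg _) (Finset.mem_univ i)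
      exact h1.trans_eq hx
  have hSne : S.Nonempty := by
    obtain ⟨i⟩ := ‹Nonempty B›
    refine ⟨Pi.single i 1, ?_⟩
    simp [S, n, Pi.single_apply]
  -- A maximiser of the quadratic form on the unit sphere. Its absolute value `y` is again one
  -- because the entries are nonnegative, and stationarity makes `y` an eigenvector.
  obtain ⟨x0, hx0, hmax⟩ := hS.exists_isMaxOn hSne hqcont.continuousOn
  set l := q x0 with hl
  have hqsmul (a : ℝ) (z : B → ℝ) : q (a • z) = a ^ 2 * q z := by
    simp only [q, Finset.mul_sum, Pi.smul_apply, smul_eq_mul]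
    refine Finset.sum_congr rfl fun i _ => Finset.sum_congr rfl fun j _ => by ring
  have hnsmul (a : ℝ) (z : B → ℝ) : n (a • z) = a ^ 2 * n z := by
    simp only [n, Finset.mul_sum, Pi.smul_apply, smul_eq_mul]
    refine Finset.sum_congr rfl fun i _ => by ring
  have hle (z : B → ℝ) : q z ≤ l * n z := by
    by_cases hz : n z = 0
    · have hz0 : z = 0 := by
        funext i
        have := (Finset.sum_eq_zero_iff_of_nonneg (fun i _ => sq_nonneg (z i))).1 hz i
          (Finset.mem_univ i)
        simpa using this
      simp [hz0, q, n]
    have hnz : 0 < n z := lt_of_le_of_ne (Finset.sum_nonneg fun i _ => sq_nonneg _) (Ne.symm hz)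
    have hmem : (Real.sqrt (n z))⁻¹ • z ∈ S := by
      show n _ = 1
      rw [hnsmul, inv_pow, Real.sq_sqrt hnz.le, inv_mul_cancel₀ hz]
    have h1 : q ((Real.sqrt (n z))⁻¹ • z) ≤ l := hmax hmem
    rw [hqsmul, inv_pow, Real.sq_sqrt hnz.le, inv_mul_le_iff₀ hnz] at h1
    linarith
  set y : B → ℝ := fun i => |x0 i| with hy
  have hyn : n y = 1 := by
    have : n y = n x0 := by simp [n, hy, sq_abs]
    rw [this]; exact hx0
  have hyq : q y = l := by
    apply le_antisymm
    · simpa [hyn] using hle y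
    · refine Finset.sum_le_sum fun i _ => Finset.sum_le_sum fun j _ => ?_
      rw [mul_assoc, mul_assoc]
      refine mul_le_mul_of_nonneg_left ?_ (hnonneg i j)
      rw [hy, ← abs_mul]
      exact le_abs_self _
  have heig (i : B) : ∑ j, A i j * y j = l * y i := by
    have hnexp (e : ℝ) : n (y + e • Pi.single i 1) = n y + 2 * e * y i + e ^ 2 := by
      have : ∀ k, (y + e • (Pi.single i 1 : B → ℝ)) k ^ 2 =
          y k ^ 2 + (2 * e) * (if k = i then y k else 0) + e ^ 2 * (if k = i then 1 else 0) := by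
        intro k
        by_cases hk : k = i
        · subst hk; simp; ring
        · simp [hk]
      simp only [n, this, Finset.sum_add_distrib, ← Finset.mul_sum, Finset.sum_ite_eq',
        Finset.mem_univ, if_true, mul_one]
    have hqexp (e : ℝ) : q (y + e • Pi.single i 1) =
        q y + 2 * e * (∑ j, A i j * y j) + e ^ 2 * A i i := by
      have : ∀ k m, A k m * (y + e • (Pi.single i 1 : B → ℝ)) k *
          (y + e • (Pi.single i 1 : B → ℝ)) m =
          A k m * y k * y m + e * (if k = i then A i m * y m else 0) +
            e * (if m = i then A k i * y k else 0) +
            e ^ 2 * (if k = i then (if m = i then A i i else 0) else 0) := by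
        intro k m
        by_cases hk : k = i <;> by_cases hm : m = i
        · subst hk; subst hm; simp; ring
        · subst hk; simp [hm]; ring
        · subst hm; simp [hk]; ring
        · simp [hk, hm]
      simp only [q, this, Finset.sum_add_distrib, ← Finset.mul_sum, Finset.sum_ite_eq',
        Finset.mem_univ, if_true]
      have h1 : ∑ k, ∑ m, (if k = i then A i m * y m else 0) = ∑ j, A i j * y j := by
        rw [Finset.sum_comm]; simp
      have h2 : ∑ k, A k i * y k = ∑ j, A i j * y j :=
        Finset.sum_congr rfl fun j _ => by rw [hsymm]
      have h3 : ∑ k, ∑ m, (if k = i then (if m = i then A i i else 0) else 0) = A i i := by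
        rw [Finset.sum_comm]; simp
      rw [h1, h2, h3]; ring
    have hb := eq_zero_of_quadratic_nonneg (b := l * y i - ∑ j, A i j * y j) (c := l - A i i)
      (by
        have := hle (Pi.single i 1)
        have e1 : q (Pi.single i 1) = A i i := by simp [q, Pi.single_apply]
        have e2 : n (Pi.single i 1) = 1 := by simp [n, Pi.single_apply]
        rw [e1, e2] at this; linarith)
      (by
        intro e
        have := hle (y + e • Pi.single i 1)
        rw [hnexp, hqexp, hyn, hyq] at this
        nlinarith)
    linarith
  have hy0 (i : B) : 0 ≤ y i := abs_nonneg _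
  refine ⟨y, l, fun i => lt_of_le_of_ne (hy0 i) fun hi => ?_, heig⟩
  -- At a zero of `y` the eigenvalue equation is a vanishing sum of nonnegative terms, so zeros
  -- spread along edges and `y` would vanish.
  have hstep : ∀ a b, G.Adj a b → y a = 0 → y b = 0 := by
    intro a b hab ha
    have h1 := heig a
    rw [ha, mul_zero] at h1
    have := (Finset.sum_eq_zero_iff_of_nonneg
      (fun j _ => mul_nonneg (hnonneg a j) (hy0 j))).1 h1 b (Finset.mem_univ b)
    exact (mul_eq_zero.1 this).resolve_left (hpos a b hab).ne'
  have hall : ∀ b, y b = 0 := by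
    intro b
    obtain ⟨p⟩ := hG.preconnected i b
    have : ∀ {u v : B} (_ : G.Walk u v), y u = 0 → y v = 0 := by
      intro u v p
      induction p with
      | nil => exact id
      | cons h _ ih => exact fun hu => ih (hstep _ _ h hu)
    exact this p hi.symm
  have : n y = 0 := by simp [n, hall]
  rw [hyn] at this
  exact one_ne_zero this

end PerronFrobenius

/-! ### Positive definiteness and the shape of the Coxeter graph -/

section FiniteType

variable {B W : Type*} [Fintype B] [DecidableEq B] [Group W] {M : CoxeterMatrix B}
  (cs : CoxeterSystem M W)

/-- The invariant inner product that is obtained by averaging over the group. -/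
noncomputable def averageForm [Fintype W] : (B → ℝ) →ₗ[ℝ] (B → ℝ) →ₗ[ℝ] ℝ :=
  LinearMap.mk₂ ℝ (fun x y => ∑ w, ∑ k, geomRep cs w x k * geomRep cs w y k)
    (by intros; simp only [map_add, Pi.add_apply, add_mul, Finset.sum_add_distrib])
    (by intros; simp only [map_smul, Pi.smul_apply, smul_eq_mul, mul_assoc, Finset.mul_sum])
    (by intros; simp only [map_add, Pi.add_apply, mul_add, Finset.sum_add_distrib])
    (by
      intros
      simp only [map_smul, Pi.smul_apply, smul_eq_mul, Finset.mul_sum, mul_left_comm])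

theorem averageForm_apply [Fintype W] (x y : B → ℝ) :
    averageForm cs x y = ∑ w, ∑ k, geomRep cs w x k * geomRep cs w y k :=
  rfl

theorem averageForm_symm [Fintype W] (x y : B → ℝ) :
    averageForm cs x y = averageForm cs y x := by
  simp only [averageForm_apply, mul_comm]

theorem averageForm_invariant [Fintype W] (g : W) (x y : B → ℝ) :
    averageForm cs (geomRep cs g x) (geomRep cs g y) = averageForm cs x y := by
  simp only [averageForm_apply, ← geomRep_mul_apply]
  exact Fintype.sum_equiv (Equiv.mulRight g) _ _ fun w => rfl

theorem averageForm_self_pos [Fintype W] {x : B → ℝ} (hx : x ≠ 0) : 0 < averageForm cs x x := by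
  rw [averageForm_apply]
  apply Finset.sum_pos' (fun w _ => Finset.sum_nonneg fun k _ => mul_self_nonneg _)
  refine ⟨1, Finset.mem_univ _, ?_⟩
  obtain ⟨k, hk⟩ := Function.ne_iff.1 hx
  apply Finset.sum_pos' (fun k _ => mul_self_nonneg _)
  refine ⟨k, Finset.mem_univ _, ?_⟩
  rw [map_one]
  exact mul_self_pos.2 hk

/-- Invariance under `s_i`, which negates `α_i`. This ties the positive definite averaged form to
the Coxeter form, up to the norm of `α_i`; adjacency forces equal norms, so for a connected graph
the two forms are proportional. -/
theorem two_mul_averageForm_simpleRoot [Fintype W] (x : B → ℝ) (i : B) :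
    2 * averageForm cs x (simpleRoot i) =
      simpleCoroot M i x * averageForm cs (simpleRoot i) (simpleRoot i) := by
  have h := averageForm_invariant cs (cs.simple i) x (simpleRoot i)
  rw [geomRep_simple_self, geomRep_simple_apply] at h
  simp only [map_neg, map_sub, map_smul, LinearMap.sub_apply, LinearMap.smul_apply,
    smul_eq_mul] at h
  linarith

theorem eq_sum_simpleRoot (x : B → ℝ) : x = ∑ i, x i • simpleRoot i := by
  funext k
  simp [simpleRoot, Pi.single_apply, Finset.sum_apply]

/-- The bilinear form of an irreducible finite Coxeter group is positive definite. -/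
theorem coroot_form_pos [Finite W] (hirr : (coxeterGraph cs).Connected) {x : B → ℝ} (hx : x ≠ 0) :
    0 < ∑ i, x i * simpleCoroot M i x := by
  have := Fintype.ofFinite W
  obtain ⟨i0⟩ := hirr.nonempty
  have hadj : ∀ i j, (coxeterGraph cs).Adj i j →
      averageForm cs (simpleRoot i) (simpleRoot i) =
        averageForm cs (simpleRoot j) (simpleRoot j) := by
    intro i j hij
    have h1 := two_mul_averageForm_simpleRoot cs (simpleRoot i) j
    have h2 := two_mul_averageForm_simpleRoot cs (simpleRoot j) i
    rw [averageForm_symm, h2, simpleCoroot_simpleRoot, simpleCoroot_simpleRoot,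
      coxForm_symm M j i] at h1
    have h3 := coxForm_le_neg_half cs hij
    have h4 : 2 * coxForm M i j ≠ 0 := by linarith
    exact mul_left_cancel₀ h4 h1
  have hconst : ∀ i, averageForm cs (simpleRoot i) (simpleRoot i) =
      averageForm cs (simpleRoot i0) (simpleRoot i0) := by
    intro i
    obtain ⟨p⟩ := hirr.preconnected i i0
    induction p with
    | nil => rfl
    | cons h _ ih => exact (hadj _ _ h).trans ih
  have hpos := averageForm_self_pos cs hx
  have hd := averageForm_self_pos cs (simpleRoot_ne_zero i0)
  have e : 2 * averageForm cs x x =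
      (∑ i, x i * simpleCoroot M i x) * averageForm cs (simpleRoot i0) (simpleRoot i0) := by
    conv_lhs => rw [eq_sum_simpleRoot x]
    rw [← eq_sum_simpleRoot x]
    conv_lhs => rw [show averageForm cs x x = averageForm cs x (∑ i, x i • simpleRoot i) by
      rw [← eq_sum_simpleRoot x]]
    rw [map_sum, Finset.mul_sum, Finset.sum_mul]
    refine Finset.sum_congr rfl fun i _ => ?_
    rw [map_smul, smul_eq_mul, ← hconst i, mul_assoc, ← two_mul_averageForm_simpleRoot]
    ring
  have h2 : 0 < (∑ i, x i * simpleCoroot M i x) *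
      averageForm cs (simpleRoot i0) (simpleRoot i0) := by
    rw [← e]; linarith
  exact pos_of_mul_pos_left h2 hd.le

/-- Each edge contributes at most `-1` to the row of the form and no off-diagonal entry is positive,
so neighbours outside `N` may be dropped. -/
theorem simpleCoroot_le {x : B → ℝ} (hx : ∀ i, 0 ≤ x i) (i : B) (N : Finset B)
    (hN : ∀ j ∈ N, (coxeterGraph cs).Adj i j) :
    simpleCoroot M i x ≤ 2 * x i - ∑ j ∈ N, x j := by
  have hi : i ∉ N := fun h => (hN i h).ne rfl
  have h1 : ∑ j ∈ N, 2 * coxForm M i j * x j ≤ -∑ j ∈ N, x j := by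
    rw [← Finset.sum_neg_distrib]
    refine Finset.sum_le_sum fun j hj => ?_
    nlinarith [coxForm_le_neg_half cs (hN j hj), hx j]
  have h2 : ∑ j ∈ (insert i N)ᶜ, 2 * coxForm M i j * x j ≤ 0 := by
    refine Finset.sum_nonpos fun j hj => ?_
    have hij : i ≠ j := by
      rintro rfl; simp at hj
    nlinarith [coxForm_nonpos (M := M) hij, hx j]
  rw [simpleCoroot_apply, ← Finset.sum_add_sum_compl (insert i N), Finset.sum_insert hi,
    coxForm_self]
  linarith

/-- The Coxeter graph of an irreducible finite Coxeter group is a tree. -/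
theorem coxeterGraph_isTree [Finite W] (hirr : (coxeterGraph cs).Connected) :
    (coxeterGraph cs).IsTree := by
  classical
  rw [SimpleGraph.isTree_iff_connected_and_card]
  refine ⟨hirr, le_antisymm ?_ hirr.card_vert_le_card_edgeSet_add_one⟩
  obtain ⟨i0⟩ := hirr.nonempty
  -- Testing positivity on the all-ones vector gives `0 < ∑ (2 - degree)`, so there are fewer edges
  -- than vertices.
  have hpos := coroot_form_pos cs hirr (x := fun _ => 1)
    (fun h => one_ne_zero (congrFun h i0))
  have hle : ∑ i, (1 : ℝ) * simpleCoroot M i (fun _ => 1) ≤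
      ∑ i, (2 - ((coxeterGraph cs).degree i : ℝ)) := by
    refine Finset.sum_le_sum fun i _ => ?_
    have := simpleCoroot_le cs (x := fun _ => 1) (fun _ => zero_le_one) i
      ((coxeterGraph cs).neighborFinset i) (by simp)
    simpa using this
  have h2 := (coxeterGraph cs).sum_degrees_eq_twice_card_edges
  rw [Finset.sum_sub_distrib, ← Nat.cast_sum, h2, Finset.sum_const, Finset.card_univ,
    nsmul_eq_mul] at hle
  push_cast at hle
  have h3 : ((coxeterGraph cs).edgeFinset.card : ℝ) < Fintype.card B := by linarith
  have h4 : (coxeterGraph cs).edgeFinset.card < Fintype.card B := by exact_mod_cast h3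
  rw [SimpleGraph.edgeFinset_card] at h4
  rw [Nat.card_eq_fintype_card, Nat.card_eq_fintype_card]
  omega

/-- The Coxeter graph of an irreducible finite Coxeter group does not contain the spider with three
legs of length two: center `f 0` and legs `f 1, f 2` and `f 3, f 4` and `f 5, f 6`. -/
theorem not_exists_spider [Finite W] (hirr : (coxeterGraph cs).Connected) (f : Fin 7 → B)
    (hf : Function.Injective f)
    (h01 : (coxeterGraph cs).Adj (f 0) (f 1)) (h12 : (coxeterGraph cs).Adj (f 1) (f 2))
    (h03 : (coxeterGraph cs).Adj (f 0) (f 3)) (h34 : (coxeterGraph cs).Adj (f 3) (f 4))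
    (h05 : (coxeterGraph cs).Adj (f 0) (f 5)) (h56 : (coxeterGraph cs).Adj (f 5) (f 6)) :
    False := by
  -- The marks of the affine diagram `E₆`: twice each mark is at most (in fact equals) the sum of
  -- the neighbouring marks, so the form is not positive on this vector.
  let u : Fin 7 → ℕ := ![3, 2, 1, 2, 1, 2, 1]
  let v : Fin 7 → ℝ := fun i => u i
  have hv : ∀ i, 0 ≤ v i := fun i => Nat.cast_nonneg _
  let x : B → ℝ := Function.extend f v 0
  have hxf : ∀ i, x (f i) = v i := fun i => hf.extend_apply _ _ _
  have hx0 : ∀ b, (¬ ∃ i, f i = b) → x b = 0 := fun b hb => Function.extend_apply' _ _ _ hb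
  have hx : ∀ b, 0 ≤ x b := by
    intro b
    by_cases hb : ∃ i, f i = b
    · obtain ⟨i, rfl⟩ := hb; rw [hxf]; exact hv i
    · rw [hx0 b hb]
  have hne : x ≠ 0 := by
    intro h
    have := congrFun h (f 0)
    rw [hxf] at this
    norm_num [v, u] at this
  have hpos := coroot_form_pos cs hirr hne
  have hle (i : Fin 7) (N : Finset (Fin 7)) (hN : ∀ j ∈ N, (coxeterGraph cs).Adj (f i) (f j))
      (hs : 2 * u i ≤ ∑ j ∈ N, u j) : simpleCoroot M (f i) x ≤ 0 := by
    have := simpleCoroot_le cs hx (f i) (N.map ⟨f, hf⟩) (by simpa using hN)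
    rw [Finset.sum_map] at this
    simp only [Function.Embedding.coeFn_mk, hxf] at this
    have h' : 2 * v i ≤ ∑ j ∈ N, v j := by
      simp only [v]; exact_mod_cast hs
    linarith
  have hall : ∀ i, simpleCoroot M (f i) x ≤ 0 := by
    intro i
    fin_cases i
    · exact hle 0 {1, 3, 5} (by simp [h01, h03, h05]) (by decide)
    · exact hle 1 {0, 2} (by simp [h01.symm, h12]) (by decide)
    · exact hle 2 {1} (by simp [h12.symm]) (by decide)
    · exact hle 3 {0, 4} (by simp [h03.symm, h34]) (by decide)
    · exact hle 4 {3} (by simp [h34.symm]) (by decide)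
    · exact hle 5 {0, 6} (by simp [h05.symm, h56]) (by decide)
    · exact hle 6 {5} (by simp [h56.symm]) (by decide)
  refine absurd hpos (not_lt.2 (Finset.sum_nonpos fun b _ => ?_))
  by_cases hb : ∃ i, f i = b
  · obtain ⟨i, rfl⟩ := hb
    exact mul_nonpos_of_nonneg_of_nonpos (hx _) (hall i)
  · rw [hx0 b hb, zero_mul]

end FiniteType

end CutPaths

namespace CutPaths

/-! ### Potentials on trees, and caterpillars -/

section Trees

variable {B : Type*} {T : SimpleGraph B}

/-- The sum of the values of a function along the edges of a walk. -/
def walkSum (o : B → B → ℤ) : ∀ {u v : B}, T.Walk u v → ℤ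
  | _, _, .nil => 0
  | u, _, .cons (v := v) _ p => o u v + walkSum o p

theorem walkSum_concat (o : B → B → ℤ) {u v w : B} (p : T.Walk u v) (h : T.Adj v w) :
    walkSum o (p.concat h) = walkSum o p + o v w := by
  induction p with
  | nil => simp [SimpleGraph.Walk.concat, SimpleGraph.Walk.append, walkSum]
  | cons h' p ih => rw [SimpleGraph.Walk.concat_cons, walkSum, walkSum, ih]; ring

/-- On a tree every antisymmetric function on the oriented edges is a gradient. -/
theorem exists_potential (hT : T.IsTree) (o : B → B → ℤ) (ho : ∀ s t, o s t = -o t s) :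
    ∃ f : B → ℤ, ∀ s t, T.Adj s t → f t = f s + o s t := by
  obtain ⟨r⟩ := hT.1.nonempty
  choose p hp using fun v => (hT.existsUnique_path r v).exists
  refine ⟨fun v => walkSum o (p v), fun s t hst => ?_⟩
  -- In a tree one of the two paths from the root extends the other by the edge between `s` and `t`.
  by_cases h : s ∈ (p t).support
  · simp only
    rw [hT.2.path_concat (hp s) (hp t) hst h, walkSum_concat]
  · have h' := hT.2.mem_support_of_ne_mem_support_of_adj_of_isPath (hp s) (hp t) hst h
    simp only
    rw [hT.2.path_concat (hp t) (hp s) hst.symm h', walkSum_concat, ho t s]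
    ring

/-- Removing an edge separates a tree. -/
theorem exists_edge_cut (hT : T.IsTree) {s t : B} (hst : T.Adj s t) :
    ∃ f : B → ℤ, f s ≠ f t ∧
      ∀ a b, T.Adj a b → s(a, b) ≠ s(s, t) → f a = f b := by
  classical
  -- A gradient supported on the single edge `s t` is constant on the two components that remain
  -- when this edge is removed.
  obtain ⟨f, hf⟩ := exists_potential hT
    (fun a b => if a = s ∧ b = t then 1 else if a = t ∧ b = s then -1 else 0) (by
      intro a b
      have := hst.ne
      by_cases h1 : a = s ∧ b = t
      · obtain ⟨rfl, rfl⟩ := h1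
        simp [this]
      · by_cases h2 : a = t ∧ b = s
        · obtain ⟨rfl, rfl⟩ := h2
          simp [this]
        · have h1' : ¬ (b = t ∧ a = s) := fun h => h1 ⟨h.2, h.1⟩
          have h2' : ¬ (b = s ∧ a = t) := fun h => h2 ⟨h.2, h.1⟩
          simp [h1, h2, h1', h2'])
  refine ⟨f, ?_, fun a b hab hne => ?_⟩
  · have := hf s t hst
    simp at this
    omega
  · have := hf a b hab
    rw [if_neg, if_neg] at this
    · omega
    · rintro ⟨rfl, rfl⟩; exact hne Sym2.eq_swap
    · rintro ⟨rfl, rfl⟩; exact hne rfl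

/-- `T` contains a spider with three legs of length two. -/
def HasSpider (T : SimpleGraph B) : Prop :=
  ∃ f : Fin 7 → B, Function.Injective f ∧ T.Adj (f 0) (f 1) ∧ T.Adj (f 1) (f 2) ∧
    T.Adj (f 0) (f 3) ∧ T.Adj (f 3) (f 4) ∧ T.Adj (f 0) (f 5) ∧ T.Adj (f 5) (f 6)

/-- In a tree without spiders there is a path such that every vertex is on it or is adjacent to
it. -/
theorem exists_dominating_path [Finite B] (hT : T.IsTree) (hspider : ¬ HasSpider T) :
    ∃ (L : ℕ) (v : ℕ → B), Set.InjOn v {i | i ≤ L} ∧ (∀ i < L, T.Adj (v i) (v (i + 1))) ∧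
      ∀ x, ∃ i ≤ L, x = v i ∨ T.Adj x (v i) := by
  have := hT.1.nonempty
  -- A longest path is dominating. Otherwise a leg of length two leaves it at some vertex, and
  -- maximality leaves at least two further edges of the path on each side of that vertex: a spider.
  obtain ⟨u, w, p, hp, hmax⟩ := SimpleGraph.Walk.exists_isPath_forall_isPath_length_le_length T
  have hinj := hp.getVert_injOn
  refine ⟨p.length, p.getVert, hinj, fun i hi => p.adj_getVert_succ hi, ?_⟩
  by_contra hcon
  push Not at hcon
  obtain ⟨x, hx⟩ := hcon
  obtain ⟨a, ha, b, hb, hab⟩ : ∃ a, (∃ i ≤ p.length, a = p.getVert i ∨ T.Adj a (p.getVert i)) ∧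
      ∃ b, (∀ i ≤ p.length, b ≠ p.getVert i ∧ ¬ T.Adj b (p.getVert i)) ∧ T.Adj a b := by
    by_contra hno
    push Not at hno
    obtain ⟨q⟩ := hT.1.preconnected u x
    have key : ∀ {c d : B} (_ : T.Walk c d),
        (∃ i ≤ p.length, c = p.getVert i ∨ T.Adj c (p.getVert i)) →
        (∃ i ≤ p.length, d = p.getVert i ∨ T.Adj d (p.getVert i)) := by
      intro c d q
      induction q with
      | nil => exact id
      | cons h _ ih =>
        intro hc
        apply ih
        by_contra hb
        push Not at hb
        exact hno _ hc _ hb h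
    obtain ⟨i, hi, h⟩ := key q ⟨0, Nat.zero_le _, Or.inl (by simp)⟩
    rcases h with h | h
    · exact (hx i hi).1 h
    · exact (hx i hi).2 h
  obtain ⟨i, hi, hai⟩ := ha
  have hai' : T.Adj a (p.getVert i) := by
    rcases hai with rfl | h
    · exact absurd hab.symm (hb i hi).2
    · exact h
  have haoff : ∀ j ≤ p.length, a ≠ p.getVert j := by
    rintro j hj rfl
    exact (hb j hj).2 hab.symm
  have hasupp : a ∉ p.support := by
    rw [SimpleGraph.Walk.mem_support_iff_exists_getVert]
    rintro ⟨j, h, hj⟩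
    exact haoff j hj h.symm
  have hbsupp : b ∉ p.support := by
    rw [SimpleGraph.Walk.mem_support_iff_exists_getVert]
    rintro ⟨j, h, hj⟩
    exact (hb j hj).1 h.symm
  have hlong : ∀ {c : B} (q : T.Walk (p.getVert i) c), q.IsPath → q.support ⊆ p.support →
      q.length + 2 ≤ p.length := by
    intro c q hq hsub
    have := hmax _ _ (.cons hab.symm (.cons hai' q)) (by
      rw [SimpleGraph.Walk.cons_isPath_iff, SimpleGraph.Walk.cons_isPath_iff]
      refine ⟨⟨hq, fun h => hasupp (hsub h)⟩, ?_⟩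
      rw [SimpleGraph.Walk.support_cons, List.mem_cons, not_or]
      exact ⟨hab.ne', fun h => hbsupp (hsub h)⟩)
    simp only [SimpleGraph.Walk.length_cons] at this
    omega
  have h1 := hlong (p.drop i) (hp.drop i) (by
    rw [SimpleGraph.Walk.drop_support_eq_support_drop_min]
    exact List.drop_subset _ _)
  have h2 := hlong (p.take i).reverse (hp.take i).reverse (by
    rw [SimpleGraph.Walk.support_reverse]
    intro y hy
    rw [List.mem_reverse, SimpleGraph.Walk.support_take] at hy
    exact List.take_subset _ _ hy)
  rw [SimpleGraph.Walk.drop_length] at h1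
  rw [SimpleGraph.Walk.length_reverse, SimpleGraph.Walk.take_length] at h2
  have hL : i + 2 ≤ p.length := by omega
  have h2i : 2 ≤ i := by omega
  apply hspider
  obtain ⟨k, rfl⟩ : ∃ k, i = k + 2 := ⟨i - 2, by omega⟩
  refine ⟨![p.getVert (k + 2), p.getVert (k + 1), p.getVert k, p.getVert (k + 3),
    p.getVert (k + 4), a, b], ?_, ?_, ?_, ?_, ?_, ?_, ?_⟩
  · have hne : ∀ i j, i ≤ p.length → j ≤ p.length → i ≠ j → p.getVert i ≠ p.getVert j :=
      fun i j hi hj hij h => hij (hinj hi hj h)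
    have hb' := fun j hj => (hb j hj).1
    rw [← List.nodup_ofFn]
    simp only [List.ofFn_succ, List.ofFn_zero, List.nodup_cons, List.mem_cons,
      List.not_mem_nil, or_false, not_or, List.nodup_nil, and_true]
    refine ⟨⟨?_, ?_, ?_, ?_, ?_, ?_⟩, ⟨?_, ?_, ?_, ?_, ?_⟩, ⟨?_, ?_, ?_, ?_⟩, ⟨?_, ?_, ?_⟩,
      ⟨?_, ?_⟩, ?_, not_false⟩
    all_goals first
      | exact hne _ _ (by omega) (by omega) (by omega)
      | exact (haoff _ (by omega)).symm
      | exact (hb' _ (by omega)).symm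
      | exact hab.ne
  · exact (p.adj_getVert_succ (i := k + 1) (by omega)).symm
  · exact (p.adj_getVert_succ (i := k) (by omega)).symm
  · exact p.adj_getVert_succ (i := k + 2) (by omega)
  · exact p.adj_getVert_succ (i := k + 3) (by omega)
  · exact hai'.symm
  · exact hab

/-- A tree without spiders is a caterpillar: both colour classes can be ordered in such a way that
the edges do not cross. -/
theorem exists_noncrossing_order [Finite B] (hT : T.IsTree) (hspider : ¬ HasSpider T)
    (η : B → ℤ) (hη : ∀ s t, T.Adj s t → |η t - η s| = 1) :
    ∃ ρ : B → ℕ ×ₗ ℕ, Function.Injective ρ ∧ ∀ s s' t t', η s % 2 = η s' % 2 → ρ s < ρ s' →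
      T.Adj s t → T.Adj s' t' → t = t' ∨ ρ t < ρ t' := by
  classical
  obtain ⟨L, v, hinj, hadj, hdom⟩ := exists_dominating_path hT hspider
  have hη' : ∀ s t, T.Adj s t → (η t - η s) % 2 = 1 := by
    intro s t h
    have := hη s t h
    rcases abs_eq (zero_le_one) |>.1 this with h | h <;> rw [h] <;> rfl
  -- a function that is constant along all edges but one is constant on the path
  have hconst : ∀ (f : B → ℤ) (s t : B),
      (∀ a b, T.Adj a b → s(a, b) ≠ s(s, t) → f a = f b) →
      (∀ i < L, s(v i, v (i + 1)) ≠ s(s, t)) → ∀ i ≤ L, ∀ j ≤ L, f (v i) = f (v j) := by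
    intro f s t hf hne
    have h0 : ∀ i ≤ L, f (v i) = f (v 0) := by
      intro i
      induction i with
      | zero => intro _; rfl
      | succ i ih => intro hi; rw [← ih (by omega), hf _ _ (hadj i (by omega)) (hne i (by omega))]
    intro i hi j hj
    rw [h0 i hi, h0 j hj]
  have hconst' : ∀ (f : B → ℤ) (s t : B),
      (∀ a b, T.Adj a b → s(a, b) ≠ s(s, t) → f a = f b) → ∀ i j, i ≤ j → j ≤ L →
      (∀ k, i ≤ k → k < j → s(v k, v (k + 1)) ≠ s(s, t)) → f (v i) = f (v j) := by
    intro f s t hf i j hij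
    induction j, hij using Nat.le_induction with
    | base => intro _ _; rfl
    | succ j hij ih =>
      intro hj hne
      rw [ih (by omega) (fun k h1 h2 => hne k h1 (by omega)),
        hf _ _ (hadj j (by omega)) (hne j hij (by omega))]
  -- A chord would be an edge whose removal does not separate its ends, since the path still joins
  -- them.
  have hspine : ∀ i j, i < j → j ≤ L → T.Adj (v i) (v j) → j = i + 1 := by
    intro i j hij hj h
    by_contra hne
    obtain ⟨f, hf1, hf2⟩ := exists_edge_cut hT h
    refine hf1 (hconst' f _ _ hf2 i j hij.le hj fun k h1 h2 he => ?_)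
    rw [Sym2.eq_iff] at he
    rcases he with ⟨h3, h4⟩ | ⟨h3, h4⟩
    · have := hinj (show k ≤ L by omega) (show i ≤ L by omega) h3
      have := hinj (show k + 1 ≤ L by omega) (show j ≤ L by omega) h4
      omega
    · have := hinj (show k ≤ L by omega) (show j ≤ L by omega) h3
      omega
  have hoff : ∀ x, (∀ i ≤ L, x ≠ v i) → ∀ y i, i < L → s(v i, v (i + 1)) ≠ s(x, y) := by
    intro x hx y i hi he
    rw [Sym2.eq_iff] at he
    rcases he with ⟨h, -⟩ | ⟨-, h⟩
    · exact hx i hi.le h.symm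
    · exact hx (i + 1) hi h.symm
  have hleaf : ∀ x, (∀ i ≤ L, x ≠ v i) → ∀ i ≤ L, ∀ j ≤ L, T.Adj x (v i) → T.Adj x (v j) →
      i = j := by
    intro x hx i hi j hj h1 h2
    by_contra hne
    obtain ⟨f, hf1, hf2⟩ := exists_edge_cut hT h1
    apply hf1
    rw [hconst f _ _ hf2 (hoff x hx _) i hi j hj]
    apply hf2 _ _ h2
    rw [Ne, Sym2.eq_iff]
    rintro (⟨-, h⟩ | ⟨h, -⟩)
    · exact hne (hinj hi hj h.symm)
    · exact hx _ hi h
  have hleaves : ∀ x y, (∀ i ≤ L, x ≠ v i) → (∀ i ≤ L, y ≠ v i) → ¬ T.Adj x y := by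
    intro x y hx hy hxy
    obtain ⟨i, hi, h1⟩ := hdom x
    obtain ⟨j, hj, h2⟩ := hdom y
    have h1 := h1.resolve_left (hx i hi)
    have h2 := h2.resolve_left (hy j hj)
    obtain ⟨f, hf1, hf2⟩ := exists_edge_cut hT hxy
    apply hf1
    rw [hf2 _ _ h1, hf2 _ _ h2, hconst f _ _ hf2 (hoff x hx _) i hi j hj]
    · rw [Ne, Sym2.eq_iff]
      rintro (⟨h, -⟩ | ⟨-, h⟩)
      · exact hxy.ne h.symm
      · exact hx _ hj h.symm
    · rw [Ne, Sym2.eq_iff]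
      rintro (⟨-, h⟩ | ⟨h, -⟩)
      · exact hy _ hi h.symm
      · exact hxy.ne h
  have hdom' : ∀ x, ∃ i ≤ L, ∃ l : ℤ, (l = 0 ∧ x = v i) ∨
      (l = 1 ∧ (∀ j ≤ L, x ≠ v j) ∧ T.Adj x (v i)) := by
    intro x
    by_cases h : ∃ i ≤ L, x = v i
    · obtain ⟨i, hi, h⟩ := h
      exact ⟨i, hi, 0, Or.inl ⟨rfl, h⟩⟩
    · push Not at h
      obtain ⟨i, hi, hx⟩ := hdom x
      exact ⟨i, hi, 1, Or.inr ⟨rfl, h, hx.resolve_left (h i hi)⟩⟩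
  choose pos hposL leaf hpos using hdom'
  have hspineη : ∀ i ≤ L, (η (v i) - η (v 0) - i) % 2 = 0 := by
    intro i
    induction i with
    | zero => intro _; simp
    | succ i ih =>
      intro hi
      have h1 := ih (by omega)
      have h2 := hη' _ _ (hadj i (by omega))
      push_cast
      omega
  -- Here `pos x` is the index of the path vertex that is `x` or its neighbour, and `leaf x` is `1`
  -- off the path. Within a colour class, equal `pos` therefore forces equal `leaf`.
  have hparity : ∀ x, (η x - η (v 0) - pos x - leaf x) % 2 = 0 := by
    intro x
    have h1 := hspineη _ (hposL x)
    rcases hpos x with ⟨h, hx⟩ | ⟨h, -, hx⟩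
    · rw [← hx] at h1; omega
    · have := hη' _ _ hx; omega
  have hedge : ∀ s t, T.Adj s t →
      (leaf s = 0 ∧ leaf t = 0 ∧ ((pos t : ℤ) = pos s + 1 ∨ (pos s : ℤ) = pos t + 1)) ∨
      (leaf s = 1 ∧ leaf t = 0 ∧ pos t = pos s) ∨ (leaf s = 0 ∧ leaf t = 1 ∧ pos t = pos s) := by
    intro s t hst
    rcases hpos s with ⟨h1, hs⟩ | ⟨h1, hs, hs'⟩ <;> rcases hpos t with ⟨h2, ht⟩ | ⟨h2, ht, ht'⟩
    · refine Or.inl ⟨h1, h2, ?_⟩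
      rw [hs, ht] at hst
      rcases lt_trichotomy (pos s) (pos t) with h | h | h
      · have := hspine _ _ h (hposL t) hst; omega
      · rw [h] at hst; exact absurd rfl hst.ne
      · have := hspine _ _ h (hposL s) hst.symm; omega
    · refine Or.inr (Or.inr ⟨h1, h2, ?_⟩)
      rw [hs] at hst
      exact hleaf t ht _ (hposL t) _ (hposL s) ht' hst.symm
    · refine Or.inr (Or.inl ⟨h1, h2, ?_⟩)
      rw [ht] at hst
      exact hleaf s hs _ (hposL t) _ (hposL s) hst hs'
    · exact absurd hst (hleaves s t hs ht)
  have hspine_eq : ∀ x y, leaf x = 0 → leaf y = 0 → pos x = pos y → x = y := by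
    intro x y hx hy h
    rcases hpos x with ⟨-, hx'⟩ | ⟨h1, -⟩
    · rcases hpos y with ⟨-, hy'⟩ | ⟨h1, -⟩
      · rw [hx', hy', h]
      · omega
    · omega
  obtain ⟨n, ⟨e⟩⟩ := Finite.exists_equiv_fin B
  -- Ties in `pos` within a colour class occur only among leaves at one path vertex; that vertex is
  -- their only neighbour, so an arbitrary numbering breaks the ties.
  refine ⟨fun x => toLex (pos x, (e x : ℕ)), ?_, ?_⟩
  · intro x y h
    have h' : (pos x, (e x : ℕ)) = (pos y, (e y : ℕ)) := toLex.injective h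
    exact e.injective (Fin.ext (Prod.ext_iff.1 h').2)
  · intro s s' t t' hss hlt hst hst'
    have p1 := hparity s
    have p2 := hparity s'
    have e1 := hedge s t hst
    have e2 := hedge s' t' hst'
    rw [Prod.Lex.toLex_lt_toLex] at hlt
    rw [Prod.Lex.toLex_lt_toLex]
    by_cases hpt : pos t = pos t'
    · left
      rcases hlt with hlt | ⟨heq, hlt⟩
      · exact hspine_eq _ _ (by dsimp only at hlt; omega) (by dsimp only at hlt; omega) hpt
      · dsimp only at heq hlt
        by_cases hls : leaf s = 0
        · have := hspine_eq s s' hls (by omega) heq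
          rw [this] at hlt
          exact absurd hlt (lt_irrefl _)
        · exact hspine_eq _ _ (by omega) (by omega) hpt
    · right; left
      rcases hlt with hlt | ⟨heq, hlt⟩
      · dsimp only at hlt ⊢; omega
      · dsimp only at heq hlt ⊢
        by_cases hls : leaf s = 0
        · have := hspine_eq s s' hls (by omega) heq
          rw [this] at hlt
          exact absurd hlt (lt_irrefl _)
        · omega

end Trees

end CutPaths

namespace CutPaths

/-! ### Equality of words up to commutations -/

section CommEquiv

variable {B W : Type*} [Group W] {M : CoxeterMatrix B} (cs : CoxeterSystem M W)

theorem CommEquiv.refl (u : List B) : CommEquiv cs u u :=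
  Relation.EqvGen.refl u

variable {cs}

theorem CommEquiv.symm {u v : List B} (h : CommEquiv cs u v) : CommEquiv cs v u :=
  Relation.EqvGen.symm _ _ h

theorem CommEquiv.trans {u v w : List B} (h : CommEquiv cs u v) (h' : CommEquiv cs v w) :
    CommEquiv cs u w :=
  Relation.EqvGen.trans _ _ _ h h'

theorem CommEquiv.cons {u v : List B} (h : CommEquiv cs u v) (i : B) :
    CommEquiv cs (i :: u) (i :: v) := by
  induction h with
  | rel u v h =>
    obtain ⟨a, b, j, k, hjk⟩ := h
    exact Relation.EqvGen.rel _ _ (CommStep.swap (i :: a) b j k hjk)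
  | refl u => exact CommEquiv.refl cs _
  | symm u v _ ih => exact ih.symm
  | trans u v w _ _ ih1 ih2 => exact ih1.trans ih2

theorem CommEquiv.wordProd_eq {u v : List B} (h : CommEquiv cs u v) :
    cs.wordProd u = cs.wordProd v := by
  induction h with
  | rel u v h =>
    obtain ⟨a, b, j, k, hjk⟩ := h
    simp only [cs.wordProd_append, cs.wordProd_cons]
    rw [← mul_assoc (cs.simple j), hjk.eq, mul_assoc]
  | refl u => rfl
  | symm u v _ ih => exact ih.symm
  | trans u v w _ _ ih1 ih2 => exact ih1.trans ih2

theorem commEquiv_move_front {i : B} {u : List B} (v : List B)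
    (h : ∀ j ∈ u, Commute (cs.simple i) (cs.simple j)) :
    CommEquiv cs (u ++ i :: v) (i :: (u ++ v)) := by
  induction u with
  | nil => exact CommEquiv.refl cs _
  | cons j u ih =>
    refine ((ih fun k hk => h k (List.mem_cons_of_mem _ hk)).cons j).trans ?_
    exact Relation.EqvGen.rel _ _ (CommStep.swap [] (u ++ v) j i (h j List.mem_cons_self).symm)

end CommEquiv

/-! ### Letters with times, linear extensions and their products -/

section Heap

variable {B W : Type*} [Group W] {M : CoxeterMatrix B} (cs : CoxeterSystem M W)

/-- The values of a height function differ by one along each edge of the Coxeter graph. -/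
def IsHeight (f : B → ℤ) : Prop :=
  ∀ s t, (coxeterGraph cs).Adj s t → f t = f s + 1 ∨ f s = f t + 1

/-- The time of the letter number `k` with generator `s`. -/
def time (η : B → ℤ) (x : ℤ × B) : ℤ :=
  η x.2 + 2 * x.1

/-- Two letters that do not commute are ordered by their times. -/
def Precedes (η : B → ℤ) (x y : ℤ × B) : Prop :=
  time η x < time η y ∧ ¬ Commute (cs.simple x.2) (cs.simple y.2)

/-- A list of letters is a linear extension if it respects the order of noncommuting letters. -/
def IsLinearExtension (η : B → ℤ) (l : List (ℤ × B)) : Prop :=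
  l.Pairwise fun x y => ¬ Precedes cs η y x

variable {cs} {η : B → ℤ}

theorem IsHeight.time_ne (hη : IsHeight cs η) {x y : ℤ × B}
    (h : ¬ Commute (cs.simple x.2) (cs.simple y.2)) : time η x ≠ time η y := by
  have := hη x.2 y.2 h
  simp only [time]
  omega

theorem commute_of_not_precedes (hη : IsHeight cs η) {x y : ℤ × B} (h1 : ¬ Precedes cs η x y)
    (h2 : ¬ Precedes cs η y x) : Commute (cs.simple x.2) (cs.simple y.2) := by
  by_contra h
  rcases lt_or_gt_of_ne (hη.time_ne h) with h3 | h3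
  · exact h1 ⟨h3, h⟩
  · exact h2 ⟨h3, fun h' => h h'.symm⟩

/-- Two linear extensions of the same collection of letters coincide up to commutations. -/
theorem IsLinearExtension.commEquiv (hη : IsHeight cs η) {l l' : List (ℤ × B)} (hp : l.Perm l')
    (hl : IsLinearExtension cs η l) (hl' : IsLinearExtension cs η l') :
    CommEquiv cs (l.map Prod.snd) (l'.map Prod.snd) := by
  induction l generalizing l' with
  | nil => rw [hp.nil_eq]; exact CommEquiv.refl cs _
  | cons x l ih =>
    -- The head `x` of the first list is incomparable to everything before it in the second list,
    -- hence commutes with it and can be moved to the front.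
    obtain ⟨a, b, rfl⟩ := List.append_of_mem (hp.subset List.mem_cons_self)
    have hp' : l.Perm (a ++ b) :=
      (List.perm_cons x).1 (hp.trans List.perm_middle)
    have hab : IsLinearExtension cs η (a ++ b) := by
      refine List.Pairwise.sublist ?_ hl'
      exact (List.Sublist.refl a).append (List.sublist_cons_self x b)
    have h1 := (ih hp' (List.pairwise_cons.1 hl).2 hab).cons x.2
    rw [List.map_cons]
    refine h1.trans (CommEquiv.symm ?_)
    rw [List.map_append, List.map_append, List.map_cons]
    apply commEquiv_move_front
    intro j hj
    obtain ⟨y, hy, rfl⟩ := List.mem_map.1 hj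
    have h2 := (List.pairwise_cons.1 hl).1 y (hp'.symm.subset (List.mem_append_left _ hy))
    have h3 := (List.pairwise_append.1 hl').2.2 y hy x List.mem_cons_self
    exact commute_of_not_precedes hη h3 h2

variable (η) in
/-- A linear extension of a finite set of letters: the letters are sorted by time. -/
noncomputable def heapList (I : Finset (ℤ × B)) : List (ℤ × B) :=
  I.toList.mergeSort fun x y => decide (time η x ≤ time η y)

theorem heapList_perm (I : Finset (ℤ × B)) : (heapList η I).Perm I.toList :=
  List.mergeSort_perm _ _

theorem mem_heapList {I : Finset (ℤ × B)} {x : ℤ × B} : x ∈ heapList η I ↔ x ∈ I := by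
  rw [(heapList_perm I).mem_iff, Finset.mem_toList]

theorem nodup_heapList (I : Finset (ℤ × B)) : (heapList η I).Nodup :=
  (heapList_perm I).nodup_iff.2 I.nodup_toList

theorem length_heapList (I : Finset (ℤ × B)) : (heapList η I).length = I.card := by
  rw [(heapList_perm I).length_eq, Finset.length_toList]

theorem isLinearExtension_heapList (I : Finset (ℤ × B)) :
    IsLinearExtension cs η (heapList η I) := by
  have h : (heapList η I).Pairwise fun x y => decide (time η x ≤ time η y) = true := by
    apply List.pairwise_mergeSort
    · intro a b c h1 h2
      simp only [decide_eq_true_eq] at *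
      omega
    · intro a b
      simp only [Bool.or_eq_true, decide_eq_true_eq]
      omega
  refine h.imp ?_
  intro x y hxy h
  simp only [decide_eq_true_eq] at hxy
  have := h.1
  omega

variable (cs η) in
/-- The product of a finite set of letters, in the order of a linear extension. -/
noncomputable def heapProd (I : Finset (ℤ × B)) : W :=
  cs.wordProd ((heapList η I).map Prod.snd)

theorem wordProd_eq_heapProd (hη : IsHeight cs η) {l : List (ℤ × B)} {I : Finset (ℤ × B)}
    (hnodup : l.Nodup) (hmem : ∀ x, x ∈ l ↔ x ∈ I) (hl : IsLinearExtension cs η l) :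
    cs.wordProd (l.map Prod.snd) = heapProd cs η I := by
  refine (IsLinearExtension.commEquiv hη ?_ hl (isLinearExtension_heapList I)).wordProd_eq
  rw [List.perm_ext_iff_of_nodup hnodup (nodup_heapList I)]
  intro x
  rw [hmem, mem_heapList]

theorem isLinearExtension_append {l l' : List (ℤ × B)} (hl : IsLinearExtension cs η l)
    (hl' : IsLinearExtension cs η l') (h : ∀ x ∈ l, ∀ y ∈ l', ¬ Precedes cs η y x) :
    IsLinearExtension cs η (l ++ l') :=
  List.pairwise_append.2 ⟨hl, hl', h⟩

theorem heapProd_union [DecidableEq B] (hη : IsHeight cs η) {J K : Finset (ℤ × B)}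
    (hd : Disjoint J K) (h : ∀ x ∈ J, ∀ y ∈ K, ¬ Precedes cs η y x) :
    heapProd cs η (J ∪ K) = heapProd cs η J * heapProd cs η K := by
  rw [heapProd.eq_1 cs η J, heapProd.eq_1 cs η K, ← cs.wordProd_append, ← List.map_append]
  refine (wordProd_eq_heapProd hη ?_ ?_ ?_).symm
  · rw [List.nodup_append]
    refine ⟨nodup_heapList J, nodup_heapList K, ?_⟩
    rintro a ha b hb rfl
    exact Finset.disjoint_left.1 hd (mem_heapList.1 ha) (mem_heapList.1 hb)
  · intro x
    rw [List.mem_append, mem_heapList, mem_heapList, Finset.mem_union]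
  · refine isLinearExtension_append (isLinearExtension_heapList J) (isLinearExtension_heapList K) ?_
    intro x hx y hy
    exact h x (mem_heapList.1 hx) y (mem_heapList.1 hy)

theorem heapProd_singleton (x : ℤ × B) : heapProd cs η {x} = cs.simple x.2 := by
  rw [heapProd, heapList]
  simp

theorem heapProd_empty : heapProd cs η ∅ = 1 := by
  rw [heapProd, heapList]
  simp

theorem length_heapProd_le (I : Finset (ℤ × B)) : cs.length (heapProd cs η I) ≤ I.card := by
  refine (cs.length_wordProd_le _).trans ?_
  rw [List.length_map, length_heapList]

end Heap

/-! ### Ideals of letters and the intervals between them -/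

section Intervals

variable {B W : Type*} [Fintype B] [DecidableEq B] [Group W] {M : CoxeterMatrix B}
  (cs : CoxeterSystem M W)

/-- The letters `(k, s)` such that `a s ≤ k < b s`. -/
noncomputable def interval (a b : B → ℤ) : Finset (ℤ × B) :=
  Finset.univ.biUnion fun s => (Finset.Ico (a s) (b s)).image fun k => (k, s)

theorem mem_interval {a b : B → ℤ} {k : ℤ} {s : B} :
    (k, s) ∈ interval a b ↔ a s ≤ k ∧ k < b s := by
  simp only [interval, Finset.mem_biUnion, Finset.mem_univ, Finset.mem_image, Finset.mem_Ico,
    Prod.mk.injEq, true_and]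
  constructor
  · rintro ⟨t, j, h, rfl, rfl⟩; exact h
  · intro h; exact ⟨s, k, h, rfl, rfl⟩

theorem mem_interval' {a b : B → ℤ} {x : ℤ × B} :
    x ∈ interval a b ↔ a x.2 ≤ x.1 ∧ x.1 < b x.2 :=
  mem_interval

/-- The function `a` describes the ideal of all letters `(k, s)` with `k < a s`. -/
def IsIdeal (η a : B → ℤ) : Prop :=
  IsHeight cs fun s => η s + 2 * a s

variable {cs} {η : B → ℤ}

/-- `η s + 2 * a s` is the time of the first letter of `s` outside the ideal. Since these times
differ by exactly one at adjacent generators, an earlier noncommuting letter cannot be outside. -/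
theorem IsIdeal.mem_of_precedes {a : B → ℤ} (ha : IsIdeal cs η a) {x y : ℤ × B}
    (h : Precedes cs η x y) (hy : y.1 < a y.2) : x.1 < a x.2 := by
  have h1 := ha x.2 y.2 h.2
  have h2 := h.1
  simp only [time] at h2
  dsimp only at h1
  omega

theorem heapProd_interval_mul (hη : IsHeight cs η) {a b c : B → ℤ} (hb : IsIdeal cs η b)
    (hab : ∀ s, a s ≤ b s) (hbc : ∀ s, b s ≤ c s) :
    heapProd cs η (interval a c) =
      heapProd cs η (interval a b) * heapProd cs η (interval b c) := by
  rw [← heapProd_union hη]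
  · congr 1
    ext ⟨k, s⟩
    rw [Finset.mem_union, mem_interval, mem_interval, mem_interval]
    have := hab s
    have := hbc s
    omega
  · rw [Finset.disjoint_left]
    rintro ⟨k, s⟩ h1 h2
    rw [mem_interval] at h1 h2
    omega
  · rintro x hx y hy h
    rw [mem_interval'] at hx hy
    have := hb.mem_of_precedes h hx.2
    omega

theorem card_interval_add {a b c : B → ℤ} (hab : ∀ s, a s ≤ b s) (hbc : ∀ s, b s ≤ c s) :
    (interval a c).card = (interval a b).card + (interval b c).card := by
  rw [← Finset.card_union_of_disjoint]
  · congr 1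
    ext ⟨k, s⟩
    rw [Finset.mem_union, mem_interval, mem_interval, mem_interval]
    have := hab s
    have := hbc s
    omega
  · rw [Finset.disjoint_left]
    rintro ⟨k, s⟩ h1 h2
    rw [mem_interval] at h1 h2
    omega

end Intervals

end CutPaths

namespace CutPaths

/-! ### The longest element and the involution it induces -/

section Longest

variable {B W : Type*} [Fintype B] [DecidableEq B] [Group W] {M : CoxeterMatrix B}
  (cs : CoxeterSystem M W)

theorem geomRep_nonpos_of_forall_descent {w : W} (h : ∀ i, cs.IsRightDescent w i) {x : B → ℝ}
    (hx : ∀ k, 0 ≤ x k) (k : B) : geomRep cs w x k ≤ 0 := by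
  rw [eq_sum_simpleRoot x, map_sum, Finset.sum_apply]
  refine Finset.sum_nonpos fun i _ => ?_
  rw [map_smul, Pi.smul_apply, smul_eq_mul]
  exact mul_nonpos_of_nonneg_of_nonpos (hx i) (geomRep_simpleRoot_nonpos cs w i (h i) k)

/-- `w` makes every nonnegative combination of simple roots nonpositive. If `u = u' s_i` is longer
than `u'`, then `u' α_i` is such a combination, so `s_i` shortens `w u'`. -/
theorem length_mul_add_of_forall_descent {w : W} (h : ∀ i, cs.IsRightDescent w i) (u : W) :
    cs.length (w * u) + cs.length u = cs.length w := by
  induction hn : cs.length u generalizing u with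
  | zero =>
    rw [cs.length_eq_zero_iff] at hn
    simp [hn]
  | succ n ih =>
    have hu : u ≠ 1 := by
      rintro rfl; simp at hn
    obtain ⟨i, hi⟩ := cs.exists_rightDescent_of_ne_one hu
    have h1 := (cs.isRightDescent_iff).1 hi
    have h2 := ih (u * cs.simple i) (by omega)
    have h3 : cs.IsRightDescent (w * (u * cs.simple i)) i := by
      apply isRightDescent_of_nonpos
      intro k
      rw [geomRep_mul_apply]
      apply geomRep_nonpos_of_forall_descent cs h
      exact geomRep_simpleRoot_nonneg cs _ i ((cs.isRightDescent_iff_not_isRightDescent_mul).1 hi)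
    have h4 := (cs.isRightDescent_iff).1 h3
    rw [mul_assoc, mul_assoc, cs.simple_mul_simple_self, mul_one] at h4
    omega

variable [Finite W]

theorem length_le_length_longest (w : W) : cs.length w ≤ cs.length (longest cs) :=
  (exists_longest cs).choose_spec w

theorem isRightDescent_longest (i : B) : cs.IsRightDescent (longest cs) i := by
  have h1 := length_le_length_longest cs (longest cs * cs.simple i)
  have h2 := cs.length_mul_simple_ne (longest cs) i
  exact lt_of_le_of_ne h1 h2

theorem length_longest_mul_add (u : W) :
    cs.length (longest cs * u) + cs.length u = cs.length (longest cs) :=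
  length_mul_add_of_forall_descent cs (isRightDescent_longest cs) u

theorem longest_mul_self : longest cs * longest cs = 1 := by
  have := length_longest_mul_add cs (longest cs)
  rw [← cs.length_eq_zero_iff]
  omega

theorem longest_inv : (longest cs)⁻¹ = longest cs :=
  inv_eq_of_mul_eq_one_left (longest_mul_self cs)

theorem eq_longest_of_length_eq {w : W} (h : cs.length w = cs.length (longest cs)) :
    w = longest cs := by
  have h1 := length_longest_mul_add cs w
  have h2 : longest cs * w = 1 := by
    rw [← cs.length_eq_zero_iff]; omega
  rw [← longest_inv]
  exact eq_inv_of_mul_eq_one_right h2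

theorem eq_longest_of_forall_descent {w : W} (h : ∀ i, cs.IsRightDescent w i) :
    w = longest cs := by
  apply eq_longest_of_length_eq
  have h1 := length_mul_add_of_forall_descent cs h (longest cs)
  have h2 := length_le_length_longest cs w
  omega

/-- Multiplication by the longest element complements lengths, and `s w₀` is the inverse of `w₀ s`;
so `w₀ s w₀` has length one. -/
theorem exists_psi_simple (i : B) : ∃ j, cs.simple j = psi cs (cs.simple i) := by
  have h1 := length_longest_mul_add cs (cs.simple i * longest cs)
  have h2 := length_longest_mul_add cs (cs.simple i)
  rw [cs.length_simple] at h2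
  have h3 : cs.length (cs.simple i * longest cs) = cs.length (longest cs * cs.simple i) := by
    rw [← cs.length_inv, mul_inv_rev, longest_inv, cs.inv_simple]
  have h4 : cs.length (psi cs (cs.simple i)) = 1 := by
    rw [psi, longest_inv, mul_assoc]; omega
  obtain ⟨j, hj⟩ := (cs.length_eq_one_iff).1 h4
  exact ⟨j, hj.symm⟩

/-- The permutation of the generators that is induced by `psi`. -/
noncomputable def psiIndex (i : B) : B :=
  (exists_psi_simple cs i).choose

theorem simple_psiIndex (i : B) : cs.simple (psiIndex cs i) = psi cs (cs.simple i) :=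
  (exists_psi_simple cs i).choose_spec

theorem longest_mul_simple (i : B) :
    longest cs * cs.simple (psiIndex cs i) = cs.simple i * longest cs := by
  rw [simple_psiIndex, psi]; group

theorem psi_psi (w : W) : psi cs (psi cs w) = w := by
  rw [psi, psi, longest_inv]
  simp only [mul_assoc, longest_mul_self, mul_one]
  rw [← mul_assoc, longest_mul_self, one_mul]

theorem psiIndex_psiIndex (i : B) : psiIndex cs (psiIndex cs i) = i := by
  apply simple_injective cs
  rw [simple_psiIndex, simple_psiIndex, psi_psi]

theorem psiIndex_injective : Function.Injective (psiIndex cs) :=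
  Function.LeftInverse.injective (psiIndex_psiIndex cs)

theorem commute_psiIndex {i j : B} :
    Commute (cs.simple (psiIndex cs i)) (cs.simple (psiIndex cs j)) ↔
      Commute (cs.simple i) (cs.simple j) := by
  have key : ∀ a b, Commute (cs.simple a) (cs.simple b) →
      Commute (cs.simple (psiIndex cs a)) (cs.simple (psiIndex cs b)) := by
    intro a b h
    rw [simple_psiIndex, simple_psiIndex, psi, psi]
    have := h.map (MulAut.conj (longest cs)⁻¹)
    simpa [MulAut.conj_apply] using this
  refine ⟨fun h => ?_, key i j⟩
  have := key _ _ h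
  rwa [psiIndex_psiIndex, psiIndex_psiIndex] at this

theorem coxeterGraph_adj_psiIndex {i j : B} :
    (coxeterGraph cs).Adj (psiIndex cs i) (psiIndex cs j) ↔ (coxeterGraph cs).Adj i j :=
  not_congr (commute_psiIndex cs)

/-- A simple root that does not occur in a word survives. -/
theorem geomRep_wordProd_of_not_mem {l : List B} {i : B} (hi : i ∉ l) :
    geomRep cs (cs.wordProd l) (simpleRoot i) i = 1 := by
  have key : ∀ x : B → ℝ, geomRep cs (cs.wordProd l) x i = x i := by
    induction l with
    | nil => intro x; simp
    | cons j l ih =>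
      intro x
      rw [List.mem_cons, not_or] at hi
      rw [cs.wordProd_cons, geomRep_mul_apply, geomRep_simple_apply]
      simp [simpleRoot, hi.1, ih hi.2]
  rw [key]; simp [simpleRoot]

theorem mem_of_isRightDescent {l : List B} {i : B} (h : cs.IsRightDescent (cs.wordProd l) i) :
    i ∈ l := by
  by_contra hi
  have h1 := geomRep_simpleRoot_nonpos cs _ i h i
  rw [geomRep_wordProd_of_not_mem cs hi] at h1
  norm_num at h1

/-- All generators are descents of the longest element, and a descent occurs in every word. This is
the source of the strict inequalities between a slice and its Nakayama translate. -/
theorem exists_mem_of_heapProd_eq_longest {η : B → ℤ} {I : Finset (ℤ × B)}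
    (h : heapProd cs η I = longest cs) (i : B) : ∃ k, (k, i) ∈ I := by
  have h1 := isRightDescent_longest cs i
  rw [← h, heapProd] at h1
  obtain ⟨⟨k, j⟩, hx, rfl⟩ := List.mem_map.1 (mem_of_isRightDescent cs h1)
  exact ⟨k, mem_heapList.1 hx⟩

end Longest

/-! ### Products of commuting generators -/

section CommutingLetters

variable {B W : Type*} [Fintype B] [DecidableEq B] [Group W] {M : CoxeterMatrix B}
  (cs : CoxeterSystem M W)

theorem geomRep_wordProd_of_commute {l : List B} {i : B}
    (h : ∀ j ∈ l, j ≠ i ∧ Commute (cs.simple j) (cs.simple i)) :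
    geomRep cs (cs.wordProd l) (simpleRoot i) = simpleRoot i := by
  induction l with
  | nil => simp
  | cons j l ih =>
    have hj := h j List.mem_cons_self
    rw [cs.wordProd_cons, geomRep_mul_apply, ih fun k hk => h k (List.mem_cons_of_mem _ hk),
      geomRep_simple_apply, simpleCoroot_simpleRoot, (commute_simple_iff cs hj.1).1 hj.2]
    simp

/-- The action of a product of pairwise commuting simple reflections. -/
theorem geomRep_wordProd_of_pairwise_commute {l : List B}
    (hl : l.Pairwise fun i j => i ≠ j ∧ Commute (cs.simple i) (cs.simple j)) (x : B → ℝ) :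
    geomRep cs (cs.wordProd l) x = x - (l.map fun i => simpleCoroot M i x • simpleRoot i).sum := by
  induction l with
  | nil => simp
  | cons j l ih =>
    rw [List.pairwise_cons] at hl
    have h0 : simpleCoroot M j (l.map fun i => simpleCoroot M i x • simpleRoot i).sum = 0 := by
      rw [map_list_sum, List.map_map]
      apply List.sum_eq_zero
      intro r hr
      obtain ⟨i, hi, rfl⟩ := List.mem_map.1 hr
      have := hl.1 i hi
      simp [simpleCoroot_simpleRoot, (commute_simple_iff cs this.1).1 this.2]
    rw [cs.wordProd_cons, geomRep_mul_apply, ih hl.2, geomRep_simple_apply, map_sub, h0,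
      List.map_cons, List.sum_cons]
    module

/-- The generators already appended fix the simple root of the next one, so whether it is a descent
is decided by `w` alone. -/
theorem length_mul_wordProd_of_pairwise_commute {w : W} {l : List B}
    (hl : l.Pairwise fun i j => i ≠ j ∧ Commute (cs.simple i) (cs.simple j))
    (hw : ∀ i ∈ l, ¬ cs.IsRightDescent w i) :
    cs.length (w * cs.wordProd l) = cs.length w + l.length := by
  induction l using List.reverseRecOn with
  | nil => simp
  | append_singleton l i ih =>
    rw [List.pairwise_append] at hl
    have h1 := ih hl.1 fun j hj => hw j (List.mem_append_left _ hj)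
    have h2 : ¬ cs.IsRightDescent (w * cs.wordProd l) i := by
      have h3 := geomRep_simpleRoot_nonneg cs w i (hw i (by simp))
      intro hd
      have h4 := geomRep_simpleRoot_nonpos cs _ i hd
      rw [geomRep_mul_apply, geomRep_wordProd_of_commute cs
        (fun j hj => hl.2.2 j hj i List.mem_cons_self)] at h4
      exact geomRep_simpleRoot_ne_zero cs w i (funext fun k => le_antisymm (h4 k) (h3 k))
    have h5 := (cs.not_isRightDescent_iff).1 h2
    rw [cs.wordProd_append, cs.wordProd_singleton, ← mul_assoc, h5, h1, List.length_append,
      List.length_singleton]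
    ring

end CommutingLetters

end CutPaths

namespace CutPaths

/-! ### The bipartite word of the longest element -/

section Bipartite

variable {B W : Type*} [Fintype B] [DecidableEq B] [Group W] {M : CoxeterMatrix B}
  {cs : CoxeterSystem M W} {η : B → ℤ}

/-- The ideal of all letters whose time is less than `t`. -/
def timeIdeal (η : B → ℤ) (t : ℤ) (s : B) : ℤ :=
  -((η s - t) / 2)

/-- The double negation in `timeIdeal` is the ceiling of `(t - η s) / 2`. -/
theorem lt_timeIdeal {t k : ℤ} {s : B} : k < timeIdeal η t s ↔ η s + 2 * k < t := by
  rw [timeIdeal]; omega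

theorem timeIdeal_le {t k : ℤ} {s : B} : timeIdeal η t s ≤ k ↔ t ≤ η s + 2 * k := by
  rw [timeIdeal]; omega

theorem timeIdeal_mono {t t' : ℤ} (h : t ≤ t') (s : B) : timeIdeal η t s ≤ timeIdeal η t' s := by
  rw [timeIdeal, timeIdeal]; omega

theorem isIdeal_timeIdeal (hη : IsHeight cs η) (t : ℤ) : IsIdeal cs η (timeIdeal η t) := by
  intro r s h
  have := hη r s h
  simp only [timeIdeal]
  omega

variable (η) in
/-- The generators of the letters with time `t`. -/
noncomputable def layer (t : ℤ) : List B :=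
  (Finset.univ.filter fun s => η s % 2 = t % 2).toList

theorem mem_layer {t : ℤ} {s : B} : s ∈ layer η t ↔ η s % 2 = t % 2 := by
  simp [layer]

theorem commute_of_parity (hη : IsHeight cs η) {r s : B} (h : η r % 2 = η s % 2) :
    Commute (cs.simple r) (cs.simple s) := by
  by_contra hc
  have := hη r s hc
  omega

theorem pairwise_layer (hη : IsHeight cs η) (t : ℤ) :
    (layer η t).Pairwise fun i j => i ≠ j ∧ Commute (cs.simple i) (cs.simple j) := by
  have h : (layer η t).Nodup := Finset.nodup_toList _
  refine List.Pairwise.imp_of_mem ?_ h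
  intro i j hi hj hij
  refine ⟨hij, commute_of_parity hη ?_⟩
  rw [mem_layer.1 hi, mem_layer.1 hj]

theorem mem_interval_timeIdeal {t : ℤ} {k : ℤ} {s : B} :
    (k, s) ∈ interval (timeIdeal η t) (timeIdeal η (t + 1)) ↔ η s + 2 * k = t := by
  rw [mem_interval, timeIdeal_le, lt_timeIdeal]; omega

theorem heapProd_layer (hη : IsHeight cs η) (t : ℤ) :
    heapProd cs η (interval (timeIdeal η t) (timeIdeal η (t + 1))) =
      cs.wordProd (layer η t) := by
  rw [← wordProd_eq_heapProd hη (l := (layer η t).map fun s => ((t - η s) / 2, s))]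
  · rw [List.map_map]
    congr 1
    exact List.map_id _
  · refine List.Nodup.map ?_ (Finset.nodup_toList _)
    intro a b h
    exact (Prod.ext_iff.1 h).2
  · rintro ⟨k, s⟩
    rw [mem_interval_timeIdeal, List.mem_map]
    constructor
    · rintro ⟨r, hr, h⟩
      rw [mem_layer] at hr
      obtain ⟨rfl, rfl⟩ := Prod.ext_iff.1 h
      dsimp only
      omega
    · intro h
      refine ⟨s, mem_layer.2 (by omega), Prod.ext ?_ rfl⟩
      dsimp only
      omega
  · rw [IsLinearExtension, List.pairwise_map]
    refine List.Pairwise.imp_of_mem ?_ (pairwise_layer hη t)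
    rintro r s hr hs - ⟨h, -⟩
    rw [mem_layer] at hr hs
    simp only [time] at h
    omega

theorem card_layer (t : ℤ) :
    (interval (timeIdeal η t) (timeIdeal η (t + 1))).card = (layer η t).length := by
  symm
  rw [layer, Finset.length_toList]
  refine Finset.card_bij (fun s _ => ((t - η s) / 2, s)) ?_ ?_ ?_
  · intro s hs
    rw [mem_interval_timeIdeal]
    have := (Finset.mem_filter.1 hs).2
    omega
  · intro r _ s _ h
    exact (Prod.ext_iff.1 h).2
  · rintro ⟨k, s⟩ h
    rw [mem_interval_timeIdeal] at h
    refine ⟨s, Finset.mem_filter.2 ⟨Finset.mem_univ _, by omega⟩, Prod.ext ?_ rfl⟩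
    dsimp only
    omega

variable (cs η) in
/-- The product of the first `t` layers. -/
noncomputable def layerProd (t : ℕ) : W :=
  heapProd cs η (interval (timeIdeal η 0) (timeIdeal η t))

theorem layerProd_zero : layerProd cs η 0 = 1 := by
  have : interval (timeIdeal η 0) (timeIdeal η ((0 : ℕ) : ℤ)) = ∅ := by
    ext ⟨k, s⟩
    rw [mem_interval]
    simp only [Nat.cast_zero, Finset.notMem_empty, iff_false]
    omega
  rw [layerProd, this, heapProd_empty]

theorem layerProd_succ (hη : IsHeight cs η) (t : ℕ) :
    layerProd cs η (t + 1) = layerProd cs η t * cs.wordProd (layer η t) := by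
  rw [layerProd, heapProd_interval_mul hη (isIdeal_timeIdeal hη t)
    (timeIdeal_mono (by positivity)) (timeIdeal_mono (by push_cast; omega)), layerProd]
  push_cast
  rw [heapProd_layer hη]

theorem card_interval_succ (t : ℕ) :
    (interval (timeIdeal η 0) (timeIdeal η ((t + 1 : ℕ) : ℤ))).card =
      (interval (timeIdeal η 0) (timeIdeal η t)).card + (layer η t).length := by
  rw [card_interval_add (b := timeIdeal η t)
    (timeIdeal_mono (by positivity)) (timeIdeal_mono (by push_cast; omega))]
  push_cast
  rw [card_layer]

/-- The recurrence that governs the roots along the layers. -/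
def layerCoeff (l u v : ℝ) : ℕ → ℝ
  | 0 => -v
  | 1 => u
  | t + 2 => l * layerCoeff l u v (t + 1) - layerCoeff l u v t

/-- Makes the sign of one coordinate available from the other, one layer earlier; this decides how
the longest element permutes the colours. -/
theorem layerCoeff_shift (l : ℝ) : ∀ t, layerCoeff l 0 1 (t + 1) = layerCoeff l 1 0 t
  | 0 => by simp [layerCoeff]
  | 1 => by simp [layerCoeff]
  | t + 2 => by
    rw [layerCoeff, layerCoeff_shift l (t + 1), layerCoeff_shift l t, layerCoeff]

/-- A functional that is a multiple of the eigenvector `x` on each colour class. -/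
noncomputable def colourFunctional (η : B → ℤ) (x : B → ℝ) (u v : ℝ) : Module.Dual ℝ (B → ℝ) :=
  ∑ s, ((if η s % 2 = 0 then u else v) * x s) • LinearMap.proj s

theorem colourFunctional_apply (x : B → ℝ) (u v : ℝ) (z : B → ℝ) :
    colourFunctional η x u v z = ∑ s, ((if η s % 2 = 0 then u else v) * x s) * z s := by
  simp only [colourFunctional, LinearMap.sum_apply, LinearMap.smul_apply, LinearMap.proj_apply,
    smul_eq_mul]

theorem colourFunctional_simpleRoot (x : B → ℝ) (u v : ℝ) (s : B) :
    colourFunctional η x u v (simpleRoot s) = (if η s % 2 = 0 then u else v) * x s := by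
  simp [colourFunctional_apply, simpleRoot, Pi.single_apply]

theorem colourFunctional_nonneg {x : B → ℝ} (hx : ∀ i, 0 < x i) {u v : ℝ} (hu : 0 ≤ u)
    (hv : 0 ≤ v) {z : B → ℝ} (hz : ∀ k, 0 ≤ z k) : 0 ≤ colourFunctional η x u v z := by
  rw [colourFunctional_apply]
  refine Finset.sum_nonneg fun s _ => mul_nonneg (mul_nonneg ?_ (hx s).le) (hz s)
  split_ifs <;> assumption

theorem colourFunctional_pos {x : B → ℝ} (hx : ∀ i, 0 < x i) {z : B → ℝ} (hz : ∀ k, 0 ≤ z k)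
    (hz0 : z ≠ 0) : 0 < colourFunctional η x 1 1 z := by
  rw [colourFunctional_apply]
  obtain ⟨k, hk⟩ := Function.ne_iff.1 hz0
  simp only [ite_self, one_mul]
  refine Finset.sum_pos' (fun s _ => mul_nonneg (hx s).le (hz s)) ⟨k, Finset.mem_univ _, ?_⟩
  exact mul_pos (hx k) (lt_of_le_of_ne (hz k) (Ne.symm hk))

/-- On the plane spanned by the two colour parts of the eigenvector, each layer acts as a
reflection, and alternating them is a dihedral recurrence. The two cases are the colour of the next
layer and that of the previous one. -/
theorem colourFunctional_layerProd (hη : IsHeight cs η) {x : B → ℝ} {l : ℝ}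
    (hx : ∀ i, ∑ j, (if i = j then 0 else -(2 * coxForm M i j)) * x j = l * x i) (u v : ℝ)
    (t : ℕ) (s : B) :
    colourFunctional η x u v (geomRep cs (layerProd cs η t) (simpleRoot s)) =
      if η s % 2 = (t : ℤ) % 2 then x s * layerCoeff l u v (t + 1)
      else -(x s * layerCoeff l u v t) := by
  induction t generalizing s with
  | zero =>
    rw [layerProd_zero, map_one]
    simp only [LinearEquiv.coe_one, id_eq, colourFunctional_simpleRoot, layerCoeff]
    simp only [Nat.cast_zero, Int.zero_emod]
    split_ifs <;> ring
  | succ t ih =>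
    rw [layerProd_succ hη, geomRep_mul_apply,
      geomRep_wordProd_of_pairwise_commute cs (pairwise_layer hη _)]
    have hsum : ((layer η t).map fun i => simpleCoroot M i (simpleRoot s) •
        (simpleRoot i : B → ℝ)).sum =
        ∑ i ∈ Finset.univ.filter (fun r => η r % 2 = (t : ℤ) % 2),
          (2 * coxForm M i s) • simpleRoot i := by
      rw [layer, Finset.sum_map_toList]
      simp only [simpleCoroot_simpleRoot]
    rw [hsum]
    simp only [map_sub, map_sum, map_smul, smul_eq_mul, ih]
    by_cases hs : η s % 2 = (t : ℤ) % 2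
    · rw [if_pos hs, if_neg (by push_cast; omega)]
      have : ∑ i ∈ Finset.univ.filter (fun r => η r % 2 = (t : ℤ) % 2),
          2 * coxForm M i s * (if η i % 2 = (t : ℤ) % 2 then x i * layerCoeff l u v (t + 1)
            else -(x i * layerCoeff l u v t)) = 2 * (x s * layerCoeff l u v (t + 1)) := by
        rw [Finset.sum_eq_single s]
        · rw [if_pos hs, coxForm_self]; ring
        · intro r hr hrs
          have hr' := (Finset.mem_filter.1 hr).2
          rw [(commute_simple_iff cs hrs).1 (commute_of_parity hη (by omega))]
          ring
        · intro h
          exact absurd (by simpa using hs) h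
      rw [this]
      ring
    · rw [if_neg hs, if_pos (by push_cast; omega)]
      have : ∑ i ∈ Finset.univ.filter (fun r => η r % 2 = (t : ℤ) % 2),
          2 * coxForm M i s * (if η i % 2 = (t : ℤ) % 2 then x i * layerCoeff l u v (t + 1)
            else -(x i * layerCoeff l u v t)) = -(l * x s * layerCoeff l u v (t + 1)) := by
        rw [← hx s, Finset.sum_filter, Finset.sum_mul, ← Finset.sum_neg_distrib]
        refine Finset.sum_congr rfl fun r _ => ?_
        by_cases hr : η r % 2 = (t : ℤ) % 2
        · have hsr : s ≠ r := by rintro rfl; exact hs hr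
          rw [if_pos hr, if_pos hr, if_neg hsr, coxForm_symm M r s]
          ring
        · rw [if_neg hr]
          by_cases hsr : s = r
          · simp [hsr]
          · rw [if_neg hsr, (commute_simple_iff cs hsr).1 (commute_of_parity hη (by omega))]
            ring
      rw [this, layerCoeff]
      ring

theorem exists_adj [Nontrivial B] (hirr : (coxeterGraph cs).Connected) (s : B) :
    ∃ t, (coxeterGraph cs).Adj s t :=
  hirr.preconnected.exists_adj_of_nontrivial s

theorem exists_parity [Nontrivial B] (hirr : (coxeterGraph cs).Connected) (hη : IsHeight cs η)
    (t : ℤ) : ∃ s, η s % 2 = t % 2 := by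
  obtain ⟨s⟩ := hirr.nonempty
  obtain ⟨r, hr⟩ := exists_adj hirr s
  have := hη s r hr
  by_cases h : η s % 2 = t % 2
  · exact ⟨s, h⟩
  · exact ⟨r, by omega⟩

/-- Steinberg's theorem: an alternating product of the two colour classes is a reduced expression
of the longest element. -/
theorem exists_layerProd_eq_longest [Finite W] [Nontrivial B] (hirr : (coxeterGraph cs).Connected)
    (hη : IsHeight cs η) :
    ∃ m : ℕ, 1 ≤ m ∧ layerProd cs η m = longest cs ∧
      (interval (timeIdeal η 0) (timeIdeal η m)).card = cs.length (longest cs) ∧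
      ∀ s, (η (psiIndex cs s) - η s - m) % 2 = 0 := by
  have := hirr.nonempty
  obtain ⟨x, l, hxpos, hx⟩ := exists_pos_eigenvector
    (fun i j => if i = j then 0 else -(2 * coxForm M i j))
    (by
      intro i j
      by_cases h : i = j
      · simp [h]
      · rw [if_neg h, if_neg (Ne.symm h), coxForm_symm])
    (by
      intro i j
      by_cases h : i = j
      · simp [h]
      · have := coxForm_nonpos (M := M) h
        simp only [if_neg h]; linarith)
    (coxeterGraph cs) hirr
    (by
      intro i j h
      have := coxForm_le_neg_half cs h
      simp only [if_neg h.ne]; linarith)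
  have hP := colourFunctional_layerProd hη hx
  have hpos : ∀ {w : W} {s : B}, ¬ cs.IsRightDescent w s →
      0 < colourFunctional η x 1 1 (geomRep cs w (simpleRoot s)) := fun h =>
    colourFunctional_pos hxpos (geomRep_simpleRoot_nonneg cs _ _ h)
      (geomRep_simpleRoot_ne_zero cs _ _)
  have hneg : ∀ {w : W} {s : B}, cs.IsRightDescent w s →
      colourFunctional η x 1 1 (geomRep cs w (simpleRoot s)) < 0 := by
    intro w s h
    have := colourFunctional_pos (η := η) hxpos
      (geomRep_simpleRoot_nonneg cs _ _ ((cs.isRightDescent_iff_not_isRightDescent_mul).1 h))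
      (geomRep_simpleRoot_ne_zero cs _ _)
    rw [geomRep_mul_simple_self, map_neg] at this
    linarith
  -- as long as the coefficients are positive, the layers lengthen the product
  have hlen : ∀ t : ℕ, (∀ j ≤ t, 0 < layerCoeff l 1 1 (j + 1)) → ∀ j ≤ t + 1,
      cs.length (layerProd cs η j) =
        (interval (timeIdeal η 0) (timeIdeal η j)).card := by
    intro t ht j
    induction j with
    | zero =>
      intro _
      rw [layerProd_zero, cs.length_one]
      refine (Finset.card_eq_zero.2 ?_).symm
      ext ⟨k, s⟩
      rw [mem_interval]
      simp only [Nat.cast_zero, Finset.notMem_empty, iff_false]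
      omega
    | succ j ih =>
      intro hj
      rw [layerProd_succ hη, length_mul_wordProd_of_pairwise_commute cs (pairwise_layer hη _),
        ih (by omega), card_interval_succ]
      intro s hs hd
      have h1 := hneg hd
      rw [hP, if_pos (mem_layer.1 hs)] at h1
      exact absurd h1 (not_lt.2 (mul_pos (hxpos s) (ht j (by omega))).le)
  have hgrow : ∀ t : ℕ, t ≤ (interval (timeIdeal η 0) (timeIdeal η t)).card := by
    intro t
    induction t with
    | zero => exact Nat.zero_le _
    | succ t ih =>
      rw [card_interval_succ]
      obtain ⟨s, hs⟩ := exists_parity hirr hη t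
      have : 0 < (layer η t).length := List.length_pos_of_mem (mem_layer.2 hs)
      omega
  -- Otherwise the layers would lengthen the product forever.
  have hex : ∃ t, layerCoeff l 1 1 (t + 1) ≤ 0 := by
    by_contra hno
    push Not at hno
    have h1 := hlen (cs.length (longest cs)) (fun j _ => hno j) _ le_rfl
    have h2 := hgrow (cs.length (longest cs) + 1)
    have h3 := length_le_length_longest cs (layerProd cs η (cs.length (longest cs) + 1))
    omega
  classical
  -- Before index `m` every letter of the next layer lengthens the product. At `m` one colour
  -- consists of descents because the new coefficient is not positive, the other because the
  -- previous one was positive.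
  obtain ⟨m, hm0, hmin⟩ : ∃ m, layerCoeff l 1 1 (m + 1) ≤ 0 ∧
      ∀ j < m, 0 < layerCoeff l 1 1 (j + 1) :=
    ⟨Nat.find hex, Nat.find_spec hex, fun j hj => not_le.1 (Nat.find_min hex hj)⟩
  have hm1 : 1 ≤ m := by
    by_contra h
    obtain rfl : m = 0 := by omega
    norm_num [layerCoeff] at hm0
  obtain ⟨n, rfl⟩ : ∃ n, m = n + 1 := ⟨m - 1, by omega⟩
  have hdesc : ∀ s, cs.IsRightDescent (layerProd cs η (n + 1)) s := by
    intro s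
    by_contra h
    have h1 := hpos h
    rw [hP] at h1
    split_ifs at h1 with hs
    · exact absurd h1 (not_lt.2 (mul_nonpos_of_nonneg_of_nonpos (hxpos s).le hm0))
    · have := mul_pos (hxpos s) (hmin n (by omega))
      linarith
  have hlong := eq_longest_of_forall_descent cs hdesc
  have hparity : ∀ s, η s % 2 = ((n + 1 : ℕ) : ℤ) % 2 → η (psiIndex cs s) % 2 = 0 := by
    intro s hs
    by_contra hodd
    set z := geomRep cs (longest cs) (simpleRoot s) with hz
    have hz1 : geomRep cs (cs.simple (psiIndex cs s)) z = -z := by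
      rw [hz, ← geomRep_mul_apply]
      have : cs.simple (psiIndex cs s) * longest cs = longest cs * cs.simple s := by
        have h := longest_mul_simple cs (psiIndex cs s)
        rw [psiIndex_psiIndex] at h
        exact h.symm
      rw [this, geomRep_mul_simple_self]
    rw [geomRep_simple_apply] at hz1
    -- The longest element sends `α_s` to a vector negated by the reflection of `ψ(s)`, hence to a
    -- multiple of that simple root.
    have hz2 : z = (simpleCoroot M (psiIndex cs s) z / 2) • simpleRoot (psiIndex cs s) := by
      have : (2 : ℝ) • z = simpleCoroot M (psiIndex cs s) z • simpleRoot (psiIndex cs s) := by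
        have h2 : z + z = simpleCoroot M (psiIndex cs s) z • simpleRoot (psiIndex cs s) := by
          have := eq_add_of_sub_eq hz1
          nth_rewrite 1 [this]
          module
        rw [two_smul]; exact h2
      rw [div_eq_inv_mul, mul_smul, ← this, smul_smul]
      norm_num
    set c := simpleCoroot M (psiIndex cs s) z / 2 with hc
    have hc0 : c < 0 := by
      have h1 := hneg (isRightDescent_longest cs s)
      rw [← hz, hz2, map_smul, colourFunctional_simpleRoot, ite_self, one_mul, smul_eq_mul] at h1
      exact neg_of_mul_neg_left h1 (hxpos _).le
    -- If `ψ(s)` were odd, the functional supported on odd generators would be negative on `z`. By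
    -- the shift its value is a multiple of a coefficient that the even functional takes on a
    -- positive root, hence nonnegative.
    have h1 := hP 0 1 (n + 1) s
    rw [hlong, ← hz, hz2, map_smul, colourFunctional_simpleRoot, if_neg hodd, if_pos hs,
      layerCoeff_shift, one_mul, smul_eq_mul] at h1
    obtain ⟨r, hr⟩ := exists_parity hirr hη n
    have h2 := hP 1 0 n r
    rw [if_pos hr] at h2
    have h3 : ¬ cs.IsRightDescent (layerProd cs η n) r := by
      intro hd
      have h3 := hneg hd
      rw [hP, if_pos hr] at h3
      exact absurd h3 (not_lt.2 (mul_pos (hxpos r) (hmin n (by omega))).le)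
    have h4 := colourFunctional_nonneg (η := η) hxpos zero_le_one le_rfl
      (geomRep_simpleRoot_nonneg cs _ _ h3)
    rw [h2] at h4
    have h5 : 0 ≤ layerCoeff l 1 0 (n + 1) := nonneg_of_mul_nonneg_right h4 (hxpos r)
    have h6 := mul_nonneg (hxpos s).le h5
    have h7 := mul_neg_of_neg_of_pos hc0 (hxpos (psiIndex cs s))
    linarith
  refine ⟨n + 1, by omega, hlong, ?_, ?_⟩
  · rw [← hlong, hlen n (fun j hj => hmin j (by omega)) (n + 1) le_rfl]
  · intro s
    by_cases hs : η s % 2 = ((n + 1 : ℕ) : ℤ) % 2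
    · have := hparity s hs
      omega
    · obtain ⟨r, hr⟩ := exists_adj hirr s
      have h1 := hη s r hr
      have h2 := hη _ _ ((coxeterGraph_adj_psiIndex cs).2 hr)
      have h3 := hparity r (by omega)
      omega

end Bipartite

end CutPaths

namespace CutPaths

/-! ### Moving an ideal one letter at a time -/

section Flips

variable {B W : Type*} [Fintype B] [DecidableEq B] [Group W] {M : CoxeterMatrix B}
  {cs : CoxeterSystem M W} {η : B → ℤ}

variable (cs η) in
/-- The first letter with generator `s` outside of the ideal `a` is minimal. -/
def IsLocalMin (a : B → ℤ) (s : B) : Prop :=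
  ∀ t, (coxeterGraph cs).Adj s t → η t + 2 * a t = η s + 2 * a s + 1

/-- The ideal `a`, enlarged by its next letter with generator `s`. -/
def bump (a : B → ℤ) (s : B) : B → ℤ :=
  Function.update a s (a s + 1)

theorem bump_self (a : B → ℤ) (s : B) : bump a s s = a s + 1 :=
  Function.update_self _ _ _

theorem bump_of_ne (a : B → ℤ) {s t : B} (h : t ≠ s) : bump a s t = a t :=
  Function.update_of_ne h _ _

theorem le_bump (a : B → ℤ) (s t : B) : a t ≤ bump a s t := by
  by_cases h : t = s
  · subst h; rw [bump_self]; omega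
  · rw [bump_of_ne a h]

theorem bump_le (a : B → ℤ) (s t : B) : bump a s t ≤ a t + 1 := by
  by_cases h : t = s
  · subst h; rw [bump_self]
  · rw [bump_of_ne a h]; omega

theorem IsIdeal.bump {a : B → ℤ} {s : B} (ha : IsIdeal cs η a) (hs : IsLocalMin cs η a s) :
    IsIdeal cs η (bump a s) := by
  intro r t h
  have h1 := ha r t h
  dsimp only at h1 ⊢
  by_cases hr : r = s
  · subst hr
    rw [bump_self, bump_of_ne a h.ne']
    have := hs t h
    omega
  · by_cases ht : t = s
    · subst ht
      rw [bump_self, bump_of_ne a hr]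
      have := hs r h.symm
      omega
    · rw [bump_of_ne a hr, bump_of_ne a ht]; exact h1

theorem interval_bump (a : B → ℤ) (s : B) : interval a (bump a s) = {(a s, s)} := by
  ext ⟨k, t⟩
  rw [mem_interval, Finset.mem_singleton, Prod.mk.injEq]
  by_cases h : t = s
  · subst h; rw [bump_self]; simp only [and_true]; omega
  · rw [bump_of_ne a h]; simp only [h, and_false, iff_false]; omega

theorem heapProd_interval_bump_left (hη : IsHeight cs η) {a b : B → ℤ} {s : B}
    (ha : IsIdeal cs η a) (hs : IsLocalMin cs η a s) (hab : ∀ t, a t ≤ b t) (h : a s < b s) :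
    heapProd cs η (interval a b) = cs.simple s * heapProd cs η (interval (bump a s) b) ∧
      (interval a b).card = (interval (bump a s) b).card + 1 := by
  have h' : ∀ t, bump a s t ≤ b t := by
    intro t
    by_cases ht : t = s
    · subst ht; rw [bump_self]; omega
    · rw [bump_of_ne a ht]; exact hab t
  rw [heapProd_interval_mul hη (ha.bump hs) (le_bump a s) h', interval_bump, heapProd_singleton,
    card_interval_add (le_bump a s) h', interval_bump, Finset.card_singleton]
  exact ⟨rfl, add_comm _ _⟩

theorem heapProd_interval_bump_right (hη : IsHeight cs η) {a b : B → ℤ} {s : B}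
    (hb : IsIdeal cs η b) (hab : ∀ t, a t ≤ b t) :
    heapProd cs η (interval a (bump b s)) = heapProd cs η (interval a b) * cs.simple s ∧
      (interval a (bump b s)).card = (interval a b).card + 1 := by
  rw [heapProd_interval_mul hη hb hab (le_bump b s), interval_bump, heapProd_singleton,
    card_interval_add hab (le_bump b s), interval_bump, Finset.card_singleton]
  exact ⟨rfl, rfl⟩

/-- Any two ideals are connected by a sequence of additions and removals of letters. -/
theorem ideal_induction {P : (B → ℤ) → Prop} (h0 : P (timeIdeal η 0))
    (hP : ∀ a s, IsIdeal cs η a → IsLocalMin cs η a s → (P a ↔ P (bump a s)))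
    {a : B → ℤ} (ha : IsIdeal cs η a) : P a := by
  induction hn : ∑ s, (a s - timeIdeal η 0 s).natAbs using Nat.strong_induction_on
    generalizing a with
  | _ n ih =>
  -- The function `timeIdeal η 0` is the one with all `η s + 2 * a s` in `{0, 1}`. A largest value
  -- at least `2` can be lowered and a smallest negative value raised, each time approaching it.
  by_cases h1 : ∃ s, 2 ≤ η s + 2 * a s
  · obtain ⟨s0, hs0⟩ := h1
    obtain ⟨s, -, hs⟩ := Finset.exists_max_image Finset.univ (fun s => η s + 2 * a s)
      ⟨s0, Finset.mem_univ _⟩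
    have hs2 : 2 ≤ η s + 2 * a s := hs0.trans (hs s0 (Finset.mem_univ _))
    let b : B → ℤ := Function.update a s (a s - 1)
    have hbs : b s = a s - 1 := Function.update_self _ _ _
    have hbt : ∀ t, t ≠ s → b t = a t := fun t ht => Function.update_of_ne ht _ _
    have hba : bump b s = a := by
      funext t
      by_cases ht : t = s
      · subst ht; rw [bump_self, hbs]; omega
      · rw [bump_of_ne b ht, hbt t ht]
    have hbmin : IsLocalMin cs η b s := by
      intro t ht
      have h2 := ha s t ht
      have h3 := hs t (Finset.mem_univ _)
      dsimp only at h2 h3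
      rw [hbs, hbt t ht.ne']
      omega
    have hb : IsIdeal cs η b := by
      intro r t h
      have h2 := ha r t h
      dsimp only at h2 ⊢
      by_cases hr : r = s
      · subst hr
        have := hbmin t h
        omega
      · by_cases ht : t = s
        · subst ht
          have := hbmin r h.symm
          omega
        · rw [hbt r hr, hbt t ht]; exact h2
    rw [← hba, ← hP b s hb hbmin]
    refine ih _ ?_ hb rfl
    rw [← hn]
    refine Finset.sum_lt_sum (fun t _ => ?_) ⟨s, Finset.mem_univ _, ?_⟩
    · by_cases ht : t = s
      · subst ht; rw [hbs]
        simp only [timeIdeal]; omega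
      · rw [hbt t ht]
    · rw [hbs]
      simp only [timeIdeal]; omega
  · push Not at h1
    by_cases h2 : ∃ s, η s + 2 * a s < 0
    · obtain ⟨s0, hs0⟩ := h2
      obtain ⟨s, -, hs⟩ := Finset.exists_min_image Finset.univ (fun s => η s + 2 * a s)
        ⟨s0, Finset.mem_univ _⟩
      have hs2 : η s + 2 * a s < 0 := (hs s0 (Finset.mem_univ _)).trans_lt hs0
      have hmin : IsLocalMin cs η a s := by
        intro t ht
        have h2 := ha s t ht
        have h3 := hs t (Finset.mem_univ _)
        dsimp only at h2 h3
        omega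
      rw [hP a s ha hmin]
      refine ih _ ?_ (ha.bump hmin) rfl
      rw [← hn]
      refine Finset.sum_lt_sum (fun t _ => ?_) ⟨s, Finset.mem_univ _, ?_⟩
      · by_cases ht : t = s
        · subst ht; rw [bump_self]
          simp only [timeIdeal]; omega
        · rw [bump_of_ne a ht]
      · rw [bump_self]
        simp only [timeIdeal]; omega
    · push Not at h2
      have : a = timeIdeal η 0 := by
        funext s
        have := h1 s
        have := h2 s
        simp only [timeIdeal]; omega
      rw [this]; exact h0

end Flips

/-! ### The Nakayama translate and the Coxeter number -/

section Nakayama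

variable {B W : Type*} [Fintype B] [DecidableEq B] [Group W] {M : CoxeterMatrix B}
  {cs : CoxeterSystem M W} [Finite W] {η : B → ℤ} {m : ℕ}

variable (cs η m) in
/-- The image of the ideal `a` under the shift of the time by `m` and the permutation of the
generators that is induced by the longest element. -/
noncomputable def nakayama (a : B → ℤ) (s : B) : ℤ :=
  a (psiIndex cs s) + (η (psiIndex cs s) + m - η s) / 2

/-- The parity hypothesis makes the halving in `nakayama` exact. -/
theorem time_nakayama (hm : ∀ s, (η (psiIndex cs s) - η s - m) % 2 = 0) (a : B → ℤ) (s : B) :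
    η s + 2 * nakayama cs η m a s = η (psiIndex cs s) + 2 * a (psiIndex cs s) + m := by
  have := hm s
  rw [nakayama]
  omega

theorem IsIdeal.nakayama (hm : ∀ s, (η (psiIndex cs s) - η s - m) % 2 = 0) {a : B → ℤ}
    (ha : IsIdeal cs η a) : IsIdeal cs η (nakayama cs η m a) := by
  intro s t h
  have h1 := ha _ _ ((coxeterGraph_adj_psiIndex cs).2 h)
  dsimp only at h1 ⊢
  rw [time_nakayama hm, time_nakayama hm]
  omega

theorem nakayama_nakayama (hm : ∀ s, (η (psiIndex cs s) - η s - m) % 2 = 0) (a : B → ℤ) (s : B) :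
    nakayama cs η m (nakayama cs η m a) s = a s + m := by
  have h1 := time_nakayama hm (nakayama cs η m a) s
  have h2 := time_nakayama hm a (psiIndex cs s)
  rw [psiIndex_psiIndex] at h2
  omega

theorem nakayama_bump (a : B → ℤ) (s : B) :
    nakayama cs η m (bump a s) = bump (nakayama cs η m a) (psiIndex cs s) := by
  funext t
  by_cases h : t = psiIndex cs s
  · subst h
    rw [bump_self, nakayama, nakayama, psiIndex_psiIndex, bump_self]
    ring
  · rw [bump_of_ne _ h, nakayama, nakayama, bump_of_ne]
    rintro rfl
    exact h (psiIndex_psiIndex cs t).symm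

theorem nakayama_timeIdeal (hm : ∀ s, (η (psiIndex cs s) - η s - m) % 2 = 0) :
    nakayama cs η m (timeIdeal η 0) = timeIdeal η m := by
  funext s
  have h1 := time_nakayama hm (timeIdeal η 0) s
  have := hm s
  simp only [timeIdeal] at h1 ⊢
  omega

/-- For each ideal `a`, the letters of `nakayama a` that do not belong to `a` form a reduced
expression of the longest element. -/
theorem heapProd_nakayama (hη : IsHeight cs η)
    (hm : ∀ s, (η (psiIndex cs s) - η s - m) % 2 = 0)
    (h0 : layerProd cs η m = longest cs)
    (hcard : (interval (timeIdeal η 0) (timeIdeal η m)).card = cs.length (longest cs))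
    {a : B → ℤ} (ha : IsIdeal cs η a) :
    heapProd cs η (interval a (nakayama cs η m a)) = longest cs ∧
      (interval a (nakayama cs η m a)).card = cs.length (longest cs) := by
  refine ideal_induction (cs := cs) (P := fun a =>
    heapProd cs η (interval a (nakayama cs η m a)) = longest cs ∧
      (interval a (nakayama cs η m a)).card = cs.length (longest cs)) ?_ ?_ ha
  · rw [nakayama_timeIdeal hm]
    exact ⟨h0, hcard⟩
  · intro a s ha hs
    -- The flip removes `s` from the left end of the word and adds `ψ(s)` at the right end; the
    -- product stays the longest element because `s w₀ = w₀ ψ(s)`.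
    have key (hab : ∀ t, a t ≤ nakayama cs η m a t) (h : a s < nakayama cs η m a s) :
        (heapProd cs η (interval a (nakayama cs η m a)) = longest cs ∧
          (interval a (nakayama cs η m a)).card = cs.length (longest cs)) ↔
        (heapProd cs η (interval (bump a s) (nakayama cs η m (bump a s))) = longest cs ∧
          (interval (bump a s) (nakayama cs η m (bump a s))).card = cs.length (longest cs)) := by
      have h' : ∀ t, bump a s t ≤ nakayama cs η m a t := by
        intro t
        by_cases ht : t = s
        · subst ht; rw [bump_self]; omega
        · rw [bump_of_ne a ht]; exact hab t
      obtain ⟨h1, h2⟩ := heapProd_interval_bump_left hη ha hs hab h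
      obtain ⟨h3, h4⟩ := heapProd_interval_bump_right (s := psiIndex cs s) hη
        (ha.nakayama hm) h'
      rw [nakayama_bump, h1, h2, h3, h4]
      refine and_congr_left fun _ => ?_
      rw [← eq_inv_mul_iff_mul_eq, ← eq_mul_inv_iff_mul_eq, cs.inv_simple, cs.inv_simple,
        longest_mul_simple]
    constructor
    · intro h
      have hlt : ∀ t, a t < nakayama cs η m a t := by
        intro t
        obtain ⟨k, hk⟩ := exists_mem_of_heapProd_eq_longest cs h.1 t
        rw [mem_interval] at hk
        omega
      exact (key (fun t => (hlt t).le) (hlt s)).1 h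
    · intro h
      have hlt : ∀ t, bump a s t < nakayama cs η m a t + 1 := by
        intro t
        obtain ⟨k, hk⟩ := exists_mem_of_heapProd_eq_longest cs h.1 t
        rw [mem_interval, nakayama_bump] at hk
        have := bump_le (nakayama cs η m a) (psiIndex cs s) t
        omega
      refine (key (fun t => ?_) ?_).2 h
      · have := hlt t
        have := le_bump a s t
        omega
      · have := hlt s
        rw [bump_self] at this
        omega

theorem lt_nakayama (hη : IsHeight cs η)
    (hm : ∀ s, (η (psiIndex cs s) - η s - m) % 2 = 0)
    (h0 : layerProd cs η m = longest cs)
    (hcard : (interval (timeIdeal η 0) (timeIdeal η m)).card = cs.length (longest cs))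
    {a : B → ℤ} (ha : IsIdeal cs η a) (s : B) : a s < nakayama cs η m a s := by
  obtain ⟨k, hk⟩ := exists_mem_of_heapProd_eq_longest cs
    (heapProd_nakayama hη hm h0 hcard ha).1 s
  rw [mem_interval] at hk
  omega

theorem IsIdeal.add_const {a : B → ℤ} (ha : IsIdeal cs η a) (k : ℤ) :
    IsIdeal cs η fun s => a s + k := by
  intro s t h
  have := ha s t h
  dsimp only at this ⊢
  omega

/-- Whether `k` successive copies of a Coxeter word multiply to the identity does not depend on
the Coxeter word. -/
theorem heapProd_period_iff (hη : IsHeight cs η) {k : ℤ} (hk : 1 ≤ k) {a : B → ℤ}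
    (ha : IsIdeal cs η a) :
    heapProd cs η (interval a fun s => a s + k) = 1 ↔
      heapProd cs η (interval (timeIdeal η 0) fun s => timeIdeal η 0 s + k) = 1 := by
  refine ideal_induction (cs := cs) (P := fun a => heapProd cs η (interval a fun s => a s + k) = 1 ↔
      heapProd cs η (interval (timeIdeal η 0) fun s => timeIdeal η 0 s + k) = 1) Iff.rfl ?_ ha
  intro a s ha hs
  have h1 := (heapProd_interval_bump_left (b := fun s => a s + k) hη ha hs
    (fun t => by omega) (by omega)).1
  have h2 := (heapProd_interval_bump_right (s := s) (a := bump a s) hη (ha.add_const k)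
    (fun t => by have := bump_le a s t; omega)).1
  have h3 : bump (fun s => a s + k) s = fun t => bump a s t + k := by
    funext t
    by_cases ht : t = s
    · subst ht; rw [bump_self, bump_self]; ring
    · rw [bump_of_ne _ ht, bump_of_ne _ ht]
  rw [h3] at h2
  -- Before and after the flip the products are conjugate by `s`.
  rw [h1, h2, mul_eq_one_iff_eq_inv', mul_eq_one_iff_eq_inv]

/-- The order of a Coxeter element is the number `m` of layers of the longest element. -/
theorem heapProd_period [Nontrivial B] (hη : IsHeight cs η) (hirr : (coxeterGraph cs).Connected)
    (hm : ∀ s, (η (psiIndex cs s) - η s - m) % 2 = 0)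
    (h0 : layerProd cs η m = longest cs)
    (hcard : (interval (timeIdeal η 0) (timeIdeal η m)).card = cs.length (longest cs))
    {a : B → ℤ} (ha : IsIdeal cs η a) :
    heapProd cs η (interval a fun s => a s + m) = 1 ∧
      ∀ k : ℤ, 1 ≤ k → k < m → heapProd cs η (interval a fun s => a s + k) ≠ 1 := by
  have hN := fun {a : B → ℤ} (ha : IsIdeal cs η a) => heapProd_nakayama hη hm h0 hcard ha
  have hlt := fun {a : B → ℤ} (ha : IsIdeal cs η a) => lt_nakayama hη hm h0 hcard ha
  constructor
  · have e : (fun s => a s + (m : ℤ)) = nakayama cs η m (nakayama cs η m a) := by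
      funext s; rw [nakayama_nakayama hm]
    rw [e, heapProd_interval_mul hη (ha.nakayama hm) (fun s => (hlt ha s).le)
      (fun s => (hlt (ha.nakayama hm) s).le), (hN ha).1, (hN (ha.nakayama hm)).1,
      longest_mul_self]
  · intro k hk1 hkm h
    -- For the slice at time zero, `k` periods are `2 * k` layers. If their product were trivial,
    -- removing them from the layers up to `m`, or removing the layers up to `m` from them, would
    -- leave a word for the longest element with too few letters.
    rw [heapProd_period_iff hη hk1 ha] at h
    have e : (fun s => timeIdeal η 0 s + k) = timeIdeal η (2 * k) := by
      funext s; simp only [timeIdeal]; omega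
    rw [e] at h
    obtain ⟨s⟩ := hirr.nonempty
    by_cases hkm2 : 2 * k ≤ m
    · have h1 := heapProd_interval_mul hη (isIdeal_timeIdeal hη (2 * k))
        (timeIdeal_mono (by omega : (0 : ℤ) ≤ 2 * k)) (timeIdeal_mono hkm2)
      have h2 := card_interval_add (timeIdeal_mono (η := η) (by omega : (0 : ℤ) ≤ 2 * k))
        (timeIdeal_mono hkm2)
      rw [h, one_mul] at h1
      have h3 := length_heapProd_le (cs := cs) (η := η)
        (interval (timeIdeal η (2 * k)) (timeIdeal η m))
      rw [← h1, ← layerProd, h0] at h3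
      have h4 : 0 < (interval (timeIdeal η 0) (timeIdeal η (2 * k))).card := by
        refine Finset.card_pos.2 ⟨(timeIdeal η 0 s, s), ?_⟩
        rw [mem_interval]
        simp only [timeIdeal]; omega
      omega
    · push Not at hkm2
      have h1 := heapProd_interval_mul hη (isIdeal_timeIdeal hη m)
        (timeIdeal_mono (by omega : (0 : ℤ) ≤ m)) (timeIdeal_mono hkm2.le)
      rw [h, ← layerProd, h0] at h1
      have h2 : heapProd cs η (interval (timeIdeal η m) (timeIdeal η (2 * k))) = longest cs := by
        rw [← longest_inv]
        exact eq_inv_of_mul_eq_one_right h1.symm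
      have h3 := length_heapProd_le (cs := cs) (η := η)
        (interval (timeIdeal η m) (timeIdeal η (2 * k)))
      rw [h2] at h3
      have h5 := (hN (isIdeal_timeIdeal hη m)).2
      have h6 : nakayama cs η m (timeIdeal η m) = timeIdeal η (2 * m) := by
        rw [← nakayama_timeIdeal hm]
        funext s
        rw [nakayama_nakayama hm]
        simp only [timeIdeal]; omega
      rw [h6, card_interval_add (timeIdeal_mono hkm2.le)
        (timeIdeal_mono (by omega : 2 * k ≤ 2 * (m : ℤ)))] at h5
      have h4 : 0 < (interval (timeIdeal η (2 * k)) (timeIdeal η (2 * m))).card := by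
        refine Finset.card_pos.2 ⟨(timeIdeal η (2 * k) s, s), ?_⟩
        rw [mem_interval]
        simp only [timeIdeal]; omega
      omega

end Nakayama

end CutPaths

namespace CutPaths

/-! ### Potentials on strongly connected digraphs -/

section ClosedWalks

variable {V : Type*} {D : Digraph V} {ω : V → V → ℤ}

/-- If the weights of all directed cycles vanish, then the weights of all closed walks do. -/
theorem closed_walk_sum_eq_zero
    (hω : ∀ (m : ℕ) (v : Fin (m + 1) → V), IsDirectedCycle D v → ∑ i, ω (v i) (v (i + 1)) = 0)
    (L : ℕ) (f : ℕ → V) (hf : ∀ i < L, D.Adj (f i) (f (i + 1))) (hclosed : f L = f 0) :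
    ∑ i ∈ Finset.range L, ω (f i) (f (i + 1)) = 0 := by
  induction L using Nat.strong_induction_on generalizing f with
  | _ L ih =>
  -- A repeated vertex splits the closed walk into two shorter ones; without a repetition it is a
  -- directed cycle.
  by_cases hinj : ∃ i j, i < j ∧ j < L ∧ f i = f j
  · obtain ⟨i, j, hij, hjL, hfij⟩ := hinj
    obtain ⟨d, rfl⟩ : ∃ d, j = i + d := ⟨j - i, by omega⟩
    obtain ⟨r, rfl⟩ : ∃ r, L = i + d + r := ⟨L - (i + d), by omega⟩
    have h1 := ih d (by omega) (fun k => f (i + k)) (fun k hk => hf (i + k) (by omega)) (by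
      simpa using hfij.symm)
    have h2 := ih (i + r) (by omega) (fun k => if k ≤ i then f k else f (k + d)) (by
      intro k hk
      by_cases h : k + 1 ≤ i
      · rw [if_pos (by omega), if_pos h]; exact hf k (by omega)
      · by_cases h' : k ≤ i
        · obtain rfl : k = i := by omega
          rw [if_pos le_rfl, if_neg h, hfij, show k + 1 + d = k + d + 1 by ring]
          exact hf _ (by omega)
        · rw [if_neg h', if_neg h, show k + 1 + d = k + d + 1 by ring]
          exact hf _ (by omega)) (by
      rw [if_neg (by omega), if_pos (Nat.zero_le _), ← hclosed]
      congr 1; ring)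
    rw [Finset.sum_range_add] at h2
    rw [Finset.sum_range_add, Finset.sum_range_add]
    have e1 : ∑ k ∈ Finset.range i, ω (if k ≤ i then f k else f (k + d))
        (if k + 1 ≤ i then f (k + 1) else f (k + 1 + d)) =
        ∑ k ∈ Finset.range i, ω (f k) (f (k + 1)) := by
      refine Finset.sum_congr rfl fun k hk => ?_
      have := Finset.mem_range.1 hk
      rw [if_pos (by omega), if_pos (by omega)]
    have e2 : ∑ k ∈ Finset.range r, ω (if i + k ≤ i then f (i + k) else f (i + k + d))
        (if i + k + 1 ≤ i then f (i + k + 1) else f (i + k + 1 + d)) =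
        ∑ k ∈ Finset.range r, ω (f (i + d + k)) (f (i + d + k + 1)) := by
      refine Finset.sum_congr rfl fun k hk => ?_
      rw [if_neg (by omega : ¬ i + k + 1 ≤ i)]
      by_cases h : i + k ≤ i
      · obtain rfl : k = 0 := by omega
        rw [if_pos h, Nat.add_zero, Nat.add_zero, Nat.add_zero, hfij,
          show i + 1 + d = i + d + 1 by ring]
        rfl
      · rw [if_neg h, show i + k + d = i + d + k by ring,
          show i + k + 1 + d = i + d + k + 1 by ring]
    rw [e1, e2] at h2
    have h1' : ∑ k ∈ Finset.range d, ω (f (i + k)) (f (i + k + 1)) = 0 := h1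
    omega
  · rcases Nat.eq_zero_or_pos L with rfl | hL
    · simp
    push Not at hinj
    obtain ⟨m, rfl⟩ : ∃ m, L = m + 1 := ⟨L - 1, by omega⟩
    have hnext : ∀ i : Fin (m + 1), f ((i + 1 : Fin (m + 1)) : ℕ) = f ((i : ℕ) + 1) := by
      intro i
      rw [Fin.val_add_one]
      split_ifs with h
      · rw [h, Fin.val_last, hclosed]
      · rfl
    have hcyc : IsDirectedCycle D (fun i : Fin (m + 1) => f i) := by
      refine ⟨fun i j h => ?_, fun i => ?_⟩
      · dsimp only at h
        rcases lt_trichotomy (i : ℕ) j with hij | hij | hij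
        · exact absurd h (hinj _ _ hij j.2)
        · exact Fin.ext hij
        · exact absurd h.symm (hinj _ _ hij i.2)
      · dsimp only
        rw [hnext]
        exact hf i i.2
    have := hω m _ hcyc
    rw [Finset.sum_range (fun i => ω (f i) (f (i + 1)))]
    simpa only [hnext] using this

variable (D ω) in
/-- There is a walk from `i` to `j` with total weight `z`. -/
def HasWalk (i j : V) (z : ℤ) : Prop :=
  ∃ (L : ℕ) (f : ℕ → V), f 0 = i ∧ f L = j ∧ (∀ k < L, D.Adj (f k) (f (k + 1))) ∧
    ∑ k ∈ Finset.range L, ω (f k) (f (k + 1)) = z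

theorem HasWalk.snoc {i j k : V} {z : ℤ} (h : HasWalk D ω i j z) (hjk : D.Adj j k) :
    HasWalk D ω i k (z + ω j k) := by
  obtain ⟨L, f, h0, hL, hf, hz⟩ := h
  refine ⟨L + 1, fun n => if n ≤ L then f n else k, ?_, ?_, ?_, ?_⟩
  · simp [h0]
  · simp
  · intro n hn
    dsimp only
    by_cases h : n + 1 ≤ L
    · rw [if_pos (by omega), if_pos h]; exact hf n (by omega)
    · obtain rfl : n = L := by omega
      rw [if_pos le_rfl, if_neg h, hL]; exact hjk
  · rw [Finset.sum_range_succ]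
    dsimp only
    rw [if_pos le_rfl, if_neg (by omega), hL, ← hz]
    congr 1
    refine Finset.sum_congr rfl fun n hn => ?_
    have := Finset.mem_range.1 hn
    rw [if_pos (by omega), if_pos (by omega)]

theorem HasWalk.nil (i : V) : HasWalk D ω i i 0 :=
  ⟨0, fun _ => i, rfl, rfl, by simp, by simp⟩

theorem HasWalk.trans {i j k : V} {z z' : ℤ} (h : HasWalk D ω i j z) (h' : HasWalk D ω j k z') :
    HasWalk D ω i k (z + z') := by
  obtain ⟨L, f, h0, hL, hf, rfl⟩ := h'
  induction L generalizing k with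
  | zero =>
    rw [← hL, h0]
    simpa using h
  | succ L ih =>
    have h1 := ih rfl (fun n hn => hf n (by omega))
    have h2 := h1.snoc (hf L (by omega))
    rw [Finset.sum_range_succ, ← add_assoc, ← hL]
    exact h2

theorem exists_hasWalk {i j : V} (h : Relation.ReflTransGen D.Adj i j) :
    ∃ z, HasWalk D ω i j z := by
  induction h with
  | refl => exact ⟨0, HasWalk.nil i⟩
  | tail _ hbc ih =>
    obtain ⟨z, hz⟩ := ih
    exact ⟨_, hz.snoc hbc⟩

/-- If the weights of all directed cycles of a strongly connected graph vanish, then the weight is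
a gradient. -/
theorem exists_digraph_potential [Nonempty V]
    (hω : ∀ (m : ℕ) (v : Fin (m + 1) → V), IsDirectedCycle D v → ∑ i, ω (v i) (v (i + 1)) = 0)
    (hconn : ∀ i j, Relation.ReflTransGen D.Adj i j) :
    ∃ g : V → ℤ, ∀ i j, D.Adj i j → g j = g i + ω i j := by
  obtain ⟨v0⟩ := ‹Nonempty V›
  have hclosed : ∀ i z, HasWalk D ω i i z → z = 0 := by
    rintro i z ⟨L, f, h0, hL, hf, rfl⟩
    exact closed_walk_sum_eq_zero hω L f hf (hL.trans h0.symm)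
  -- The potential is the weight of an arbitrary walk from `v0`; closing two such walks by the same
  -- walk back shows that the choice is irrelevant.
  choose g hg using fun i => exists_hasWalk (ω := ω) (hconn v0 i)
  refine ⟨g, fun i j hij => ?_⟩
  obtain ⟨z, hz⟩ := exists_hasWalk (ω := ω) (hconn j v0)
  have h1 := hclosed _ _ (((hg i).snoc hij).trans hz)
  have h2 := hclosed _ _ ((hg j).trans hz)
  omega

end ClosedWalks

/-! ### Cycles and level functions on the cylinder -/

section Cylinder

variable {B V : Type*}

/-- The edges of the Hasse diagram of the letters `(k, s)`. -/
def HasseEdge (T : SimpleGraph B) (η : B → ℤ) (x y : ℤ × B) : Prop :=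
  T.Adj x.2 y.2 ∧ time η y = time η x + 1

/-- The graph `D` is the quotient of the Hasse diagram of the letters `(k, s)` by the translation
of `k` by `h`, with the quotient map `π`. -/
structure IsCylinder (T : SimpleGraph B) (η : B → ℤ) (h : ℕ) (π : ℤ × B → V) (D : Digraph V) :
    Prop where
  height : ∀ s t, T.Adj s t → η t = η s + 1 ∨ η s = η t + 1
  pos : 0 < h
  proj_eq : ∀ x y, π x = π y ↔ x.2 = y.2 ∧ x.1 % h = y.1 % h
  surj : Function.Surjective π
  adj : ∀ i j, D.Adj i j ↔ ∃ x y, HasseEdge T η x y ∧ π x = i ∧ π y = j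

/-- A level function increases by at most one along the edges, and it increases by one under
translation. -/
structure IsLevel (T : SimpleGraph B) (η : B → ℤ) (h : ℕ) (F : ℤ × B → ℤ) : Prop where
  step : ∀ x y, HasseEdge T η x y → F y = F x ∨ F y = F x + 1
  translate : ∀ k s, F (k + h, s) = F (k, s) + 1

/-- The edges along which a level function increases. -/
def cutOf (T : SimpleGraph B) (η : B → ℤ) (π : ℤ × B → V) (F : ℤ × B → ℤ) : Set (V × V) :=
  {e | ∃ x y, HasseEdge T η x y ∧ F y = F x + 1 ∧ e = (π x, π y)}

variable {T : SimpleGraph B} {η : B → ℤ} {h : ℕ} {π : ℤ × B → V} {D : Digraph V}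

theorem HasseEdge.translate {x y : ℤ × B} (hxy : HasseEdge T η x y) (n : ℤ) :
    HasseEdge T η (x.1 + n, x.2) (y.1 + n, y.2) := by
  refine ⟨hxy.1, ?_⟩
  have := hxy.2
  simp only [time] at this ⊢
  omega

theorem IsLevel.translate_mul {F : ℤ × B → ℤ} (hF : IsLevel T η h F) (n k : ℤ) (s : B) :
    F (k + n * h, s) = F (k, s) + n := by
  induction n using Int.induction_on with
  | zero => simp
  | succ i ih =>
    have := hF.translate (k + i * h) s
    rw [← add_assoc, ← ih, ← this]
    congr 2
    ring
  | pred i ih =>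
    have h1 := hF.translate (k + (-i - 1) * h) s
    have h2 : k + (-i - 1) * h + (h : ℤ) = k + -i * h := by ring
    rw [h2, ih] at h1
    omega

namespace IsCylinder

theorem proj_translate (hC : IsCylinder T η h π D) (x : ℤ × B) (n : ℤ) :
    π (x.1 + n * h, x.2) = π x := by
  rw [hC.proj_eq]
  exact ⟨rfl, by simp⟩

theorem exists_translate (hC : IsCylinder T η h π D) {x y : ℤ × B} (hxy : π x = π y) :
    ∃ n : ℤ, x = (y.1 + n * h, y.2) := by
  obtain ⟨h1, h2⟩ := (hC.proj_eq x y).1 hxy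
  obtain ⟨n, hn⟩ := Int.ModEq.dvd (n := (h : ℤ)) h2.symm
  refine ⟨n, Prod.ext ?_ h1⟩
  dsimp only
  linarith [mul_comm n (h : ℤ)]

theorem exists_lift (hC : IsCylinder T η h π D) {x : ℤ × B} {j : V} (hj : D.Adj (π x) j) :
    ∃ y, HasseEdge T η x y ∧ π y = j := by
  obtain ⟨x', y', he, hx, hy⟩ := (hC.adj _ _).1 hj
  obtain ⟨n, rfl⟩ := hC.exists_translate hx.symm
  exact ⟨_, he.translate (n * h), by rw [hC.proj_translate, hy]⟩

theorem exists_lift_seq (hC : IsCylinder T η h π D) {u : ℕ → V}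
    (hu : ∀ j, D.Adj (u j) (u (j + 1))) :
    ∃ X : ℕ → ℤ × B, (∀ j, π (X j) = u j) ∧ ∀ j, HasseEdge T η (X j) (X (j + 1)) := by
  obtain ⟨x0, hx0⟩ := hC.surj (u 0)
  have step : ∀ j (x : {x // π x = u j}), ∃ y : {y // π y = u (j + 1)},
      HasseEdge T η x.1 y.1 := by
    rintro j ⟨x, hx⟩
    obtain ⟨y, hy1, hy2⟩ := hC.exists_lift (hx ▸ hu j : D.Adj (π x) (u (j + 1)))
    exact ⟨⟨y, hy2⟩, hy1⟩
  choose next hnext using step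
  let X : ∀ j, {x // π x = u j} := fun j => Nat.rec ⟨x0, hx0⟩ (fun j x => next j x) j
  exact ⟨fun j => (X j).1, fun j => (X j).2, fun j => hnext j (X j)⟩

/-- A lift of a directed cycle to the letters `(k, s)`. -/
theorem exists_cycle_lift (hC : IsCylinder T η h π D) {m : ℕ} {v : Fin (m + 1) → V}
    (hv : IsDirectedCycle D v) :
    ∃ X : ℕ → ℤ × B, (∀ j : ℕ, π (X j) = v (Fin.ofNat (m + 1) j)) ∧
      (∀ j, HasseEdge T η (X j) (X (j + 1))) ∧ ∀ j : ℕ, time η (X j) = time η (X 0) + j := by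
  obtain ⟨X, h1, h2⟩ := hC.exists_lift_seq (u := fun j => v (Fin.ofNat (m + 1) j)) (by
    intro j
    have e : Fin.ofNat (m + 1) (j + 1) = Fin.ofNat (m + 1) j + 1 := by
      apply Fin.ext
      simp [Fin.val_add]
    rw [e]
    exact hv.2 _)
  refine ⟨X, h1, h2, fun j => ?_⟩
  induction j with
  | zero => simp
  | succ j ih =>
    have := (h2 j).2
    push_cast
    omega

theorem _root_.CutPaths.fst_eq_of_time_eq {x y : ℤ × B} (hxy : x.2 = y.2) {d : ℤ}
    (ht : time η y = time η x + 2 * d) : y.1 = x.1 + d := by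
  simp only [time, hxy] at ht
  omega

/-- All directed cycles wind around the cylinder once. -/
theorem cycle_length (hC : IsCylinder T η h π D) (ρ : B → ℕ ×ₗ ℕ) (hρ : Function.Injective ρ)
    (hcross : ∀ s s' t t', η s % 2 = η s' % 2 → ρ s < ρ s' → T.Adj s t → T.Adj s' t' →
      t = t' ∨ ρ t < ρ t')
    {m : ℕ} {v : Fin (m + 1) → V} (hv : IsDirectedCycle D v) : m + 1 = 2 * h := by
  obtain ⟨X, hX1, hX2, hX3⟩ := hC.exists_cycle_lift hv
  have hpos := hC.pos
  -- the length of the cycle is a multiple of `2 h`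
  obtain ⟨w, hw⟩ : ∃ w : ℕ, m + 1 = 2 * h * w := by
    have h1 : π (X (m + 1)) = π (X 0) := by
      rw [hX1, hX1]; congr 1; apply Fin.ext; simp
    obtain ⟨n, hn⟩ := hC.exists_translate h1
    have h2 := hX3 (m + 1)
    rw [hn] at h2
    simp only [time] at h2
    have h3 : ((m + 1 : ℕ) : ℤ) = ((2 * h : ℕ) : ℤ) * n := by push_cast at h2 ⊢; linarith
    obtain ⟨w, hw⟩ := Int.natCast_dvd_natCast.1 ⟨n, h3⟩
    exact ⟨w, hw⟩
  have hw1 : 1 ≤ w := by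
    rcases Nat.eq_zero_or_pos w with rfl | h
    · omega
    · exact h
  rcases hw1.eq_or_lt with rfl | hw2
  · omega
  exfalso
  have hlt : 2 * h < m + 1 := by
    rw [hw]; nlinarith
  -- After `2 * h` steps the same generator would mean the same vertex, closing the cycle too early.
  have hne : ∀ j, (X j).2 ≠ (X (j + 2 * h)).2 := by
    intro j hj
    have h1 : (X (j + 2 * h)).1 = (X j).1 + h := by
      apply fst_eq_of_time_eq hj
      rw [hX3 j, hX3 (j + 2 * h)]; push_cast; ring
    have h2 : π (X (j + 2 * h)) = π (X j) := by
      rw [hC.proj_eq]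
      exact ⟨hj.symm, by rw [h1]; simp⟩
    rw [hX1, hX1] at h2
    have h3 := hv.1 h2
    have h4 : j + 2 * h ≡ j [MOD m + 1] := by
      exact congrArg Fin.val h3
    have h5 : m + 1 ∣ 2 * h := by
      simpa using (Nat.modEq_iff_dvd' (Nat.le_add_right j (2 * h))).1 h4.symm
    have := Nat.le_of_dvd (by omega) h5
    omega
  have hpar : ∀ j, η (X j).2 % 2 = η (X (j + 2 * h)).2 % 2 := by
    intro j
    have h1 := hX3 j
    have h2 := hX3 (j + 2 * h)
    simp only [time] at h1 h2
    push_cast at h2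
    omega
  have hperiod : (X (2 * h * w)).2 = (X 0).2 := by
    have h1 : π (X (m + 1)) = π (X 0) := by
      rw [hX1, hX1]; congr 1; apply Fin.ext; simp
    rw [← hw]
    exact ((hC.proj_eq _ _).1 h1).1
  -- The lifted cycle and its shift by `2 * h` steps never meet, so by the noncrossing condition one
  -- stays strictly on one side of the other. Thus `ρ` is monotone from turn to turn, yet it returns
  -- to its start after `w` turns.
  rcases lt_or_gt_of_ne (fun e => hne 0 (hρ e)) with h0 | h0
  · have hall : ∀ j, ρ (X j).2 < ρ (X (j + 2 * h)).2 := by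
      intro j
      induction j with
      | zero => exact h0
      | succ j ih =>
        have h1 := hX2 (j + 2 * h)
        rw [show j + 2 * h + 1 = j + 1 + 2 * h by ring] at h1
        exact (hcross _ _ _ _ (hpar j) ih (hX2 j).1 h1.1).resolve_left (hne (j + 1))
    have hmono : ∀ n, 1 ≤ n → ρ (X 0).2 < ρ (X (2 * h * n)).2 := by
      intro n hn
      induction n, hn using Nat.le_induction with
      | base => simpa using h0
      | succ n hn ih =>
        have := hall (2 * h * n)
        rw [show 2 * h * n + 2 * h = 2 * h * (n + 1) by ring] at this
        exact ih.trans this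
    have := hmono w hw1
    rw [hperiod] at this
    exact lt_irrefl _ this
  · have hall : ∀ j, ρ (X (j + 2 * h)).2 < ρ (X j).2 := by
      intro j
      induction j with
      | zero => exact h0
      | succ j ih =>
        have h1 := hX2 (j + 2 * h)
        rw [show j + 2 * h + 1 = j + 1 + 2 * h by ring] at h1
        exact (hcross _ _ _ _ (hpar j).symm ih h1.1 (hX2 j).1).resolve_left
          (hne (j + 1)).symm
    have hmono : ∀ n, 1 ≤ n → ρ (X (2 * h * n)).2 < ρ (X 0).2 := by
      intro n hn
      induction n, hn using Nat.le_induction with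
      | base => simpa using h0
      | succ n hn ih =>
        have := hall (2 * h * n)
        rw [show 2 * h * n + 2 * h = 2 * h * (n + 1) by ring] at this
        exact this.trans ih
    have := hmono w hw1
    rw [hperiod] at this
    exact lt_irrefl _ this

/-- All Hasse edges over one edge of `D` are translates of each other by a common multiple of `h`,
because an edge always takes one unit of time. -/
theorem mem_cutOf_iff (hC : IsCylinder T η h π D) {F : ℤ × B → ℤ} (hF : IsLevel T η h F)
    {x y : ℤ × B} (hxy : HasseEdge T η x y) :
    (π x, π y) ∈ cutOf T η π F ↔ F y = F x + 1 := by
  constructor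
  · rintro ⟨x', y', he, hF', heq⟩
    obtain ⟨h1, h2⟩ := Prod.ext_iff.1 heq
    obtain ⟨n, rfl⟩ := hC.exists_translate h1
    obtain ⟨n', rfl⟩ := hC.exists_translate h2
    have h3 := hxy.2
    have h4 := he.2
    have hpos : (0 : ℤ) < h := by exact_mod_cast hC.pos
    simp only [time] at h3 h4
    have h5 : n' * (h : ℤ) = n * h := by omega
    have h6 : n' = n := mul_right_cancel₀ hpos.ne' h5
    rw [hF.translate_mul, hF.translate_mul, h6, hF']
    ring
  · intro h'
    exact ⟨x, y, hxy, h', rfl⟩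

/-- The number of cut edges on a cycle telescopes to the growth of the level along a lift; by the
length hypothesis the lift ends at the translate of its start by `h`, so the growth is one. -/
theorem isCutPath_cutOf (hC : IsCylinder T η h π D) {F : ℤ × B → ℤ} (hF : IsLevel T η h F)
    (hlen : ∀ {m : ℕ} {v : Fin (m + 1) → V}, IsDirectedCycle D v → m + 1 = 2 * h) :
    IsCutPath D (cutOf T η π F) := by
  classical
  constructor
  · rintro e ⟨x, y, hxy, -, rfl⟩
    exact (hC.adj _ _).2 ⟨x, y, hxy, rfl, rfl⟩
  · intro m v hv
    obtain ⟨X, hX1, hX2, hX3⟩ := hC.exists_cycle_lift hv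
    have hmem : ∀ i : Fin (m + 1), (v i, v (i + 1)) ∈ cutOf T η π F ↔
        F (X (i + 1)) = F (X i) + 1 := by
      intro i
      rw [← hC.mem_cutOf_iff hF (hX2 i), hX1, hX1]
      have e1 : Fin.ofNat (m + 1) i = i := by apply Fin.ext; simp
      have e2 : Fin.ofNat (m + 1) (i + 1) = i + 1 := by apply Fin.ext; simp [Fin.val_add]
      rw [e1, e2]
    have hsum : ∑ i : Fin (m + 1), (if (v i, v (i + 1)) ∈ cutOf T η π F then 1 else 0 : ℤ) = 1 := by
      have h1 : ∀ i : Fin (m + 1), (if (v i, v (i + 1)) ∈ cutOf T η π F then 1 else 0 : ℤ) =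
          F (X (i + 1)) - F (X i) := by
        intro i
        rw [hmem]
        rcases hF.step _ _ (hX2 i) with h | h <;> rw [h] <;> simp
      simp only [h1]
      rw [← Finset.sum_range (fun i => F (X (i + 1)) - F (X i)),
        Finset.sum_range_sub (fun i => F (X i))]
      have h2 : π (X (m + 1)) = π (X 0) := by
        rw [hX1, hX1]; congr 1; apply Fin.ext; simp
      have h3 := ((hC.proj_eq _ _).1 h2).1
      have h4 : (X (m + 1)).1 = (X 0).1 + h := by
        apply fst_eq_of_time_eq h3.symm
        rw [hX3 (m + 1), hlen hv]; push_cast; rfl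
      have h5 : X (m + 1) = ((X 0).1 + h, (X 0).2) := Prod.ext h4 h3
      rw [h5, hF.translate]
      simp
    rw [Finset.sum_boole] at hsum
    have hcard : (Finset.univ.filter fun i => (v i, v (i + 1)) ∈ cutOf T η π F).card = 1 := by
      exact_mod_cast hsum
    obtain ⟨i, hi⟩ := Finset.card_eq_one.1 hcard
    refine ⟨i, ?_, ?_⟩
    · have : i ∈ Finset.univ.filter fun i => (v i, v (i + 1)) ∈ cutOf T η π F := by
        rw [hi]; exact Finset.mem_singleton_self i
      exact (Finset.mem_filter.1 this).2
    · intro j hj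
      have : j ∈ Finset.univ.filter fun i => (v i, v (i + 1)) ∈ cutOf T η π F :=
        Finset.mem_filter.2 ⟨Finset.mem_univ _, hj⟩
      rw [hi] at this
      exact Finset.mem_singleton.1 this

/-- The letter of generator `t` between two successive letters of a neighbour `s`. -/
theorem exists_between (hC : IsCylinder T η h π D) {s t : B} (hst : T.Adj s t) (k : ℤ) :
    ∃ j : ℤ, HasseEdge T η (k, s) (j, t) ∧ HasseEdge T η (j, t) (k + 1, s) := by
  rcases hC.height s t hst with h1 | h1
  · refine ⟨k, ⟨hst, ?_⟩, hst.symm, ?_⟩ <;> simp only [time] <;> omega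
  · refine ⟨k + 1, ⟨hst, ?_⟩, hst.symm, ?_⟩ <;> simp only [time] <;> omega

/-- Connectedness of the Hasse diagram: successive letters of a generator are joined through a
letter of a neighbour. -/
theorem const_of_edges [Nontrivial B] (hC : IsCylinder T η h π D) (hT : T.Connected)
    {α : Type*} {φ : ℤ × B → α} (hφ : ∀ x y, HasseEdge T η x y → φ x = φ y) (x y : ℤ × B) :
    φ x = φ y := by
  have h1 : ∀ s k, φ (k, s) = φ (0, s) := by
    intro s k
    obtain ⟨t, ht⟩ := hT.preconnected.exists_adj_of_nontrivial s
    have h2 : ∀ k, φ (k, s) = φ (k + 1, s) := by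
      intro k
      obtain ⟨j, h1, h2⟩ := hC.exists_between ht k
      rw [hφ _ _ h1, hφ _ _ h2]
    induction k using Int.induction_on with
    | zero => rfl
    | succ i ih => rw [← h2, ih]
    | pred i ih => rw [← ih, h2]; congr 2; ring
  have h2 : ∀ {s t : B} (_ : T.Walk s t), φ (0, s) = φ (0, t) := by
    intro s t p
    induction p with
    | nil => rfl
    | cons hadj _ ih =>
      obtain ⟨j, h3, -⟩ := hC.exists_between hadj 0
      rw [hφ _ _ h3, h1, ih]
  obtain ⟨p⟩ := hT.preconnected x.2 y.2
  have h3 := h2 p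
  rw [← h1 x.2 x.1, ← h1 y.2 y.1] at h3
  exact h3

/-- Walks can only increase the time, but a letter with smaller `k` has the same projection as a
translate of it far enough ahead. -/
theorem stronglyConnected [Nontrivial B] (hC : IsCylinder T η h π D) (hT : T.Connected) (i j : V) :
    Relation.ReflTransGen D.Adj i j := by
  obtain ⟨x, rfl⟩ := hC.surj i
  obtain ⟨y, rfl⟩ := hC.surj j
  have hadj : ∀ x y, HasseEdge T η x y → D.Adj (π x) (π y) :=
    fun x y hxy => (hC.adj _ _).2 ⟨x, y, hxy, rfl, rfl⟩
  have h1 : ∀ s (k : ℤ) (n : ℕ), Relation.ReflTransGen D.Adj (π (k, s)) (π (k + n, s)) := by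
    intro s k n
    obtain ⟨t, ht⟩ := hT.preconnected.exists_adj_of_nontrivial s
    induction n with
    | zero => simpa using Relation.ReflTransGen.refl
    | succ n ih =>
      obtain ⟨j, h1, h2⟩ := hC.exists_between ht (k + n)
      have := (ih.tail (hadj _ _ h1)).tail (hadj _ _ h2)
      rw [add_assoc] at this
      exact_mod_cast this
  have h2 : ∀ s (k k' : ℤ), Relation.ReflTransGen D.Adj (π (k, s)) (π (k', s)) := by
    intro s k k'
    have hpos : (1 : ℤ) ≤ h := by exact_mod_cast hC.pos
    have h3 := hC.proj_translate (k', s) (k - k').natAbs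
    have h4 : 0 ≤ k' + ((k - k').natAbs : ℤ) * h - k := by
      have : ((k - k').natAbs : ℤ) ≤ ((k - k').natAbs : ℤ) * h := by nlinarith
      omega
    obtain ⟨n, hn⟩ := Int.eq_ofNat_of_zero_le h4
    have h5 := h1 s k n
    rw [← hn, show k + (k' + ((k - k').natAbs : ℤ) * h - k) = k' + ((k - k').natAbs : ℤ) * h by ring]
      at h5
    dsimp only at h3
    rwa [h3] at h5
  have h3 : ∀ {s t : B} (_ : T.Walk s t) (k k' : ℤ),
      Relation.ReflTransGen D.Adj (π (k, s)) (π (k', t)) := by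
    intro s t p
    induction p with
    | nil => exact fun k k' => h2 _ k k'
    | cons hst _ ih =>
      intro k k'
      obtain ⟨j, h4, -⟩ := hC.exists_between hst k
      exact Relation.ReflTransGen.head (hadj _ _ h4) (ih j k')
  obtain ⟨p⟩ := hT.preconnected x.2 y.2
  exact h3 p x.1 y.1

/-- Each cut path is the set of edges along which some level function increases. -/
theorem exists_level [Nontrivial B] (hC : IsCylinder T η h π D) (hT : T.Connected)
    (hlen : ∀ {m : ℕ} {v : Fin (m + 1) → V}, IsDirectedCycle D v → m + 1 = 2 * h)
    {κ : Set (V × V)} (hκ : IsCutPath D κ) :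
    ∃ F, IsLevel T η h F ∧ κ = cutOf T η π F := by
  classical
  have hpos : (0 : ℤ) < 2 * h := by have := hC.pos; omega
  have : Nonempty V := by
    obtain ⟨s⟩ := hT.nonempty
    exact ⟨π (0, s)⟩
  obtain ⟨g, hg⟩ := exists_digraph_potential (D := D)
    -- A cycle has `2 * h` edges, exactly one of them in `κ`, so its total weight is zero.
    (ω := fun i j => (if (i, j) ∈ κ then 2 * (h : ℤ) else 0) - 1) (by
      intro m v hv
      obtain ⟨i, hi, huniq⟩ := hκ.2 m v hv
      rw [Finset.sum_sub_distrib, Finset.sum_eq_single i, if_pos hi]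
      · have := hlen hv
        simp only [Finset.sum_const, Finset.card_univ, Fintype.card_fin, nsmul_eq_mul, mul_one]
        omega
      · intro j _ hj
        rw [if_neg fun h' => hj (huniq j h')]
      · intro h'; exact absurd (Finset.mem_univ i) h')
    (hC.stronglyConnected hT)
  have hadj : ∀ x y, HasseEdge T η x y → D.Adj (π x) (π y) :=
    fun x y hxy => (hC.adj _ _).2 ⟨x, y, hxy, rfl, rfl⟩
  have hstep : ∀ x y, HasseEdge T η x y →
      g (π y) + time η y = g (π x) + time η x + if (π x, π y) ∈ κ then 2 * (h : ℤ) else 0 := by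
    intro x y hxy
    rw [hg _ _ (hadj x y hxy), hxy.2]
    ring
  have hstep' : ∀ x y, HasseEdge T η x y →
      (g (π y) + time η y) / (2 * h) = (g (π x) + time η x) / (2 * h) +
        if (π x, π y) ∈ κ then 1 else 0 := by
    intro x y hxy
    rw [hstep x y hxy]
    split_ifs
    · rw [Int.add_ediv_of_dvd_right (dvd_refl _), Int.ediv_self hpos.ne']
    · simp
  -- Adding the time cancels the `-1` of the weight: the numerator jumps by `2 * h` on `κ`, is
  -- constant along other edges, and grows by `2 * h` under translation.
  refine ⟨fun x => (g (π x) + time η x) / (2 * h), ⟨?_, ?_⟩, ?_⟩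
  · intro x y hxy
    rw [hstep' x y hxy]
    split_ifs <;> simp
  · intro k s
    have h1 := hC.proj_translate (k, s) 1
    rw [one_mul] at h1
    dsimp only at h1 ⊢
    rw [h1]
    have : g (π (k, s)) + time η (k + h, s) = g (π (k, s)) + time η (k, s) + 2 * h := by
      simp only [time]; ring
    rw [this, Int.add_ediv_of_dvd_right (dvd_refl _), Int.ediv_self hpos.ne']
  · ext ⟨i, j⟩
    constructor
    · intro hij
      obtain ⟨x, y, hxy, rfl, rfl⟩ := (hC.adj i j).1 (hκ.1 hij)
      refine ⟨x, y, hxy, ?_, rfl⟩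
      dsimp only
      rw [hstep' x y hxy, if_pos hij]
    · rintro ⟨x, y, hxy, hF, heq⟩
      dsimp only at hF
      rw [hstep' x y hxy] at hF
      rw [heq]
      by_contra hno
      rw [if_neg hno] at hF
      omega

end IsCylinder

end Cylinder

end CutPaths

namespace CutPaths

/-! ### Slices and cut paths -/

section Slices

variable {B V : Type*} {T : SimpleGraph B} {η : B → ℤ} {h : ℕ} {π : ℤ × B → V} {D : Digraph V}

/-- The letters `(k, s)` with `k < b s` form an order ideal. -/
def IsSlice (T : SimpleGraph B) (η b : B → ℤ) : Prop :=
  ∀ s t, T.Adj s t → η t + 2 * b t = η s + 2 * b s + 1 ∨ η s + 2 * b s = η t + 2 * b t + 1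

/-- The level function of a slice. -/
def levelOf (h : ℕ) (b : B → ℤ) (x : ℤ × B) : ℤ :=
  (x.1 - b x.2) / h

theorem levelOf_eq_zero {b : B → ℤ} {x : ℤ × B} (h1 : b x.2 ≤ x.1) (h2 : x.1 < b x.2 + h) :
    levelOf h b x = 0 :=
  Int.ediv_eq_zero_of_lt (by omega) (by omega)

theorem le_levelOf (hpos : 0 < h) {b : B → ℤ} {x : ℤ × B} {n : ℤ} :
    n ≤ levelOf h b x ↔ n * h ≤ x.1 - b x.2 :=
  Int.le_ediv_iff_mul_le (by exact_mod_cast hpos)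

theorem isLevel_levelOf (hpos : 0 < h) {b : B → ℤ} (hb : IsSlice T η b) :
    IsLevel T η h (levelOf h b) := by
  have hpos' : (1 : ℤ) ≤ h := by exact_mod_cast hpos
  constructor
  · intro x y hxy
    have h1 : y.1 - b y.2 = x.1 - b x.2 ∨ y.1 - b y.2 = x.1 - b x.2 + 1 := by
      have h2 := hxy.2
      simp only [time] at h2
      rcases hb _ _ hxy.1 with h3 | h3 <;> omega
    rcases h1 with h1 | h1
    · left; rw [levelOf, levelOf, h1]
    · have h2 : levelOf h b x ≤ levelOf h b y := by
        rw [levelOf, levelOf, h1]; exact Int.ediv_le_ediv (by omega) (by omega)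
      have h3 : levelOf h b y ≤ levelOf h b x + 1 := by
        have : levelOf h b x + 1 = (x.1 - b x.2 + h) / h := by
          rw [levelOf, Int.add_ediv_of_dvd_right (dvd_refl _), Int.ediv_self (by omega)]
        rw [this, levelOf, h1]
        exact Int.ediv_le_ediv (by omega) (by omega)
      omega
  · intro k s
    simp only [levelOf]
    rw [show k + (h : ℤ) - b s = k - b s + h by ring,
      Int.add_ediv_of_dvd_right (dvd_refl _), Int.ediv_self (by omega)]

theorem cutOf_add_const (F : ℤ × B → ℤ) (c : ℤ) :
    cutOf T η π (fun x => F x + c) = cutOf T η π F := by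
  ext e
  refine exists_congr fun x => exists_congr fun y => and_congr_right fun _ => and_congr_left fun _ => ?_
  constructor <;> intro h' <;> linarith

namespace IsCylinder

theorem fst_le_of_hasseEdge (hC : IsCylinder T η h π D) {x y : ℤ × B} (hxy : HasseEdge T η x y) :
    x.1 ≤ y.1 ∧ y.1 ≤ x.1 + 1 := by
  have h2 := hxy.2
  simp only [time] at h2
  rcases hC.height _ _ hxy.1 with h3 | h3 <;> omega

/-- On the strip the bounds `0 ≤ b ≤ a` make the level equal to `k / h`, and an edge inside the
strip does not enter a new period, as `a` is positive. -/
theorem disjoint_cutOf (hC : IsCylinder T η h π D) {a b : B → ℤ}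
    (hb : ∀ s, 0 ≤ b s ∧ b s ≤ a s) (ha : ∀ s, 1 ≤ a s) {P : Set V}
    (hP : ∀ x, π x ∈ P ↔ a x.2 ≤ x.1 % h) :
    Disjoint (cutOf T η π (levelOf h b)) (inducedEdgeSet D P) := by
  have hpos : (0 : ℤ) < h := by exact_mod_cast hC.pos
  rw [Set.disjoint_left]
  rintro e ⟨x, y, hxy, hF, rfl⟩ ⟨-, hx, hy⟩
  have hlev : ∀ z : ℤ × B, a z.2 ≤ z.1 % h → levelOf h b z = z.1 / h := by
    intro z hz
    have h1 := Int.emod_lt_of_pos z.1 hpos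
    have h2 := Int.emod_add_mul_ediv z.1 h
    have h3 := hb z.2
    rw [levelOf, show z.1 - b z.2 = (z.1 % h - b z.2) + h * (z.1 / h) by linarith,
      Int.add_mul_ediv_left _ _ hpos.ne', Int.ediv_eq_zero_of_lt (by omega) (by omega), zero_add]
  rw [hlev x ((hP x).1 hx), hlev y ((hP y).1 hy)] at hF
  have h1 := ha y.2
  have h2 := (hP y).1 hy
  have h3 := Int.emod_add_mul_ediv y.1 h
  have h4 := Int.emod_lt_of_pos y.1 hpos
  have h5 : (y.1 - 1) / h = y.1 / h := by
    rw [show y.1 - 1 = (y.1 % h - 1) + h * (y.1 / h) by linarith,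
      Int.add_mul_ediv_left _ _ hpos.ne', Int.ediv_eq_zero_of_lt (by omega) (by omega), zero_add]
  rcases (hC.fst_le_of_hasseEdge hxy) with ⟨h6, h7⟩
  rcases h6.eq_or_lt with h8 | h8
  · rw [h8] at hF; omega
  · rw [show x.1 = y.1 - 1 by omega] at hF; omega

/-- The cut determines the level up to a constant, which is fixed by the value `0` at `k = h - 1`;
the slice is where the level becomes nonnegative. -/
theorem slice_eq_of_cutOf_eq [Nontrivial B] (hC : IsCylinder T η h π D) (hT : T.Connected)
    {b b' : B → ℤ} (hb : IsSlice T η b) (hb' : IsSlice T η b')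
    (h0 : ∀ s, 0 ≤ b s ∧ b s < h) (h0' : ∀ s, 0 ≤ b' s ∧ b' s < h)
    (heq : cutOf T η π (levelOf h b) = cutOf T η π (levelOf h b')) : b = b' := by
  have hF := isLevel_levelOf hC.pos hb
  have hF' := isLevel_levelOf hC.pos hb'
  have hconst := hC.const_of_edges hT (φ := fun x => levelOf h b x - levelOf h b' x) (by
    intro x y hxy
    have h1 := hC.mem_cutOf_iff hF hxy
    rw [heq, hC.mem_cutOf_iff hF' hxy] at h1
    have h2 := hF.step x y hxy
    have h3 := hF'.step x y hxy
    omega)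
  have hzero : ∀ x, levelOf h b x = levelOf h b' x := by
    intro x
    have h1 := hconst x ((h : ℤ) - 1, x.2)
    have h2 := h0 x.2
    have h3 := h0' x.2
    rw [levelOf_eq_zero (b := b) (x := ((h : ℤ) - 1, x.2)) (by dsimp only; omega) (by dsimp only; omega),
      levelOf_eq_zero (b := b') (x := ((h : ℤ) - 1, x.2)) (by dsimp only; omega) (by dsimp only; omega)] at h1
    omega
  funext s
  have key : ∀ k : ℤ, b s ≤ k ↔ b' s ≤ k := by
    intro k
    have h1 := le_levelOf hC.pos (b := b) (x := (k, s)) (n := 0)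
    have h2 := le_levelOf hC.pos (b := b') (x := (k, s)) (n := 0)
    rw [hzero (k, s), h2] at h1
    simp only [zero_mul, sub_nonneg] at h1
    exact h1.symm
  exact le_antisymm ((key _).2 le_rfl) ((key _).1 le_rfl)

/-- The level has a constant value `c` on the strip `a s ≤ k < h` and is smaller for negative `k`,
by translation. It is monotone in `k`, so `b s` is the first `k` at which `c` is reached. -/
theorem exists_slice [Nontrivial B] (hC : IsCylinder T η h π D) (hT : T.Connected)
    {a : B → ℤ} (ha : IsSlice T η a) (ha1 : ∀ s, 1 ≤ a s) (hah : ∀ s, a s < h) {P : Set V}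
    (hP : ∀ x, π x ∈ P ↔ a x.2 ≤ x.1 % h) {F : ℤ × B → ℤ} (hF : IsLevel T η h F)
    (hdisj : Disjoint (cutOf T η π F) (inducedEdgeSet D P)) :
    ∃ b : B → ℤ, IsSlice T η b ∧ (∀ s, 0 ≤ b s ∧ b s ≤ a s) ∧
      cutOf T η π (levelOf h b) = cutOf T η π F := by
  have hpos : (0 : ℤ) < h := by exact_mod_cast hC.pos
  have hedge : ∀ x y, HasseEdge T η x y → a x.2 ≤ x.1 → y.1 < h → F x = F y := by
    intro x y hxy h1 h2
    obtain ⟨h3, h4⟩ := hC.fst_le_of_hasseEdge hxy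
    have h5 : a y.2 ≤ y.1 := by
      have h2 := hxy.2
      simp only [time] at h2
      rcases ha _ _ hxy.1 with h6 | h6 <;> omega
    have h6 : π x ∈ P := by
      rw [hP, Int.emod_eq_of_lt (by linarith [ha1 x.2]) (by omega)]; exact h1
    have h7 : π y ∈ P := by
      rw [hP, Int.emod_eq_of_lt (by linarith [ha1 y.2]) h2]; exact h5
    rcases hF.step x y hxy with h8 | h8
    · exact h8.symm
    · exact absurd ⟨(hC.adj _ _).2 ⟨x, y, hxy, rfl, rfl⟩, h6, h7⟩
        (Set.disjoint_left.1 hdisj ⟨x, y, hxy, h8, rfl⟩)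
  obtain ⟨s0⟩ := hT.nonempty
  have hlast : ∀ {s t : B} (_ : T.Walk s t), F ((h : ℤ) - 1, s) = F ((h : ℤ) - 1, t) := by
    intro s t p
    induction p with
    | nil => rfl
    | @cons s t _ hadj _ ih =>
      rw [← ih]
      have hs := hah s
      have ht := hah t
      rcases hC.height _ _ hadj with h1 | h1
      · exact hedge _ _ ⟨hadj, by simp only [time]; omega⟩ (by dsimp only; omega)
          (by dsimp only; omega)
      · exact (hedge _ _ ⟨hadj.symm, by simp only [time]; omega⟩ (by dsimp only; omega)
          (by dsimp only; omega)).symm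
  set c := F ((h : ℤ) - 1, s0) with hc
  have hlast' : ∀ s, F ((h : ℤ) - 1, s) = c := fun s => by
    obtain ⟨p⟩ := hT.preconnected s s0
    exact hlast p
  have hconst : ∀ s (n : ℕ), a s ≤ (h : ℤ) - 1 - n → F ((h : ℤ) - 1 - n, s) = c := by
    intro s n hn
    obtain ⟨t, ht⟩ := hT.preconnected.exists_adj_of_nontrivial s
    induction n with
    | zero => simpa using hlast' s
    | succ n ih =>
      obtain ⟨j, h1, h2⟩ := hC.exists_between ht ((h : ℤ) - 1 - (n + 1 : ℕ))
      rw [← ih (by push_cast at hn; omega)]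
      have h3 := hC.fst_le_of_hasseEdge h2
      dsimp only at h3
      have h4 := h1.2
      simp only [time] at h4
      rw [hedge _ _ h1 hn (by dsimp only; push_cast at h3 ⊢; omega), hedge _ _ h2 (by
        dsimp only
        rcases ha _ _ ht with h6 | h6 <;> omega) (by dsimp only; push_cast; omega)]
      congr 2
      push_cast
      ring
  have hmono : ∀ s (k : ℤ) (n : ℕ), F (k, s) ≤ F (k + n, s) := by
    intro s k n
    obtain ⟨t, ht⟩ := hT.preconnected.exists_adj_of_nontrivial s
    induction n with
    | zero => simp
    | succ n ih =>
      obtain ⟨j, h1, h2⟩ := hC.exists_between ht (k + n)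
      have h3 := hF.step _ _ h1
      have h4 := hF.step _ _ h2
      rw [add_assoc] at h4
      push_cast
      omega
  have hmono' : ∀ s (k k' : ℤ), k ≤ k' → F (k, s) ≤ F (k', s) := by
    intro s k k' hk
    obtain ⟨n, hn⟩ := Int.eq_ofNat_of_zero_le (sub_nonneg.2 hk)
    have := hmono s k n
    rwa [← hn, add_sub_cancel] at this
  have hneg : ∀ s (k : ℤ), k < 0 → F (k, s) < c := by
    intro s k hk
    have h1 := hmono' s k (-1) (by omega)
    have h2 := hF.translate (-1) s
    rw [show (-1 : ℤ) + h = h - 1 by ring, hlast'] at h2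
    omega
  have hat : ∀ s, F (a s, s) = c := by
    intro s
    obtain ⟨n, hn⟩ := Int.eq_ofNat_of_zero_le (show 0 ≤ (h : ℤ) - 1 - a s by linarith [hah s])
    have := hconst s n (by omega)
    rwa [← hn, sub_sub_cancel] at this
  choose b hb1 hb2 using fun s => Int.exists_least_of_bdd (P := fun k => c ≤ F (k, s))
    ⟨0, fun z hz => by
      by_contra hlt
      have := hneg s z (by omega)
      omega⟩ ⟨a s, (hat s).ge⟩
  have hb3 : ∀ s k, b s ≤ k ↔ c ≤ F (k, s) :=
    fun s k => ⟨fun hk => (hb1 s).trans (hmono' s _ _ hk), hb2 s k⟩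
  refine ⟨b, ?_, fun s => ⟨?_, ?_⟩, ?_⟩
  · have key : ∀ s t, T.Adj s t → η t + 2 * b t ≤ η s + 2 * b s + 1 := by
      intro s t hst
      obtain ⟨j, h1, -⟩ := hC.exists_between hst (b s)
      have h2 := hF.step _ _ h1
      have h3 := (hb3 t j).2 (by have := hb1 s; omega)
      have h4 := h1.2
      simp only [time] at h4
      omega
    intro s t hst
    have h1 := key s t hst
    have h2 := key t s hst.symm
    rcases hC.height s t hst with h3 | h3 <;> omega
  · by_contra hlt
    have := hneg s (b s) (by omega)
    have := hb1 s
    omega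
  · exact hb2 s _ (hat s).ge
  · rw [← cutOf_add_const F (-c)]
    congr 1
    funext x
    obtain ⟨k, s⟩ := x
    -- Translating by `n` periods reduces the comparison with any integer `n` to the defining level
    -- `c` of `b`.
    refine eq_of_forall_le_iff fun n => ?_
    rw [le_levelOf hC.pos]
    have h1 := hF.translate_mul (-n) k s
    have h2 := hb3 s (k + -n * h)
    rw [h1] at h2
    dsimp only
    constructor
    · intro h3
      have := h2.1 (by linarith)
      linarith
    · intro h3
      have := h2.2 (by linarith)
      linarith

/-- The cut paths that avoid the edges between letters `(k, s)` with `a s ≤ k < h` correspond to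
the slices between `0` and `a`. -/
theorem nonempty_slice_equiv [Nontrivial B] (hC : IsCylinder T η h π D) (hT : T.Connected)
    (hlen : ∀ {m : ℕ} {v : Fin (m + 1) → V}, IsDirectedCycle D v → m + 1 = 2 * h)
    {a : B → ℤ} (ha : IsSlice T η a) (ha1 : ∀ s, 1 ≤ a s) (hah : ∀ s, a s < h) {P : Set V}
    (hP : ∀ x, π x ∈ P ↔ a x.2 ≤ x.1 % h) :
    Nonempty ({b : B → ℤ // IsSlice T η b ∧ ∀ s, 0 ≤ b s ∧ b s ≤ a s} ≃
      {κ : Set (V × V) // IsCutPath D κ ∧ Disjoint κ (inducedEdgeSet D P)}) := by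
  refine ⟨Equiv.ofBijective (fun b => ⟨cutOf T η π (levelOf h b.1),
    hC.isCutPath_cutOf (isLevel_levelOf hC.pos b.2.1) hlen,
    hC.disjoint_cutOf b.2.2 ha1 hP⟩) ⟨?_, ?_⟩⟩
  · intro b b' hbb
    exact Subtype.ext (hC.slice_eq_of_cutOf_eq hT b.2.1 b'.2.1
      (fun s => ⟨(b.2.2 s).1, (b.2.2 s).2.trans_lt (hah s)⟩)
      (fun s => ⟨(b'.2.2 s).1, (b'.2.2 s).2.trans_lt (hah s)⟩) (congrArg Subtype.val hbb))
  · rintro ⟨κ, hκ, hdisj⟩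
    obtain ⟨F, hF, rfl⟩ := hC.exists_level hT hlen hκ
    obtain ⟨b, hb, hb', heq⟩ := hC.exists_slice hT ha ha1 hah hP hF hdisj
    exact ⟨⟨b, hb, hb'⟩, Subtype.ext heq⟩

end IsCylinder

end Slices

end CutPaths

namespace CutPaths

/-! ### The Coxeter word as a height, and its sorting word -/

section WordHeights

variable {B W : Type*} [Group W] {M : CoxeterMatrix B} (cs : CoxeterSystem M W)

/-- The height increases along the word, for adjacent generators. -/
def IsWordHeight (c : List B) (η : B → ℤ) : Prop :=
  ∀ p q : Fin c.length, p < q → (coxeterGraph cs).Adj (c.get p) (c.get q) →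
    η (c.get q) = η (c.get p) + 1

variable {cs} {c : List B} {η : B → ℤ}

/-- The order of the letters of `c` orients the edges of a tree, and such an orientation is a
gradient. -/
theorem exists_isWordHeight (hc : IsCoxeterWord c) (hT : (coxeterGraph cs).IsTree) :
    ∃ η : B → ℤ, IsWordHeight cs c η := by
  classical
  choose idx hidx using fun i : B => List.get_of_mem (hc.2 i)
  have hidx' : ∀ p, idx (c.get p) = p := fun p => hc.1.injective_get (hidx _)
  obtain ⟨f, hf⟩ := exists_potential hT
    (fun s t => if idx s < idx t then 1 else if idx t < idx s then -1 else 0) (by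
      intro s t
      split_ifs with h1 h2
      · exact absurd h1 h2.asymm
      · rfl
      · rfl
      · rfl)
  refine ⟨f, fun p q hpq h => ?_⟩
  rw [hf _ _ h, hidx', hidx', if_pos hpq]

theorem IsWordHeight.isHeight (hw : IsWordHeight cs c η) (hc : IsCoxeterWord c) :
    IsHeight cs η := by
  intro s t h
  obtain ⟨p, rfl⟩ := List.get_of_mem (hc.2 s)
  obtain ⟨q, rfl⟩ := List.get_of_mem (hc.2 t)
  rcases lt_trichotomy p q with hpq | hpq | hpq
  · exact Or.inl (hw p q hpq h)
  · rw [hpq] at h; exact absurd h (coxeterGraph cs).irrefl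
  · exact Or.inr (hw q p hpq h.symm)

/-- The letter `(k, s)` of `c^∞` at a position. -/
def posLetter (c : List B) (x : Pos c) : ℤ × B :=
  ((ofLex x).1, letter c x)

theorem posLetter_injective (hc : IsCoxeterWord c) : Function.Injective (posLetter c) := by
  intro x y hxy
  obtain ⟨h1, h2⟩ := Prod.ext_iff.1 hxy
  have h3 : (ofLex x).1 = (ofLex y).1 := Int.natCast_inj.1 h1
  have h4 : (ofLex x).2 = (ofLex y).2 := hc.1.injective_get h2
  exact ofLex.injective (Prod.ext h3 h4)

theorem exists_posLetter (hc : IsCoxeterWord c) {x : ℤ × B} (hx : 0 ≤ x.1) :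
    ∃ y : Pos c, posLetter c y = x := by
  obtain ⟨k, s⟩ := x
  obtain ⟨n, rfl⟩ := Int.eq_ofNat_of_zero_le hx
  obtain ⟨p, rfl⟩ := List.get_of_mem (hc.2 s)
  exact ⟨toLex (n, p), rfl⟩

/-- Two letters of `c^∞` that do not commute are ordered by their times. -/
theorem IsWordHeight.precedes_iff (hw : IsWordHeight cs c η) {x y : Pos c} :
    Precedes cs η (posLetter c x) (posLetter c y) ↔
      x < y ∧ ¬ Commute (cs.simple (letter c x)) (cs.simple (letter c y)) := by
  refine and_congr_left fun h => ?_
  rw [Prod.Lex.lt_iff]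
  have h1 : (coxeterGraph cs).Adj (c.get (ofLex x).2) (c.get (ofLex y).2) := h
  simp only [time, posLetter, letter]
  rcases lt_trichotomy (ofLex x).2 (ofLex y).2 with hpq | hpq | hpq
  · have := hw _ _ hpq h1
    omega
  · rw [hpq] at h1; exact absurd h1 (coxeterGraph cs).irrefl
  · have := hw _ _ hpq h1.symm
    omega

theorem posLetter_fst_lt_of_lt {x y : Pos c} (hc : IsCoxeterWord c) (h : x < y)
    (hl : letter c x = letter c y) : (ofLex x).1 < (ofLex y).1 := by
  rcases Prod.Lex.lt_iff.1 h with h1 | ⟨-, h2⟩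
  · exact h1
  · exact absurd (hc.1.injective_get hl) h2.ne

theorem IsWordHeight.isLinearExtension_map (hw : IsWordHeight cs c η) {l : List (Pos c)}
    (hl : l.Pairwise (· < ·)) : IsLinearExtension cs η (l.map (posLetter c)) := by
  rw [IsLinearExtension, List.pairwise_map]
  exact hl.imp fun hxy h => (hw.precedes_iff.1 h).1.not_gt hxy

theorem IsWordHeight.wordProd_map_letter (hw : IsWordHeight cs c η) (hc : IsCoxeterWord c)
    {l : List (Pos c)} (hl : l.Pairwise (· < ·)) {I : Finset (ℤ × B)}
    (hmem : ∀ x, (∃ y ∈ l, posLetter c y = x) ↔ x ∈ I) :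
    cs.wordProd (l.map (letter c)) = heapProd cs η I := by
  rw [← wordProd_eq_heapProd (hw.isHeight hc) (l := l.map (posLetter c)) ?_ ?_
    (hw.isLinearExtension_map hl), List.map_map]
  · rfl
  · exact (hl.imp fun h => h.ne).map _ fun _ _ h h' => h (posLetter_injective hc h')
  · intro x
    rw [List.mem_map, hmem]

variable [Fintype B] [DecidableEq B]

theorem IsWordHeight.wordProd_eq (hw : IsWordHeight cs c η) (hc : IsCoxeterWord c) (k : ℕ) :
    cs.wordProd c = heapProd cs η (interval (fun _ => (k : ℤ)) fun _ => k + 1) := by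
  have h1 : ((List.finRange c.length).map fun p => (toLex (k, p) : Pos c)).map (letter c) = c := by
    rw [List.map_map]
    exact List.map_get_finRange c
  nth_rewrite 1 [← h1]
  refine hw.wordProd_map_letter hc ?_ ?_
  · rw [List.pairwise_map]
    refine (List.pairwise_lt_finRange _).imp fun h => ?_
    exact Prod.Lex.toLex_lt_toLex.2 (Or.inr ⟨rfl, h⟩)
  · intro x
    rw [mem_interval']
    constructor
    · rintro ⟨y, hy, rfl⟩
      obtain ⟨p, -, rfl⟩ := List.mem_map.1 hy
      simp [posLetter]
    · intro hx
      obtain ⟨y, rfl⟩ := exists_posLetter hc (x := x) (by omega)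
      refine ⟨y, List.mem_map.2 ⟨(ofLex y).2, List.mem_finRange _, ?_⟩, rfl⟩
      simp only [posLetter] at hx
      have : k = (ofLex y).1 := by omega
      rw [this]
      rfl

theorem IsWordHeight.wordProd_pow (hw : IsWordHeight cs c η) (hc : IsCoxeterWord c) (k : ℕ) :
    cs.wordProd c ^ k = heapProd cs η (interval (fun _ => (0 : ℤ)) fun _ => k) := by
  induction k with
  | zero =>
    have : interval (fun _ : B => (0 : ℤ)) (fun _ => ((0 : ℕ) : ℤ)) = ∅ := by
      ext ⟨k, s⟩
      rw [mem_interval]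
      simp
    rw [this, heapProd_empty, pow_zero]
  | succ k ih =>
    have hη := hw.isHeight hc
    have h0 : IsIdeal cs η fun _ => (k : ℤ) := by
      intro s t h
      have := hη s t h
      dsimp only
      omega
    rw [pow_succ, ih, hw.wordProd_eq hc k,
      heapProd_interval_mul hη h0 (c := fun _ => ((k + 1 : ℕ) : ℤ)) (fun _ => by omega)
        (fun _ => by push_cast; omega)]
    push_cast
    rfl

theorem isIdeal_zero (hη : IsHeight cs η) : IsIdeal cs η fun _ => 0 := by
  intro s t h
  have := hη s t h
  dsimp only
  omega

variable [Finite W]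

theorem IsWordHeight.coxeterNumber_eq [Nontrivial B] (hw : IsWordHeight cs c η)
    (hc : IsCoxeterWord c) (hirr : (coxeterGraph cs).Connected) {m : ℕ} (hm1 : 1 ≤ m)
    (hm : ∀ s, (η (psiIndex cs s) - η s - m) % 2 = 0)
    (h0 : layerProd cs η m = longest cs)
    (hcard : (interval (timeIdeal η 0) (timeIdeal η m)).card = cs.length (longest cs)) :
    coxeterNumber cs c = m := by
  have hη := hw.isHeight hc
  obtain ⟨h1, h2⟩ := heapProd_period hη hirr hm h0 hcard (isIdeal_zero hη)
  simp only [zero_add] at h1 h2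
  rw [coxeterNumber, orderOf_eq_iff hm1]
  refine ⟨by rw [hw.wordProd_pow hc, h1], fun k hk hk0 => ?_⟩
  rw [hw.wordProd_pow hc]
  exact h2 k (by omega) (by omega)

/-- The data of an initial ideal whose letters form a reduced expression of the longest element. -/
structure IsLongestIdeal (cs : CoxeterSystem M W) (η a : B → ℤ) : Prop where
  isIdeal : IsIdeal cs η a
  nonneg : ∀ s, 0 ≤ a s
  heapProd_eq : heapProd cs η (interval (fun _ => 0) a) = longest cs
  card_eq : (interval (fun _ => 0) a).card = cs.length (longest cs)

variable {a : B → ℤ}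

theorem exists_position_finset (hc : IsCoxeterWord c) (a : B → ℤ) :
    ∃ I : Finset (Pos c), (∀ x, x ∈ I ↔ ((ofLex x).1 : ℤ) < a (letter c x)) ∧
      I.card = (interval (fun _ => 0) a).card := by
  classical
  refine ⟨(interval (fun _ => 0) a).preimage (posLetter c) (posLetter_injective hc).injOn, ?_, ?_⟩
  · intro x
    rw [Finset.mem_preimage, mem_interval']
    simp [posLetter]
  · rw [Finset.card_preimage]
    congr 1
    refine Finset.filter_true_of_mem fun x hx => ?_
    rw [mem_interval'] at hx
    exact exists_posLetter hc hx.1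

theorem wordProd_ofFn_letter (hw : IsWordHeight cs c η) (hc : IsCoxeterWord c) {n : ℕ}
    {p : Fin n → Pos c} (hp : StrictMono p)
    (hmem : ∀ x, x ∈ Set.range p ↔ ((ofLex x).1 : ℤ) < a (letter c x)) :
    cs.wordProd (List.ofFn fun k => letter c (p k)) = heapProd cs η (interval (fun _ => 0) a) := by
  rw [show (fun k => letter c (p k)) = letter c ∘ p from rfl, ← List.map_ofFn]
  refine hw.wordProd_map_letter hc (List.pairwise_ofFn.2 fun _ _ h => hp h) ?_
  intro x
  rw [mem_interval']
  constructor
  · rintro ⟨y, hy, rfl⟩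
    rw [List.mem_ofFn] at hy
    exact ⟨by simp [posLetter], (hmem y).1 hy⟩
  · intro hx
    obtain ⟨y, rfl⟩ := exists_posLetter hc hx.1
    exact ⟨y, List.mem_ofFn.2 ((hmem y).2 hx.2), rfl⟩

/-- No reduced subword for the longest element is lexicographically smaller than the initial
ideal. -/
theorem not_lt_of_mem_reducedSubwords (hw : IsWordHeight cs c η) (hc : IsCoxeterWord c)
    (ha : IsLongestIdeal cs η a) {p q : Lex (Fin (cs.length (longest cs)) → Pos c)}
    (hp : StrictMono (ofLex p))
    (hmem : ∀ x, x ∈ Set.range (ofLex p) ↔ ((ofLex x).1 : ℤ) < a (letter c x))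
    (hq : q ∈ reducedSubwords cs c (longest cs)) : ¬ q < p := by
  rintro ⟨i, hi1, hi2⟩
  replace hi1 : ∀ j < i, ofLex q j = ofLex p j := hi1
  replace hi2 : ofLex q i < ofLex p i := hi2
  obtain ⟨hq1, hq2⟩ := hq
  set lq := List.ofFn fun k => letter c (ofLex q k) with hlq
  set lp := List.ofFn fun k => letter c (ofLex p k) with hlp
  have hlenq : lq.length = cs.length (longest cs) := List.length_ofFn
  have hlenp : lp.length = cs.length (longest cs) := List.length_ofFn
  have hredq : cs.IsReduced lq := by
    rw [CoxeterSystem.IsReduced, hq2, hlenq]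
  have htake : lq.take i = lp.take i := by
    apply List.ext_getElem
    · simp [hlenq, hlenp]
    · intro n h1 h2
      have hn : n < i := by
        have := h1
        rw [List.length_take] at this
        omega
      simp only [List.getElem_take, hlq, hlp, List.getElem_ofFn]
      rw [hi1 ⟨n, by omega⟩ hn]
  -- At the first difference `q` uses a position that `p` passes over, hence a position outside the
  -- ideal.
  have hnot : a (letter c (ofLex q i)) ≤ ((ofLex (ofLex q i)).1 : ℤ) := by
    by_contra hlt
    obtain ⟨j, hj⟩ := (hmem _).2 (not_le.1 hlt)
    have hji : j < i := hp.lt_iff_lt.1 (by rw [hj]; exact hi2)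
    have := hi1 j hji
    rw [hj] at this
    exact hji.ne (hq1.injective this)
  set s := letter c (ofLex q i) with hs
  -- The remaining letters of `p` lie in the ideal and come after that position; an equal or
  -- noncommuting one would pull the position into the ideal.
  have hdrop : ∀ j ∈ lp.drop i, j ≠ s ∧ Commute (cs.simple j) (cs.simple s) := by
    intro j hj
    obtain ⟨n, hn, rfl⟩ := List.mem_iff_getElem.1 hj
    rw [List.length_drop] at hn
    rw [List.getElem_drop]
    simp only [hlp, List.getElem_ofFn]
    set y := ofLex p ⟨i + n, by omega⟩ with hy
    have hlt : ofLex q i < y := hi2.trans_le (hp.monotone (Fin.le_def.2 (Nat.le_add_right _ _)))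
    have hya : ((ofLex y).1 : ℤ) < a (letter c y) := (hmem y).1 ⟨_, rfl⟩
    refine ⟨fun hls => ?_, ?_⟩
    · have h1 := posLetter_fst_lt_of_lt hc hlt (by rw [hls])
      rw [hls] at hya
      omega
    · by_contra hcomm
      have h1 := hw.precedes_iff.2 ⟨hlt, fun h => hcomm h.symm⟩
      have h2 := ha.isIdeal.mem_of_precedes h1 hya
      exact absurd h2 (not_lt.2 hnot)
  -- The remaining letters fix `α_s`, and the longest element makes it negative, so the common
  -- prefix already does. Hence the prefix of `q` through `s` is not reduced.
  have hdesc : cs.IsRightDescent (cs.wordProd (lp.take i)) s := by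
    apply isRightDescent_of_nonpos
    intro k
    have h1 := geomRep_simpleRoot_nonpos cs _ s (isRightDescent_longest cs s) k
    rwa [← ha.heapProd_eq, ← wordProd_ofFn_letter hw hc hp hmem, ← hlp, ← List.take_append_drop i lp,
      cs.wordProd_append, geomRep_mul_apply, geomRep_wordProd_of_commute cs hdrop] at h1
  have h1 := hredq.take (i + 1)
  have h2 : lq.take (i + 1) = lq.take i ++ [s] := by
    rw [List.take_succ_eq_append_getElem (by omega)]
    simp [hlq, hs]
  rw [h2, htake, CoxeterSystem.IsReduced, cs.wordProd_append, cs.wordProd_singleton,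
    List.length_append, List.length_singleton] at h1
  have h3 := hdesc
  have h4 := cs.length_wordProd_le (lp.take i)
  rw [CoxeterSystem.IsRightDescent] at h3
  omega

/-- The sorting word of the longest element consists of the letters of an initial ideal. -/
theorem mem_range_sortingPositions (hw : IsWordHeight cs c η) (hc : IsCoxeterWord c)
    (ha : IsLongestIdeal cs η a) (x : Pos c) :
    x ∈ Set.range (ofLex (sortingPositions cs hc (longest cs))) ↔
      ((ofLex x).1 : ℤ) < a (letter c x) := by
  obtain ⟨I, hI, hcard⟩ := exists_position_finset hc a
  rw [ha.card_eq] at hcard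
  let p : Lex (Fin (cs.length (longest cs)) → Pos c) := toLex (I.orderEmbOfFin hcard)
  have hmem : ∀ x, x ∈ Set.range (ofLex p) ↔ ((ofLex x).1 : ℤ) < a (letter c x) := by
    intro x
    rw [← hI x]
    exact Set.ext_iff.1 (Finset.range_orderEmbOfFin I hcard) x
  have hp : StrictMono (ofLex p) := (I.orderEmbOfFin hcard).strictMono
  have hp' : p ∈ reducedSubwords cs c (longest cs) :=
    ⟨hp, (wordProd_ofFn_letter hw hc hp hmem).trans ha.heapProd_eq⟩
  have h1 : ¬ p < sortingPositions cs hc (longest cs) :=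
    WellFounded.not_lt_min _ _ hp'
  have h2 := not_lt_of_mem_reducedSubwords hw hc ha hp hmem
    (WellFounded.min_mem (wellFounded_lt (α := Lex (Fin (cs.length (longest cs)) → Pos c)))
      (reducedSubwords cs c (longest cs)) (reducedSubwords_nonempty cs hc (longest cs)))
  have h3 : sortingPositions cs hc (longest cs) = p := le_antisymm (not_lt.1 h1) (not_lt.1 h2)
  rw [h3, hmem]

theorem strictMono_sortingPositions (hc : IsCoxeterWord c) (w : W) :
    StrictMono (ofLex (sortingPositions cs hc w)) :=
  (WellFounded.min_mem (wellFounded_lt (α := Lex (Fin (cs.length w) → Pos c)))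
    (reducedSubwords cs c w) (reducedSubwords_nonempty cs hc w)).1

end WordHeights

end CutPaths

namespace CutPaths

/-! ### The 2-cover as a cylinder -/

section Vertices

variable {B W : Type*} [Fintype B] [DecidableEq B] [Group W] {M : CoxeterMatrix B}
  {cs : CoxeterSystem M W} {c : List B} {η a : B → ℤ} [Finite W] {m : ℕ}

variable (cs) in
/-- The letter `(k, s)` that corresponds to a vertex of the 2-cover. -/
noncomputable def vertexCoord (hc : IsCoxeterWord c) (a : B → ℤ) :
    Fin (numLetters cs + numLetters cs) → ℤ × B :=
  Fin.append (fun k => posLetter c (ofLex (sortingPositions cs hc (longest cs)) k))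
    -- The generator `ψ(s)` has already occurred `a (ψ s)` times in the first half.
    (fun k => ((posLetter c (ofLex (sortingPositions cs hc (longest cs)) k)).1 +
        a (psiIndex cs (longestWord cs hc k)), psiIndex cs (longestWord cs hc k)))

theorem doubleWord_eq (hc : IsCoxeterWord c) (a : B → ℤ)
    (i : Fin (numLetters cs + numLetters cs)) :
    doubleWord cs hc i = cs.simple (vertexCoord cs hc a i).2 := by
  refine Fin.addCases (fun k => ?_) (fun k => ?_) i
  · rw [doubleWord, vertexCoord, Fin.append_left, Fin.append_left]
    rfl
  · rw [doubleWord, vertexCoord, Fin.append_right, Fin.append_right]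
    exact (simple_psiIndex cs _).symm

theorem longestWord_position_lt (hw : IsWordHeight cs c η) (hc : IsCoxeterWord c)
    (ha : IsLongestIdeal cs η a) (k : Fin (numLetters cs)) :
    0 ≤ (posLetter c (ofLex (sortingPositions cs hc (longest cs)) k)).1 ∧
      (posLetter c (ofLex (sortingPositions cs hc (longest cs)) k)).1 <
        a (longestWord cs hc k) :=
  ⟨by simp [posLetter], (mem_range_sortingPositions hw hc ha _).1 ⟨k, rfl⟩⟩

theorem lt_iff_vertexCoord_lt (hw : IsWordHeight cs c η) (hc : IsCoxeterWord c)
    (ha : IsLongestIdeal cs η a) (i : Fin (numLetters cs + numLetters cs)) :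
    (i : ℕ) < numLetters cs ↔ (vertexCoord cs hc a i).1 < a (vertexCoord cs hc a i).2 := by
  refine Fin.addCases (fun k => ?_) (fun k => ?_) i
  · rw [vertexCoord, Fin.append_left]
    exact iff_of_true k.2 (longestWord_position_lt hw hc ha k).2
  · rw [vertexCoord, Fin.append_right]
    have := (longestWord_position_lt hw hc ha k).1
    exact iff_of_false (by simp) (by dsimp only; omega)

theorem vertexCoord_fst_lt (hw : IsWordHeight cs c η) (hc : IsCoxeterWord c)
    (ha : IsLongestIdeal cs η a) {i j : Fin (numLetters cs + numLetters cs)} (hij : i < j)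
    (h : (vertexCoord cs hc a i).2 = (vertexCoord cs hc a j).2) :
    (vertexCoord cs hc a i).1 < (vertexCoord cs hc a j).1 := by
  by_cases hj : (j : ℕ) < numLetters cs
  · obtain ⟨k, rfl⟩ : ∃ k, i = Fin.castAdd _ k := ⟨⟨i, (Fin.lt_def.1 hij).trans hj⟩, rfl⟩
    obtain ⟨l, rfl⟩ : ∃ l, j = Fin.castAdd _ l := ⟨⟨j, hj⟩, rfl⟩
    simp only [vertexCoord, Fin.append_left] at h ⊢
    have hkl : k < l := hij
    have := posLetter_fst_lt_of_lt hc (strictMono_sortingPositions hc _ hkl) h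
    simpa [posLetter] using this
  · obtain ⟨l, rfl⟩ : ∃ l, j = Fin.natAdd _ l :=
      ⟨⟨j - numLetters cs, by omega⟩, by apply Fin.ext; simp; omega⟩
    by_cases hi : (i : ℕ) < numLetters cs
    · have h1 := (lt_iff_vertexCoord_lt hw hc ha i).1 hi
      rw [h] at h1
      exact h1.trans_le (not_lt.1 fun h2 => hj ((lt_iff_vertexCoord_lt hw hc ha _).2 h2))
    · obtain ⟨k, rfl⟩ : ∃ k, i = Fin.natAdd _ k :=
        ⟨⟨i - numLetters cs, by omega⟩, by apply Fin.ext; simp; omega⟩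
      simp only [vertexCoord, Fin.append_right] at h ⊢
      have hkl : k < l := by
        rw [Fin.lt_def] at hij ⊢
        simpa using hij
      have := posLetter_fst_lt_of_lt hc (strictMono_sortingPositions hc _ hkl)
        (psiIndex_injective cs h)
      rw [h]
      have h3 : ((ofLex (ofLex (sortingPositions cs hc (longest cs)) k)).1 : ℤ) <
        (ofLex (ofLex (sortingPositions cs hc (longest cs)) l)).1 := by exact_mod_cast this
      simpa [posLetter] using h3

theorem vertexCoord_injective (hw : IsWordHeight cs c η) (hc : IsCoxeterWord c)
    (ha : IsLongestIdeal cs η a) : Function.Injective (vertexCoord cs hc a) := by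
  intro i j hij
  rcases lt_trichotomy i j with h | h | h
  · exact absurd (vertexCoord_fst_lt hw hc ha h (by rw [hij])) (by rw [hij]; exact lt_irrefl _)
  · exact h
  · exact absurd (vertexCoord_fst_lt hw hc ha h (by rw [hij])) (by rw [hij]; exact lt_irrefl _)

/-- The first half fills the copies `0 ≤ k < a s` of `s`, and the second half continues with `a (ψ
s)` further copies, which ends at `m`. -/
theorem exists_vertexCoord_eq_iff (hw : IsWordHeight cs c η) (hc : IsCoxeterWord c)
    (ha : IsLongestIdeal cs η a) (ham : ∀ s, a s + a (psiIndex cs s) = m) (x : ℤ × B) :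
    (∃ i, vertexCoord cs hc a i = x) ↔ 0 ≤ x.1 ∧ x.1 < m := by
  have hex : ∀ y : ℤ × B, 0 ≤ y.1 → y.1 < a y.2 → ∃ k : Fin (numLetters cs),
      posLetter c (ofLex (sortingPositions cs hc (longest cs)) k) = y := by
    intro y hy1 hy2
    obtain ⟨p, rfl⟩ := exists_posLetter hc hy1
    obtain ⟨k, rfl⟩ := (mem_range_sortingPositions hw hc ha p).2 hy2
    exact ⟨k, rfl⟩
  constructor
  · rintro ⟨i, rfl⟩
    refine Fin.addCases (fun k => ?_) (fun k => ?_) i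
    · rw [vertexCoord, Fin.append_left]
      have h1 := longestWord_position_lt hw hc ha k
      have h2 := ham (longestWord cs hc k)
      have h3 := ha.nonneg (psiIndex cs (longestWord cs hc k))
      exact ⟨h1.1, by omega⟩
    · rw [vertexCoord, Fin.append_right]
      have h1 := longestWord_position_lt hw hc ha k
      have h2 := ham (longestWord cs hc k)
      have h3 := ha.nonneg (psiIndex cs (longestWord cs hc k))
      dsimp only
      omega
  · rintro ⟨h1, h2⟩
    by_cases h3 : x.1 < a x.2
    · obtain ⟨k, rfl⟩ := hex x h1 h3
      exact ⟨Fin.castAdd _ k, by rw [vertexCoord, Fin.append_left]⟩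
    · have h4 := ham x.2
      obtain ⟨k, hk⟩ := hex (x.1 - a x.2, psiIndex cs x.2) (by dsimp only; omega)
        (by dsimp only; omega)
      refine ⟨Fin.natAdd _ k, ?_⟩
      have h5 : longestWord cs hc k = psiIndex cs x.2 := congrArg Prod.snd hk
      rw [vertexCoord, Fin.append_right, hk, h5, psiIndex_psiIndex]
      exact Prod.ext (by dsimp only; omega) rfl

theorem occ_eq (hw : IsWordHeight cs c η) (hc : IsCoxeterWord c)
    (ha : IsLongestIdeal cs η a) (ham : ∀ s, a s + a (psiIndex cs s) = m)
    (i : Fin (numLetters cs + numLetters cs)) :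
    (occ cs hc i : ℤ) = (vertexCoord cs hc a i).1 := by
  have hrange := fun x => exists_vertexCoord_eq_iff hw hc ha ham x
  have h1 := (hrange _).1 ⟨i, rfl⟩
  have hiff : ∀ j, (j < i ∧ doubleWord cs hc j = doubleWord cs hc i) ↔
      ((vertexCoord cs hc a j).2 = (vertexCoord cs hc a i).2 ∧
        (vertexCoord cs hc a j).1 < (vertexCoord cs hc a i).1) := by
    intro j
    rw [doubleWord_eq hc a, doubleWord_eq hc a, (simple_injective cs).eq_iff]
    constructor
    · rintro ⟨h1, h2⟩
      exact ⟨h2, vertexCoord_fst_lt hw hc ha h1 h2⟩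
    · rintro ⟨h1, h2⟩
      refine ⟨?_, h1⟩
      rcases lt_trichotomy i j with h | h | h
      · exact absurd (vertexCoord_fst_lt hw hc ha h h1.symm) h2.not_gt
      · rw [h] at h2; exact absurd h2 (lt_irrefl _)
      · exact h
  obtain ⟨n, hn⟩ := Int.eq_ofNat_of_zero_le h1.1
  have himage : (fun j => (vertexCoord cs hc a j).1.toNat) ''
      {j | j < i ∧ doubleWord cs hc j = doubleWord cs hc i} = Set.Iio n := by
    ext k
    simp only [Set.mem_image, Set.mem_ofPred_eq, Set.mem_Iio, hiff]
    constructor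
    · rintro ⟨j, ⟨-, h3⟩, rfl⟩
      have := ((hrange _).1 ⟨j, rfl⟩).1
      omega
    · intro hk
      obtain ⟨j, hj⟩ := (hrange ((k : ℤ), (vertexCoord cs hc a i).2)).2
        ⟨by simp, by dsimp only; omega⟩
      refine ⟨j, ?_, ?_⟩
      · rw [hj, hn]; exact ⟨rfl, by simpa using hk⟩
      · rw [hj]; simp
  have hinj : Set.InjOn (fun j => (vertexCoord cs hc a j).1.toNat)
      {j | j < i ∧ doubleWord cs hc j = doubleWord cs hc i} := by
    intro j hj j' hj' hjj
    have h3 := ((hiff j).1 hj).1.trans ((hiff j').1 hj').1.symm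
    have h4 := ((hrange _).1 ⟨j, rfl⟩).1
    have h5 := ((hrange _).1 ⟨j', rfl⟩).1
    dsimp only at hjj
    exact vertexCoord_injective hw hc ha (Prod.ext (by omega) h3)
  rw [occ, ← hinj.ncard_image, himage, hn]
  simp [Set.ncard_eq_toFinset_card']

theorem exists_vertexProj (hw : IsWordHeight cs c η) (hc : IsCoxeterWord c)
    (ha : IsLongestIdeal cs η a) (hm : 0 < m) (ham : ∀ s, a s + a (psiIndex cs s) = m) :
    ∃ π : ℤ × B → Fin (numLetters cs + numLetters cs), ∀ x i,
      π x = i ↔ vertexCoord cs hc a i = (x.1 % m, x.2) := by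
  have hm' : (0 : ℤ) < m := by exact_mod_cast hm
  choose π hπ using fun x : ℤ × B =>
    (exists_vertexCoord_eq_iff hw hc ha ham (x.1 % m, x.2)).2
      ⟨Int.emod_nonneg _ hm'.ne', Int.emod_lt_of_pos _ hm'⟩
  refine ⟨π, fun x i => ⟨?_, fun h => vertexCoord_injective hw hc ha ((hπ x).trans h.symm)⟩⟩
  rintro rfl
  exact hπ x

theorem natLT_time_lt (hw : IsWordHeight cs c η) {x y : Pos c}
    (h : NatLT (fun x : Pos c => cs.simple (letter c x)) x y) :
    time η (posLetter c x) < time η (posLetter c y) := by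
  induction h with
  | single h => exact (hw.precedes_iff.2 h).1
  | tail _ h ih => exact ih.trans (hw.precedes_iff.2 h).1

/-- The Hasse diagram of the natural partial order of `c^∞`. -/
theorem natCovBy_iff (hw : IsWordHeight cs c η) (hc : IsCoxeterWord c) {x y : Pos c} :
    NatCovBy (fun x : Pos c => cs.simple (letter c x)) x y ↔
      HasseEdge (coxeterGraph cs) η (posLetter c x) (posLetter c y) := by
  have hη := hw.isHeight hc
  have hone : ∀ {x y : Pos c}, Precedes cs η (posLetter c x) (posLetter c y) →
      NatLT (fun x : Pos c => cs.simple (letter c x)) x y :=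
    fun h => Relation.TransGen.single (hw.precedes_iff.1 h)
  constructor
  · rintro ⟨h1, h2⟩
    have hstep : Precedes cs η (posLetter c x) (posLetter c y) := by
      rcases Relation.TransGen.head'_iff.1 h1 with ⟨z, hxz, hzy⟩
      rcases Relation.reflTransGen_iff_eq_or_transGen.1 hzy with rfl | hzy
      · exact hw.precedes_iff.2 hxz
      · exact absurd hzy (h2 z (Relation.TransGen.single hxz))
    refine ⟨hstep.2, ?_⟩
    -- Otherwise the times differ by at least three. Then the next letter of the generator of `y`
    -- after `x`, followed by the next letter of the generator of `x`, lies strictly between.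
    by_contra hne
    have hadj := hη _ _ hstep.2
    have hlt := hstep.1
    have hpos : 0 ≤ (posLetter c x).1 := by simp [posLetter]
    simp only [time] at hne hlt
    obtain ⟨j, hj⟩ : ∃ j : ℤ, time η (j, (posLetter c y).2) = time η (posLetter c x) + 1 := by
      simp only [time]
      rcases hadj with h | h
      · exact ⟨(posLetter c x).1, by omega⟩
      · exact ⟨(posLetter c x).1 + 1, by omega⟩
    simp only [time] at hj
    obtain ⟨z, hz⟩ := exists_posLetter hc (x := (j, (posLetter c y).2)) (by dsimp only; omega)
    obtain ⟨w, hw'⟩ := exists_posLetter hc (x := ((posLetter c x).1 + 1, (posLetter c x).2))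
      (by dsimp only; omega)
    refine h2 z (hone ⟨?_, ?_⟩) ((hone (y := w) ⟨?_, ?_⟩).trans (hone ⟨?_, ?_⟩))
    · rw [hz]; simp only [time]; omega
    · rw [hz]; exact hstep.2
    · rw [hz, hw']; simp only [time]; omega
    · rw [hz, hw']; exact fun h => hstep.2 h.symm
    · rw [hw']; simp only [time]; omega
    · rw [hw']; exact hstep.2
  · intro h
    refine ⟨hone ⟨by have := h.2; omega, h.1⟩, fun z hxz hzy => ?_⟩
    have h1 := natLT_time_lt hw hxz
    have h2 := natLT_time_lt hw hzy
    have h3 := h.2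
    omega

theorem projectsTo_iff (hw : IsWordHeight cs c η) (hc : IsCoxeterWord c)
    (ha : IsLongestIdeal cs η a) (ham : ∀ s, a s + a (psiIndex cs s) = m)
    (hcox : coxeterNumber cs c = m) (x : Pos c) (i : Fin (numLetters cs + numLetters cs)) :
    ProjectsTo cs hc x i ↔
      vertexCoord cs hc a i = ((posLetter c x).1 % m, (posLetter c x).2) := by
  rw [ProjectsTo, doubleWord_eq hc a, (simple_injective cs).eq_iff, hcox, Prod.ext_iff,
    ← occ_eq hw hc ha ham]
  simp only [posLetter]
  constructor
  · rintro ⟨h1, h2⟩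
    exact ⟨by rw [← h2]; simp, h1.symm⟩
  · rintro ⟨h1, h2⟩
    exact ⟨h2.symm, by exact_mod_cast h1.symm⟩

/-- The 2-cover is a cylinder. -/
theorem exists_isCylinder (hw : IsWordHeight cs c η) (hc : IsCoxeterWord c)
    (ha : IsLongestIdeal cs η a) (hm : 0 < m) (ham : ∀ s, a s + a (psiIndex cs s) = m)
    (hcox : coxeterNumber cs c = m) :
    ∃ π : ℤ × B → Fin (numLetters cs + numLetters cs),
      IsCylinder (coxeterGraph cs) η m π (twoCover cs hc) ∧
        ∀ x, π x ∈ psiVertices cs ↔ a x.2 ≤ x.1 % m := by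
  have hm' : (0 : ℤ) < m := by exact_mod_cast hm
  have hη := hw.isHeight hc
  obtain ⟨π, hπ⟩ := exists_vertexProj hw hc ha hm ham
  have hproj : ∀ x i, ProjectsTo cs hc x i ↔ π (posLetter c x) = i := by
    intro x i
    rw [projectsTo_iff hw hc ha ham hcox, hπ]
  have heq : ∀ x y, π x = π y ↔ x.2 = y.2 ∧ x.1 % m = y.1 % m := by
    intro x y
    rw [hπ, (hπ y _).1 rfl, Prod.ext_iff]
    dsimp only
    rw [and_comm, eq_comm (a := y.2), eq_comm (a := y.1 % _)]
  refine ⟨π, ⟨hη, hm, heq, ?_, ?_⟩, ?_⟩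
  · intro i
    refine ⟨vertexCoord cs hc a i, (hπ _ _).2 ?_⟩
    have h1 := (exists_vertexCoord_eq_iff hw hc ha ham _).1 ⟨i, rfl⟩
    rw [Int.emod_eq_of_lt h1.1 h1.2]
  · intro i j
    constructor
    · rintro ⟨x, y, hxy, hx, hy⟩
      exact ⟨_, _, (natCovBy_iff hw hc).1 hxy, (hproj x i).1 hx, (hproj y j).1 hy⟩
    · rintro ⟨x, y, hxy, rfl, rfl⟩
      have hle : x.1 ≤ y.1 := by
        have h2 := hxy.2
        simp only [time] at h2
        rcases hη _ _ hxy.1 with h3 | h3 <;> omega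
      -- A translation by whole periods brings the edge into `c^∞`, where copies are counted from
      -- `0`.
      have hnn : 0 ≤ x.1 + (x.1.natAbs : ℤ) * m := by
        have : (x.1.natAbs : ℤ) ≤ (x.1.natAbs : ℤ) * m := by nlinarith
        omega
      obtain ⟨p, hp⟩ := exists_posLetter hc
        (x := (x.1 + (x.1.natAbs : ℤ) * m, x.2)) hnn
      obtain ⟨q, hq⟩ := exists_posLetter hc
        (x := (y.1 + (x.1.natAbs : ℤ) * m, y.2)) (by dsimp only; omega)
      refine ⟨p, q, (natCovBy_iff hw hc).2 ?_, (hproj _ _).2 ?_, (hproj _ _).2 ?_⟩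
      · rw [hp, hq]
        exact hxy.translate _
      · rw [hp, heq]; simp
      · rw [hq, heq]; simp
  · intro x
    have h1 := lt_iff_vertexCoord_lt hw hc ha (π x)
    rw [(hπ x _).1 rfl] at h1
    dsimp only at h1
    rw [psiVertices, Set.mem_ofPred_eq, ← not_lt, h1, not_lt]

end Vertices

end CutPaths

namespace CutPaths

/-! ### Singletons and order ideals -/

section Singletons

variable {B W : Type*} [Group W] {M : CoxeterMatrix B} {cs : CoxeterSystem M W} {η : B → ℤ}

theorem CommStep.symm {u v : List B} (h : CommStep cs u v) : CommStep cs v u := by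
  obtain ⟨a, b, i, j, hij⟩ := h
  exact CommStep.swap a b j i hij.symm

/-- Letters of commuting generators are not compared by `Precedes`, so exchanging two adjacent ones
respects the order. -/
theorem CommStep.exists_isLinearExtension {u v : List B} (h : CommStep cs u v)
    {L : List (ℤ × B)} (hL : IsLinearExtension cs η L) (hu : L.map Prod.snd = u) :
    ∃ L', L'.Perm L ∧ IsLinearExtension cs η L' ∧ L'.map Prod.snd = v := by
  obtain ⟨a, b, i, j, hij⟩ := h
  obtain ⟨X, Z, rfl, rfl, h1⟩ := List.map_eq_append_iff.1 hu
  obtain ⟨x, Z, rfl, rfl, h2⟩ := List.map_eq_cons_iff.1 h1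
  obtain ⟨y, Y, rfl, rfl, rfl⟩ := List.map_eq_cons_iff.1 h2
  refine ⟨X ++ y :: x :: Y, (List.Perm.swap x y Y).append_left X, ?_, by simp⟩
  rw [IsLinearExtension, List.pairwise_append, List.pairwise_cons, List.pairwise_cons] at hL ⊢
  obtain ⟨h1, ⟨h3, h4, h5⟩, h6⟩ := hL
  refine ⟨h1, ⟨?_, fun z hz => h3 z (List.mem_cons_of_mem _ hz), h5⟩, ?_⟩
  · intro z hz
    rcases List.mem_cons.1 hz with rfl | hz
    · exact fun h => h.2 hij
    · exact h4 z hz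
  · intro z hz w hw
    refine h6 z hz w ?_
    simp only [List.mem_cons] at hw ⊢
    tauto

/-- Commutations of a word lift to commutations of a linear extension. -/
theorem CommEquiv.exists_isLinearExtension_iff {u v : List B} (h : CommEquiv cs u v)
    {L₀ : List (ℤ × B)} :
    (∃ L, L.Perm L₀ ∧ IsLinearExtension cs η L ∧ L.map Prod.snd = u) ↔
      ∃ L, L.Perm L₀ ∧ IsLinearExtension cs η L ∧ L.map Prod.snd = v := by
  have key : ∀ {u v : List B}, CommStep cs u v →
      (∃ L, L.Perm L₀ ∧ IsLinearExtension cs η L ∧ L.map Prod.snd = u) →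
      ∃ L, L.Perm L₀ ∧ IsLinearExtension cs η L ∧ L.map Prod.snd = v := by
    rintro u v h ⟨L, hp, hL, hu⟩
    obtain ⟨L', hp', hL', hv⟩ := h.exists_isLinearExtension hL hu
    exact ⟨L', hp'.trans hp, hL', hv⟩
  induction h with
  | rel u v h => exact ⟨key h, key h.symm⟩
  | refl u => exact Iff.rfl
  | symm u v _ ih => exact ih.symm
  | trans u v w _ _ ih1 ih2 => exact ih1.trans ih2

variable [Fintype B] [DecidableEq B]

/-- An order ideal of letters `(k, s)` inside an initial ideal is an initial ideal. -/
theorem exists_slice_of_closed (hη : IsHeight cs η) (hirr : ∀ s, ∃ t, (coxeterGraph cs).Adj s t)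
    {a : B → ℤ} (ha : IsIdeal cs η a) (ha0 : ∀ s, 0 ≤ a s) {J : Set (ℤ × B)}
    (hJ : ∀ x ∈ J, 0 ≤ x.1 ∧ x.1 < a x.2)
    (hclosed : ∀ x y, y ∈ J → 0 ≤ x.1 → x.1 < a x.2 → Precedes cs η x y → x ∈ J) :
    ∃ b : B → ℤ, IsSlice (coxeterGraph cs) η b ∧ (∀ s, 0 ≤ b s ∧ b s ≤ a s) ∧
      ∀ k s, (k, s) ∈ J ↔ 0 ≤ k ∧ k < b s := by
  have hclosed' : ∀ x y, y ∈ J → 0 ≤ x.1 → Precedes cs η x y → x ∈ J :=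
    fun x y hy hx h => hclosed x y hy hx (ha.mem_of_precedes h (hJ y hy).2) h
  -- Copies of one generator are comparable through the letter of a neighbour whose time lies
  -- between theirs.
  have hdown : ∀ (k : ℤ) s, 0 ≤ k → (k + 1, s) ∈ J → (k, s) ∈ J := by
    intro k s hk hks
    obtain ⟨t, ht⟩ := hirr s
    obtain ⟨j, hj, hjk⟩ : ∃ j : ℤ, time η (j, t) = time η (k, s) + 1 ∧ 0 ≤ j := by
      simp only [time]
      rcases hη _ _ ht with h | h
      · exact ⟨k, by omega, hk⟩
      · exact ⟨k + 1, by omega, by omega⟩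
    have h1 : (j, t) ∈ J := by
      refine hclosed' _ _ hks hjk ⟨?_, fun h => ht h.symm⟩
      simp only [time] at hj ⊢
      omega
    exact hclosed' _ _ h1 hk ⟨by omega, ht⟩
  have hdown' : ∀ (k : ℤ) s (n : ℕ), 0 ≤ k → (k + n, s) ∈ J → (k, s) ∈ J := by
    intro k s n hk
    induction n with
    | zero => simp
    | succ n ih =>
      intro h
      refine ih (hdown _ _ (by omega) ?_)
      rw [add_assoc]
      exact_mod_cast h
  choose b hb1 hb2 using fun s => Int.exists_least_of_bdd
    (P := fun k => 0 ≤ k ∧ (k, s) ∉ J) ⟨0, fun z hz => hz.1⟩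
    ⟨a s, ha0 s, fun h => lt_irrefl _ (hJ _ h).2⟩
  have hmem : ∀ k s, (k, s) ∈ J ↔ 0 ≤ k ∧ k < b s := by
    intro k s
    constructor
    · intro h
      refine ⟨(hJ _ h).1, ?_⟩
      by_contra hle
      obtain ⟨n, hn⟩ := Int.eq_ofNat_of_zero_le (sub_nonneg.2 (not_lt.1 hle))
      refine (hb1 s).2 (hdown' _ s n (hb1 s).1 ?_)
      rwa [← hn, add_sub_cancel]
    · rintro ⟨h1, h2⟩
      by_contra h
      exact absurd (hb2 s k ⟨h1, h⟩) (not_le.2 h2)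
  refine ⟨b, ?_, fun s => ⟨(hb1 s).1, hb2 s _ ⟨ha0 s, fun h => lt_irrefl _ (hJ _ h).2⟩⟩, hmem⟩
  have key : ∀ s t, (coxeterGraph cs).Adj s t → η t + 2 * b t ≤ η s + 2 * b s + 1 := by
    intro s t hst
    by_contra hlt
    have h1 := hη s t hst
    have h2 := (hb1 s).1
    have h3 : (b t - 1, t) ∈ J := (hmem _ _).2 ⟨by omega, by omega⟩
    exact (hb1 s).2 (hclosed' _ _ h3 h2 ⟨by simp only [time]; omega, hst⟩)
  intro s t hst
  have h1 := key s t hst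
  have h2 := key t s hst.symm
  have h3 := hη s t hst
  omega

variable [Finite W] {c : List B} {a : B → ℤ}

/-- A consecutive part of a reduced word is reduced: otherwise the longest element would be too
short. -/
theorem IsLongestIdeal.length_heapProd (hη : IsHeight cs η) (ha : IsLongestIdeal cs η a)
    {b d : B → ℤ} (hb : IsIdeal cs η b) (hd : IsIdeal cs η d) (h0 : ∀ s, 0 ≤ d s)
    (hdb : ∀ s, d s ≤ b s) (hba : ∀ s, b s ≤ a s) :
    cs.length (heapProd cs η (interval d b)) = (interval d b).card := by
  have h1 := heapProd_interval_mul hη (a := fun _ => 0) hb (fun s => (h0 s).trans (hdb s)) hba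
  have h2 := heapProd_interval_mul hη (a := fun _ => 0) hd h0 hdb
  have h3 := card_interval_add (a := fun _ => 0) (fun s => (h0 s).trans (hdb s)) hba
  have h4 := card_interval_add (a := fun _ => 0) h0 hdb
  rw [ha.heapProd_eq, h2] at h1
  have h5 := congrArg cs.length h1
  have h6 := cs.length_mul_le (heapProd cs η (interval (fun _ => 0) d) *
    heapProd cs η (interval d b)) (heapProd cs η (interval b a))
  have h7 := cs.length_mul_le (heapProd cs η (interval (fun _ => 0) d))
    (heapProd cs η (interval d b))
  have h8 := length_heapProd_le (cs := cs) (η := η) (interval (fun _ => 0) d)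
  have h9 := length_heapProd_le (cs := cs) (η := η) (interval d b)
  have h10 := length_heapProd_le (cs := cs) (η := η) (interval b a)
  have h11 := ha.card_eq
  omega

/-- After cancelling the common ideal `min b b'`, the two remaining products agree. A descent of
theirs would occur in both remainders, but no generator has letters in both; so the remainder of `b`
is empty. -/
theorem IsLongestIdeal.le_of_heapProd_eq (hη : IsHeight cs η) (ha : IsLongestIdeal cs η a)
    {b b' : B → ℤ} (hb : IsIdeal cs η b) (hb' : IsIdeal cs η b')
    (h0 : ∀ s, 0 ≤ b s ∧ b s ≤ a s) (h0' : ∀ s, 0 ≤ b' s ∧ b' s ≤ a s)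
    (h : heapProd cs η (interval (fun _ => 0) b) = heapProd cs η (interval (fun _ => 0) b'))
    (s : B) : b s ≤ b' s := by
  by_contra hlt
  let d : B → ℤ := fun s => min (b s) (b' s)
  have hd : IsIdeal cs η d := by
    intro s t hst
    have h1 := hb s t hst
    have h2 := hb' s t hst
    have h3 := hη s t hst
    simp only [d] at h1 h2 ⊢
    omega
  have hd0 : ∀ s, 0 ≤ d s := fun s => le_min (h0 s).1 (h0' s).1
  have hdb : ∀ s, d s ≤ b s := fun s => min_le_left _ _
  have hdb' : ∀ s, d s ≤ b' s := fun s => min_le_right _ _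
  rw [heapProd_interval_mul hη hd hd0 hdb, heapProd_interval_mul hη hd hd0 hdb',
    mul_right_inj] at h
  have hpos : 0 < (interval d b).card := by
    refine Finset.card_pos.2 ⟨(b' s, s), ?_⟩
    rw [mem_interval]
    simp only [d]
    omega
  have hne : heapProd cs η (interval d b) ≠ 1 := by
    intro h1
    have h2 := ha.length_heapProd hη hb hd hd0 hdb fun s => (h0 s).2
    rw [h1, cs.length_one] at h2
    omega
  obtain ⟨i, hi⟩ := cs.exists_rightDescent_of_ne_one hne
  have hletter : ∀ {e : B → ℤ}, cs.IsRightDescent (heapProd cs η (interval d e)) i →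
      ∃ k, (k, i) ∈ interval d e := by
    intro e he
    obtain ⟨⟨k, j⟩, hx, rfl⟩ := List.mem_map.1 (mem_of_isRightDescent cs he)
    exact ⟨k, mem_heapList.1 hx⟩
  obtain ⟨k, hk⟩ := hletter hi
  rw [h] at hi
  obtain ⟨k', hk'⟩ := hletter hi
  rw [mem_interval] at hk hk'
  simp only [d] at hk hk'
  omega

/-- The sorting word of the longest element is a linear extension of an initial ideal. -/
theorem exists_isLinearExtension_longestWord (hw : IsWordHeight cs c η) (hc : IsCoxeterWord c)
    (ha : IsLongestIdeal cs η a) :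
    ∃ L, L.Perm (heapList η (interval (fun _ => 0) a)) ∧ IsLinearExtension cs η L ∧
      L.map Prod.snd = List.ofFn (longestWord cs hc) := by
  set p := ofLex (sortingPositions cs hc (longest cs)) with hp
  have hmono : StrictMono p := strictMono_sortingPositions hc (longest cs)
  have hpair : (List.ofFn p).Pairwise (· < ·) := List.pairwise_ofFn.2 fun _ _ h => hmono h
  refine ⟨(List.ofFn p).map (posLetter c), ?_, hw.isLinearExtension_map hpair, ?_⟩
  · refine (List.perm_ext_iff_of_nodup ?_ (nodup_heapList _)).2 ?_
    · exact (hpair.imp fun h => h.ne).map _ fun _ _ h h' => h (posLetter_injective hc h')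
    · intro x
      rw [mem_heapList, mem_interval', List.mem_map]
      constructor
      · rintro ⟨y, hy, rfl⟩
        rw [List.mem_ofFn] at hy
        exact ⟨by simp [posLetter], (mem_range_sortingPositions hw hc ha y).1 hy⟩
      · intro hx
        obtain ⟨y, rfl⟩ := exists_posLetter hc hx.1
        exact ⟨y, List.mem_ofFn.2 ((mem_range_sortingPositions hw hc ha y).2 hx.2), rfl⟩
  · rw [List.map_map, List.map_ofFn]
    rfl

theorem isSingleton_heapProd (hw : IsWordHeight cs c η) (hc : IsCoxeterWord c)
    (ha : IsLongestIdeal cs η a) {b : B → ℤ} (hb : IsIdeal cs η b)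
    (h0 : ∀ s, 0 ≤ b s ∧ b s ≤ a s) :
    IsSingleton cs hc (heapProd cs η (interval (fun _ => 0) b)) := by
  have hη := hw.isHeight hc
  obtain ⟨L, hL1, hL2, hL3⟩ := exists_isLinearExtension_longestWord hw hc ha
  refine ⟨(heapList η (interval (fun _ => 0) b)).map Prod.snd, ?_, rfl,
    (heapList η (interval (fun _ => 0) b) ++ heapList η (interval b a)).map Prod.snd, ?_, ?_⟩
  · have h1 := ha.length_heapProd hη hb (isIdeal_zero hη) (fun _ => le_rfl)
      (fun s => (h0 s).1) fun s => (h0 s).2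
    rw [CoxeterSystem.IsReduced, List.length_map, length_heapList]
    exact h1
  · rw [← hL3]
    refine IsLinearExtension.commEquiv hη ?_ (isLinearExtension_append
      (isLinearExtension_heapList _) (isLinearExtension_heapList _) ?_) hL2
    · refine List.Perm.trans ?_ hL1.symm
      refine (List.perm_ext_iff_of_nodup ?_ (nodup_heapList _)).2 ?_
      · rw [List.nodup_append]
        refine ⟨nodup_heapList _, nodup_heapList _, ?_⟩
        rintro x hx y hy rfl
        rw [mem_heapList, mem_interval'] at hx hy
        omega
      · intro x
        rw [List.mem_append, mem_heapList, mem_heapList, mem_heapList, mem_interval',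
          mem_interval', mem_interval']
        have := h0 x.2
        omega
    · intro x hx y hy h
      rw [mem_heapList, mem_interval'] at hx hy
      have := hb.mem_of_precedes h hx.2
      omega
  · rw [List.map_append]
    exact List.prefix_append _ _

/-- Commutations of the sorting word lift to linear extensions of its letters, and a prefix of a
linear extension is an order ideal. -/
theorem IsSingleton.exists_slice (hw : IsWordHeight cs c η) {hc : IsCoxeterWord c}
    (hirr : ∀ s, ∃ t, (coxeterGraph cs).Adj s t) (ha : IsLongestIdeal cs η a) {w : W}
    (h : IsSingleton cs hc w) :
    ∃ b : B → ℤ, IsSlice (coxeterGraph cs) η b ∧ (∀ s, 0 ≤ b s ∧ b s ≤ a s) ∧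
      heapProd cs η (interval (fun _ => 0) b) = w := by
  have hη := hw.isHeight hc
  obtain ⟨u, -, rfl, v, hv, ⟨z, rfl⟩⟩ := h
  obtain ⟨L, hL1, hL2, hL3⟩ :=
    hv.exists_isLinearExtension_iff.2 (exists_isLinearExtension_longestWord hw hc ha)
  obtain ⟨X, Y, rfl, rfl, rfl⟩ := List.map_eq_append_iff.1 hL3
  have hmem : ∀ x, x ∈ X ++ Y ↔ 0 ≤ x.1 ∧ x.1 < a x.2 := by
    intro x
    rw [hL1.mem_iff, mem_heapList, mem_interval']
  have hpair := List.pairwise_append.1 hL2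
  obtain ⟨b, hb1, hb2, hb3⟩ := exists_slice_of_closed hη hirr ha.isIdeal ha.nonneg
    (J := {x | x ∈ X}) (fun x hx => (hmem x).1 (List.mem_append_left _ hx)) (by
      intro x y hy h1 h2 hxy
      rcases List.mem_append.1 ((hmem x).2 ⟨h1, h2⟩) with h | h
      · exact h
      · exact absurd hxy (hpair.2.2 y hy x h))
  refine ⟨b, hb1, hb2, (wordProd_eq_heapProd hη ?_ ?_ hpair.1).symm⟩
  · exact (List.nodup_append.1 (hL1.nodup_iff.2 (nodup_heapList _))).1
  · intro x
    rw [mem_interval']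
    exact hb3 x.1 x.2

/-- The singletons correspond to the slices below the initial ideal of the longest element. -/
theorem nonempty_singleton_equiv (hw : IsWordHeight cs c η) (hc : IsCoxeterWord c)
    (hirr : ∀ s, ∃ t, (coxeterGraph cs).Adj s t) (ha : IsLongestIdeal cs η a) :
    Nonempty ({b : B → ℤ // IsSlice (coxeterGraph cs) η b ∧ ∀ s, 0 ≤ b s ∧ b s ≤ a s} ≃
      {w : W // IsSingleton cs hc w}) := by
  have hη := hw.isHeight hc
  refine ⟨Equiv.ofBijective (fun b => ⟨heapProd cs η (interval (fun _ => 0) b.1),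
    isSingleton_heapProd hw hc ha b.2.1 b.2.2⟩) ⟨?_, ?_⟩⟩
  · intro b b' hbb
    have h := congrArg Subtype.val hbb
    dsimp only at h
    refine Subtype.ext (funext fun s => le_antisymm ?_ ?_)
    · exact ha.le_of_heapProd_eq hη b.2.1 b'.2.1 b.2.2 b'.2.2 h s
    · exact ha.le_of_heapProd_eq hη b'.2.1 b.2.1 b'.2.2 b.2.2 h.symm s
  · rintro ⟨w, hw'⟩
    obtain ⟨b, hb1, hb2, rfl⟩ := hw'.exists_slice hw hirr ha
    exact ⟨⟨b, hb1, hb2⟩, rfl⟩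

end Singletons

end CutPaths

/-! ### The bijection -/

theorem mainTheorem7 {B W : Type*} [Group W] [Finite W] [Nontrivial B] {M : CoxeterMatrix B}
    (cs : CoxeterSystem M W) (hirr : (CutPaths.coxeterGraph cs).Connected)
    (c : List B) (hc : CutPaths.IsCoxeterWord c) :
    Nonempty
      ({w : W // CutPaths.IsSingleton cs hc w} ≃
        {κ : Set (Fin (CutPaths.numLetters cs + CutPaths.numLetters cs) ×
              Fin (CutPaths.numLetters cs + CutPaths.numLetters cs)) //
          CutPaths.IsCutPath (CutPaths.twoCover cs hc) κ ∧
            Disjoint κ (CutPaths.inducedEdgeSet (CutPaths.twoCover cs hc)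
              (CutPaths.psiVertices cs))}) := by
  classical
  open CutPaths in
  let : Fintype B := ⟨c.toFinset, fun i => List.mem_toFinset.2 (hc.2 i)⟩
  have hT : (coxeterGraph cs).IsTree := coxeterGraph_isTree cs hirr
  obtain ⟨η, hw⟩ := exists_isWordHeight hc hT
  have hη := hw.isHeight hc
  obtain ⟨m, hm1, h0, hcard, hm⟩ := exists_layerProd_eq_longest hirr hη
  have hcox := hw.coxeterNumber_eq hc hirr hm1 hm h0 hcard
  have hzero := isIdeal_zero hη
  -- The slice `0` is the beginning of `c^∞`, so its Nakayama translate bounds the letters of the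
  -- sorting word.
  obtain ⟨h1, h2⟩ := heapProd_nakayama hη hm h0 hcard hzero
  have hpos := lt_nakayama hη hm h0 hcard hzero
  have ham : ∀ s, nakayama cs η m (fun _ => 0) s +
      nakayama cs η m (fun _ => 0) (psiIndex cs s) = m := by
    intro s
    have h3 := time_nakayama hm (fun _ => 0) s
    have h4 := time_nakayama hm (fun _ => 0) (psiIndex cs s)
    rw [psiIndex_psiIndex] at h4
    omega
  have ha : IsLongestIdeal cs η (nakayama cs η m fun _ => 0) :=
    ⟨hzero.nakayama hm, fun s => (hpos s).le, h1, h2⟩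
  obtain ⟨π, hC, hP⟩ := exists_isCylinder hw hc ha hm1 ham hcox
  obtain ⟨ρ, hρ, hcross⟩ := exists_noncrossing_order hT
    (fun ⟨f, hf, h01, h12, h03, h34, h05, h56⟩ =>
      not_exists_spider cs hirr f hf h01 h12 h03 h34 h05 h56) η (by
      intro s t h
      rcases hη s t h with h | h <;> rw [h] <;> simp)
  obtain ⟨e1⟩ := nonempty_singleton_equiv hw hc (exists_adj hirr) ha
  obtain ⟨e2⟩ := hC.nonempty_slice_equiv hirr (hC.cycle_length ρ hρ hcross) ha.isIdeal
    -- Since `a (ψ s)` is positive and `a s + a (ψ s) = m`, the strip meets every column of the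
    -- cylinder.
    (fun s => hpos s) (fun s => by have := hpos (psiIndex cs s); have := ham s; omega) hP
  exact ⟨e1.symm.trans e2⟩
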